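/- Let $2\le k<\ell$, $p\ge k$, $n=p\ell$ and $N=(k-1)(\ell-1)$. For a $k\times n$ matrix $X$ of rank $k$ (representing a point of $\mathrm{Gr}(k,n)$ over $\mathbb C$) let $\Delta_I(X)$ be its Plücker coordinates, with index sets read modulo $n$ and columns taken in increasing order in $\{1,\dots,n\}$. Let $\rho$ be the cyclic shift, induced by the signed circulant matrix with corner entry $(-1)^{k-1}$, so that $\Delta_I(\rho X)=\Delta_{I+1}(X)$. Let $\mathcal D=\mathcal D_n(k,\ell)$ be the distinguished component: the connected component of the fixed locus $\mathrm{Gr}(k,n)^{\rho^\ell}$ that contains the $\rho^\ell$-fixed points whose Plücker coordinates are all nonnegative. Identities between functions on $\mathcal D$ are understood in its homogeneous coordinate ring, i.e. on the affine cone. *Index sets.* For $1\le j\le k-1$, $1\le r\le \ell-1$ and $i=(j-1)(\ell-1)+r$ let $I_i=\{i,i+1,\dots,i+j-1\}\cup\{1+j\ell,1+(j+1)\ell,\dots,1+(k-1)\ell\}$, and let $I_{N+i}=\{i-k+1,\dots,i\}$ for $1\le i\le\ell$. For $0<s<k$ let $\eta_s$ be the $q$-binomial coefficient ${k \brack s}_q=\frac{[k]_q!}{[s]_q!\,[k-s]_q!}$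 with $[m]_q=\frac{q^{m/2}-q^{-m/2}}{q^{1/2}-q^{-1/2}}$, at $q^{1/2}=e^{\pi i/p}$. For $a\in\mathbb Z$ let $\langle a\rangle\in\{1,\dots,\ell\}$ be its residue modulo $\ell$. *Band matrices.* $\mathrm{Band}(k,\ell)$ is the space of matrices $M=(M_{i,j})_{i,j\in\mathbb Z}$ with $M_{i,j}=0$ unless $0\le j-i\le k$ and $M_{i+\ell,j+\ell}=M_{i,j}$. For $1\le i\le N$ let $x_i$ be the minor of $M$ with column set $\{k+i,\dots,(k-1)\ell+1\}$ and row set the $N-i+1$ largest elements of $\{j\in\{1,\dots,(k-1)\ell\}: j\not\equiv1 \bmod \ell\}$. Let $A,B$ be the $\ell\times\ell$ matrices with entries $A_{ij}=M_{i,j-\ell+k}$ if $j-\ell+k\ge1$ and $0$ otherwise, and $B_{ij}=M_{i,j+k}$; put $\tilde c_s=(-1)^{s(\ell-s)}[t^{\ell-s}]\det(tB+A)$. Define $\phi(X)_{i,j}=\Delta_{[i,i+k]\setminus j}(X)$ (zero when the index set is not a $k$-subset), $\tau(M)_{i,j}=M_{j,i+k}$, and $\phi'=\tau\circ\phi\circ\rho^{-k}$.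 **Part 1 (every $k$).** $\phi'$ maps $\mathcal D$ to $\mathrm{Band}(k,\ell)$, and on $\mathcal D$ $$(\phi')^*x_i=\Delta_{I_i}\prod_{b=i}^{N-1}\Delta_{I_{N+\langle b+k\rangle}}\quad(1\le i\le N),\qquad (\phi')^*M_{i,i}=(\phi')^*M_{i-k-1,i-1}=\Delta_{I_{N+\langle i-1\rangle}}\quad(i\in\mathbb Z).$$ **Part 2 ($k=2$ or $3$).** On $\mathcal D$, for $1\le s\le k-1$, $\;(\phi')^*\tilde c_s=\eta_s\prod_{i=1}^{\ell}\Delta_{I_{N+i}}.$ **Part 3 ($k=2$ or $3$).** Consider the following two seeds; in both, the mutable part is given by the quiver with arrows $\overline x_{i+1}\to \overline x_i\to \overline x_{i+\ell}\to \overline x_{i+1}$ ($1\le i\le N$), the vertices $1,\dots,N$ are mutable, vertex $1$ has exchange degree $k$, and the others have degree $1$; $B=(b_{ij})$ with $b_{ij}$ the number of arrows $i\to j$ minus the number of arrows $j\to i$. * $\Sigma_{\rm cyc}$: indeterminates $\overline x_1,\dots,\overline x_N$ (mutable), $\overline x_{N+1},\dots,\overline x_{N+\ell}$ (frozen vertices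 of the same quiver), and coefficient string variables $z_1,\dots,z_{k-1}$ with $z_s=z_{k-s}$ ($z_0=z_k=1$) at vertex $1$. The coefficient of $u^sv^{d-s}$ in the exchange polynomial at vertex $i$ of degree $d$ is $p_{i;s}=\zeta\prod_{j=N+1}^{N+\ell}\overline x_j^{\,s[b_{ji}]_++(d-s)[-b_{ji}]_+}$, where $\zeta=z_s$ if $i=1$ and $\zeta=1$ if $i\ge2$. Its coefficient group $\mathbb P_{\rm cyc}$ is generated by the $\overline x_{N+j}$ and the $z_s$. * $\Sigma_{\rm GSV}$ (Gekhtman–Shapiro–Vainshtein): mutable variables $x_1,\dots,x_N$, frozen variables $M_{i,i}$ and $M_{i,i+k}$ ($i$ modulo $\ell$), and $\tilde c_1,\dots,\tilde c_{k-1}$, all treated as independent indeterminates which are evaluated on $\mathrm{Band}(k,\ell)$ as above; $\mathbb P_{\rm GSV}$ is generated by the variables other than the $x_i$. The coefficients of the exchange polynomials are, at vertex $1$ and for $k\ge3$: $p_{1;0}=\prod_{i=1}^\ell M_{i,i}\prod_{i=2}^\ell M_{i,i+k}^{k-1}$, $p_{1;s}=\tilde c_{k-s}\prod_{i=2}^\ell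 M_{i,i+k}^{k-1-s}$ for $0<s<k$, $p_{1;k}=M_{1,k+1}$; at vertex $1$ and for $k=2$: $p_{1;0}=\prod_{1\le i\le\ell,\,i\ne2}M_{i,i}\prod_{i=2}^\ell M_{i,i+2}$, $p_{1;1}=\tilde c_1$, $p_{1;2}=M_{1,3}M_{2,2}$; at vertex $i\ge2$: $p_{i;0}=1$ and $p_{i;1}$ is the product of $M_{i,i+k}$ (if $i\le\ell$) and $M_{i+k-1,i+k-1}$ (if $i\ge N-\ell+2$). For a seed $\Sigma$ with coefficient group $\mathbb P$ let $\mathcal F_{>0}$ be the semifield of subtraction-free rational expressions in the cluster variables with coefficients in $\mathbb P$, and let $\hat y_{i;s}=\frac{p_{i;s}}{p_{i;0}}\big(\prod_{j\le N}x_j^{b_{ji}}\big)^s$. Then there is a homomorphism of semifields $\psi^*:\mathcal F_{>0,\rm GSV}\to\mathcal F_{>0,\rm cyc}$ with $$\psi^*(x_i)=\overline x_i\prod_{b=i}^{N-1}\overline x_{N+\langle b+k\rangle},\qquad \psi^*(M_{i,i})=\psi^*(M_{i-k-1,i-1})=\overline x_{N+\langle i-1\rangle},\qquad \psi^*(\tilde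 c_s)=z_s\prod_{i=1}^\ell\overline x_{N+i},$$ which is a quasi-homomorphism from $\Sigma_{\rm GSV}$ to $\Sigma_{\rm cyc}$, i.e. $\psi^*(\mathbb P_{\rm GSV})\subseteq\mathbb P_{\rm cyc}$, the exchange degrees agree, $\psi^*(x_i)/\overline x_i\in\mathbb P_{\rm cyc}$, and $\psi^*$ sends $\Sigma_{\rm GSV}$ to a seed with the same $\hat y_{i;s}$ as $\Sigma_{\rm cyc}$ for all $1\le i\le N$ and $1\le s\le d_i$ (where $d_i$ is the exchange degree of vertex $i$). Moreover it is realized by $\phi'$: for every $f\in\mathcal F_{>0,\rm GSV}$, the pullback $(\phi')^*f$ equals the specialization of $\psi^*(f)$ at $\overline x_i=\Delta_{I_i}$, $z_s=\eta_s$, at every point of $\mathcal D$ where $f$, as a rational function of the initial variables of $\Sigma_{\rm GSV}$, is defined at the image under $\phi'$. -/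

import Mathlib

noncomputable section

namespace CyclicLocus

open Finset Polynomial

/-! ### Grassmannian, cyclic shift, distinguished component

A point of the Grassmannian `Gr(k,n)` is represented by a `k × n` matrix of rank `k` (rows = a basis
of the subspace), so that Plücker coordinates become honest functions of the matrix and identities in
a homogeneous coordinate ring become identities of functions on the affine cone. The column with
number `i ∈ {1,…,n}` is the one indexed by the element `i - 1` of `Fin n`. -/

/-- The subset of `{1,…,n}` (as columns) obtained by reducing a set of integers modulo `n`. -/
def residues (n : ℕ) (I : Finset ℤ) : Finset (Fin n) :=
  univ.filter fun c => ∃ i ∈ I, ((c : ℕ) : ℤ) + 1 ≡ i [ZMOD n]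

/-- The maximal minor of `X` with column set `I` (columns in increasing order);
`0` when `I` is not a `k`-subset. -/
def maxMinor {k n : ℕ} (X : Matrix (Fin k) (Fin n) ℂ) (I : Finset (Fin n)) : ℂ :=
  if h : I.card = k then (X.submatrix id (I.orderEmbOfFin h)).det else 0

/-- The Plücker coordinate `Δ_I` with indices treated modulo `n`. -/
def plucker {k n : ℕ} (X : Matrix (Fin k) (Fin n) ℂ) (I : Finset ℤ) : ℂ :=
  maxMinor X (residues n I)

/-- The signed circulant matrix `ρ`. It acts on row vectors from the right, so that
`Δ_I (X * ρ) = Δ_{I+1} (X)`. -/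
def rho (k n : ℕ) : Matrix (Fin n) (Fin n) ℂ :=
  Matrix.of fun i j =>
    if (i : ℕ) = j + 1 then 1
    else if (i : ℕ) = 0 ∧ (j : ℕ) + 1 = n then (-1) ^ (k - 1)
    else 0

/-- The subspace represented by a matrix. -/
def rowSpan {k n : ℕ} (X : Matrix (Fin k) (Fin n) ℂ) : Submodule ℂ (Fin n → ℂ) :=
  Submodule.span ℂ (Set.range X.row)

/-- Matrices representing the points of `Gr(k,n)` that are fixed by `ρ ^ ℓ`. -/
def fixedLocus (k n ℓ : ℕ) : Set (Matrix (Fin k) (Fin n) ℂ) :=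
  {X | X.rank = k ∧ rowSpan (X * rho k n ^ ℓ) = rowSpan X}

/-- The point represented by `X` is totally nonnegative: up to a common nonzero factor, all its
Plücker coordinates are nonnegative reals. -/
def IsTNN {k n : ℕ} (X : Matrix (Fin k) (Fin n) ℂ) : Prop :=
  ∃ c : ℂ, c ≠ 0 ∧ ∀ I : Finset (Fin n), I.card = k → ∃ r : ℝ, 0 ≤ r ∧ maxMinor X I = c * r

/-- Matrices representing the points of the distinguished component `𝒟_n(k,ℓ)`: the connected
component of the `ρ ^ ℓ`-fixed locus that contains the totally nonnegative fixed points. (The space of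
matrices of rank `k` is a principal bundle over `Gr(k,n)` with connected fibre `GL_k(ℂ)`, so connected
components upstairs are the preimages of those downstairs.) -/
def distinguished (k n ℓ : ℕ) : Set (Matrix (Fin k) (Fin n) ℂ) :=
  {X | ∃ X₀ ∈ fixedLocus k n ℓ, IsTNN X₀ ∧ X ∈ connectedComponentIn (fixedLocus k n ℓ) X₀}

/-- The number `N = (k-1)(ℓ-1)` of mutable variables. -/
def numMutable (k ℓ : ℕ) : ℕ := (k - 1) * (ℓ - 1)

/-- The index sets `I_1, I_2, …`. For `i = (j-1)(ℓ-1) + r` with `1 ≤ j ≤ k-1`, `1 ≤ r ≤ ℓ-1`, one has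
`I_i = {i, …, i+j-1} ∪ {1+jℓ, 1+(j+1)ℓ, …, 1+(k-1)ℓ}`, and `I_{N+i} = {i-k+1, …, i}`. -/
def initSet (k ℓ i : ℕ) : Finset ℤ :=
  if i ≤ numMutable k ℓ then
    let j : ℕ := (i - 1) / (ℓ - 1) + 1
    Icc (i : ℤ) (i + j - 1) ∪ (Ico j k).image fun t : ℕ => 1 + (t : ℤ) * ℓ
  else
    Icc ((i : ℤ) - numMutable k ℓ - k + 1) ((i : ℤ) - numMutable k ℓ)

/-- The representative in `{1,…,ℓ}` of an integer modulo `ℓ`. -/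
def resIcc (ℓ : ℕ) (a : ℤ) : ℕ := ((a - 1) % ℓ).toNat + 1

/-- The number `[m]_q = (q^{m/2} - q^{-m/2}) / (q^{1/2} - q^{-1/2})` at `q = exp(2πi/p)`. -/
def qInt (p m : ℕ) : ℂ :=
  let h : ℂ := Complex.exp (Real.pi * Complex.I / p)
  (h ^ m - (h ^ m)⁻¹) / (h - h⁻¹)

/-- The `q`-factorial at `q = exp(2πi/p)`. -/
def qFactorial (p m : ℕ) : ℂ := ∏ j ∈ Icc 1 m, qInt p j

/-- The number `η_s`, the `q`-binomial coefficient `[k choose s]_q` at `q = exp(2πi/p)`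
(used for `0 < s < k ≤ p`, where the denominator does not vanish). -/
def eta (k p s : ℕ) : ℂ := qFactorial p k / (qFactorial p s * qFactorial p (k - s))

/-! ### Periodic band matrices -/

/-- The space `Band(k,ℓ)`. -/
def band (k ℓ : ℕ) : Set (Matrix ℤ ℤ ℂ) :=
  {M | (∀ i j : ℤ, ¬(0 ≤ j - i ∧ j - i ≤ k) → M i j = 0) ∧
    ∀ i j : ℤ, M (i + ℓ) (j + ℓ) = M i j}

/-- The map `φ`, `X ↦ (Δ_{[i,i+k] ∖ j}(X))_{i,j}`. -/
def phi {k n : ℕ} (X : Matrix (Fin k) (Fin n) ℂ) : Matrix ℤ ℤ ℂ :=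
  fun i j => plucker X ((Icc i (i + k)).erase j)

/-- The transpose of band matrices, `τ(M)_{i,j} = M_{j,i+k}`. -/
def tau (k : ℕ) (M : Matrix ℤ ℤ ℂ) : Matrix ℤ ℤ ℂ := fun i j => M j (i + k)

/-- The map `φ' = τ ∘ φ ∘ ρ^{-k}`. -/
def phi' {k n : ℕ} (X : Matrix (Fin k) (Fin n) ℂ) : Matrix ℤ ℤ ℂ :=
  tau k (phi (X * ((rho k n)⁻¹) ^ k))

/-- The minor of `M` with row set `R` and column set `C` (`0` if the sizes differ). -/
def minor (M : Matrix ℤ ℤ ℂ) (R C : Finset ℤ) : ℂ :=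
  if h : C.card = R.card then
    (M.submatrix (R.orderEmbOfFin rfl) (C.orderEmbOfFin h)).det
  else 0

/-- The `m` largest elements of a finite set of integers. -/
def largest (m : ℕ) (S : Finset ℤ) : Finset ℤ :=
  S.filter fun a => (S.filter fun b => a < b).card < m

/-- The row set `R_i`: the `N-i+1` largest elements of
`{j ∈ {1,…,(k-1)ℓ} : j ≢ 1 mod ℓ}`. -/
def initRows (k ℓ i : ℕ) : Finset ℤ :=
  largest (numMutable k ℓ - i + 1)
    ((Icc (1 : ℤ) (((k - 1 : ℕ) : ℤ) * ℓ)).filter fun j => ¬ j ≡ 1 [ZMOD ℓ])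

/-- The column set `C_i = {k+i, …, (k-1)ℓ+1}`. -/
def initCols (k ℓ i : ℕ) : Finset ℤ := Icc ((k : ℤ) + i) (((k - 1 : ℕ) : ℤ) * ℓ + 1)

/-- The value at `M` of the initial mutable variable `x_i` of the structure on band matrices. -/
def initMinor (k ℓ i : ℕ) (M : Matrix ℤ ℤ ℂ) : ℂ := minor M (initRows k ℓ i) (initCols k ℓ i)

/-- The matrix `A`: its entry in row `i`, column `j` (`1 ≤ i, j ≤ ℓ`) is `M_{i,j-ℓ+k}` if
`j - ℓ + k ≥ 1`, and `0` otherwise. -/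
def matA (k ℓ : ℕ) (M : Matrix ℤ ℤ ℂ) : Matrix (Fin ℓ) (Fin ℓ) ℂ :=
  Matrix.of fun a b =>
    let i : ℤ := (a : ℕ) + 1
    let j : ℤ := (b : ℕ) + 1
    if 1 ≤ j - ℓ + k then M i (j - ℓ + k) else 0

/-- The matrix `B`: its entry in row `i`, column `j` (`1 ≤ i, j ≤ ℓ`) is `M_{i,j+k}`. -/
def matB (k ℓ : ℕ) (M : Matrix ℤ ℤ ℂ) : Matrix (Fin ℓ) (Fin ℓ) ℂ :=
  Matrix.of fun a b => M ((a : ℕ) + 1) ((b : ℕ) + 1 + k)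

/-- The regular function `c_s = [t^{ℓ-s}] det(tB + A)`. -/
def charCoeff (k ℓ s : ℕ) (M : Matrix ℤ ℤ ℂ) : ℂ :=
  (((X : ℂ[X]) • (matB k ℓ M).map C + (matA k ℓ M).map C).det).coeff (ℓ - s)

/-- The coefficient string variable `c̃_s = (-1)^{s(ℓ-s)} c_s`. -/
def coeffString (k ℓ s : ℕ) (M : Matrix ℤ ℤ ℂ) : ℂ :=
  (-1) ^ (s * (ℓ - s)) * charCoeff k ℓ s M

/-! ### Non-normalized generalized seeds and quasi-homomorphisms -/

/-- The data of a non-normalized generalized seed of rank `N` with elements in a field `K`; only the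
indices in `{1,…,N}`, and `p i s` with `0 ≤ s ≤ d i`, matter. -/
structure CSSeed (K : Type) where
  /-- the cluster -/
  x : ℕ → K
  /-- the exchange matrix -/
  B : ℕ → ℕ → ℤ
  /-- the exchange degrees -/
  d : ℕ → ℕ
  /-- the coefficient strings -/
  p : ℕ → ℕ → K

namespace CSSeed

variable {K K' : Type} [Field K] [Field K']

/-- The exchange degrees are positive, the coefficients lie in the coefficient group, and the exchange
matrix is skew-symmetrizable. -/
def IsSeedOver (N : ℕ) (P : Set K) (S : CSSeed K) : Prop :=
  (∀ i ∈ Icc 1 N, 1 ≤ S.d i ∧ ∀ s ≤ S.d i, S.p i s ∈ P) ∧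
  ∃ r : ℕ → ℤ, (∀ i, 0 < r i) ∧ ∀ i ∈ Icc 1 N, ∀ j ∈ Icc 1 N, r i * S.B i j = -(r j * S.B j i)

/-- The exchange monomial `M_i^+`. -/
def monPos (N : ℕ) (S : CSSeed K) (i : ℕ) : K := ∏ j ∈ Icc 1 N, S.x j ^ (S.B j i).toNat

/-- The exchange monomial `M_i^-`. -/
def monNeg (N : ℕ) (S : CSSeed K) (i : ℕ) : K := ∏ j ∈ Icc 1 N, S.x j ^ (-S.B j i).toNat

/-- `ŷ_{i;s} = (p_{i;s} / p_{i;0}) (M_i^+ / M_i^-)^s`. -/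
def yhat (N : ℕ) (S : CSSeed K) (i s : ℕ) : K :=
  S.p i s / S.p i 0 * (S.monPos N i / S.monNeg N i) ^ s

/-- The relation `S ∼ S'` over the coefficient group `P`. -/
def Equivalent (N : ℕ) (P : Set K) (S S' : CSSeed K) : Prop :=
  ∀ i ∈ Icc 1 N, S.d i = S'.d i ∧ S.x i / S'.x i ∈ P ∧
    ∀ s ∈ Icc 1 (S.d i), S.yhat N i s = S'.yhat N i s

/-- The image of a seed under a map of ambient (semi)fields. -/
def map (ψ : K → K') (S : CSSeed K) : CSSeed K' where
  x i := ψ (S.x i)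
  B := S.B
  d := S.d
  p i s := ψ (S.p i s)

end CSSeed

section

variable {K K' : Type} [Field K] [Field K']

/-- The multiplicative group of Laurent monomials in a set of (nonzero) elements of a field. -/
def laurentMonomials (G : Set K) : Set K :=
  {f | ∃ u ∈ Subgroup.closure {u : Kˣ | (u : K) ∈ G}, f = u}

/-- Subtraction-free rational expressions in a set of elements of a field. -/
inductive SubtractionFree (G : Set K) : K → Prop
  | of {f : K} : f ∈ G → SubtractionFree G f
  | add {f g : K} : SubtractionFree G f → SubtractionFree G g → SubtractionFree G (f + g)
  | mul {f g : K} : SubtractionFree G f → SubtractionFree G g → SubtractionFree G (f * g)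
  | div {f g : K} : SubtractionFree G f → SubtractionFree G g → SubtractionFree G (f / g)

/-- The ambient semifield `F_{>0}` of a seed `S` over the coefficient group `P`: subtraction-free
rational expressions in the cluster variables with coefficients in `P`. -/
def ambient (N : ℕ) (P : Set K) (S : CSSeed K) : Set K :=
  {f | SubtractionFree ({g | ∃ i ∈ Icc 1 N, g = S.x i} ∪ P) f}

/-- `ψ` (of which only the values on the ambient semifield of `S` matter) is a quasi-homomorphism from
the generalized cluster algebra of the seed `S` over `P` to that of the seed `S'` over `P'`:
a homomorphism of ambient semifields with `ψ(P) ⊆ P'` and `ψ(S) ∼ S'`. -/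
structure IsQuasiHom (N : ℕ) (P : Set K) (S : CSSeed K) (P' : Set K') (S' : CSSeed K')
    (ψ : K → K') : Prop where
  source : S.IsSeedOver N P
  target : S'.IsSeedOver N P'
  mapsTo : ∀ f ∈ ambient N P S, ψ f ∈ ambient N P' S'
  map_add : ∀ f ∈ ambient N P S, ∀ g ∈ ambient N P S, ψ (f + g) = ψ f + ψ g
  map_mul : ∀ f ∈ ambient N P S, ∀ g ∈ ambient N P S, ψ (f * g) = ψ f * ψ g
  map_coeff : ∀ f ∈ P, ψ f ∈ P'
  equivalent : (S.map ψ).Equivalent N P' S'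

end

/-- The rational function `f` in indeterminates `V` is defined at the point `a`, with value `c`. -/
def HasValueAt {V : Type} (a : V → ℂ) (f : FractionRing (MvPolynomial V ℂ)) (c : ℂ) : Prop :=
  ∃ g h : MvPolynomial V ℂ, MvPolynomial.eval a h ≠ 0 ∧
    f * algebraMap _ _ h = algebraMap _ _ g ∧
    c = MvPolynomial.eval a g / MvPolynomial.eval a h

/-! ### The two seeds -/

/-- The extended quiver with arrows `x_{i+1} → x_i → x_{i+ℓ} → x_{i+1}`, `1 ≤ i ≤ N`:
number of arrows from `a` to `b`. -/
def arrows (k ℓ a b : ℕ) : ℤ :=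
  ∑ i ∈ Icc 1 (numMutable k ℓ),
    ((if a = i + 1 ∧ b = i then 1 else 0) + (if a = i ∧ b = i + ℓ then 1 else 0)
      + (if a = i + ℓ ∧ b = i + 1 then 1 else 0))

/-- The extended exchange matrix of that quiver. -/
def exchange (k ℓ a b : ℕ) : ℤ := arrows k ℓ a b - arrows k ℓ b a

/-- The exchange degrees: `x_1` is the only special variable, of degree `k`. -/
def degree (k i : ℕ) : ℕ := if i = 1 then k else 1

/-- Initial variables of `𝒜_cyc(k,ℓ)`: mutable `x̄_1,…,x̄_N`, frozen `x̄_{N+j}` with `j` modulo `ℓ`, and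
coefficient string variables `z_1,…,z_{⌊k/2⌋}` (the others are `z_s = z_{k-s}`). -/
inductive CycVar (k ℓ : ℕ) : Type
  | x (i : Set.Icc 1 (numMutable k ℓ))
  | frozen (j : ZMod ℓ)
  | z (s : Set.Icc 1 (k / 2))

/-- The field generated by the initial variables of `𝒜_cyc(k,ℓ)`. -/
abbrev CycField (k ℓ : ℕ) : Type := FractionRing (MvPolynomial (CycVar k ℓ) ℂ)

/-- An initial variable as an element of the field. -/
def cycVar {k ℓ : ℕ} (v : CycVar k ℓ) : CycField k ℓ :=
  algebraMap (MvPolynomial (CycVar k ℓ) ℂ) _ (MvPolynomial.X v)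

/-- The extended cluster variable `x̄_i`, `1 ≤ i ≤ N + ℓ`. -/
def cycX (k ℓ i : ℕ) : CycField k ℓ :=
  if h : 1 ≤ i ∧ i ≤ numMutable k ℓ then cycVar (.x ⟨i, h⟩)
  else cycVar (.frozen ((i - numMutable k ℓ : ℕ) : ZMod ℓ))

/-- The coefficient string variable `z_s`, with `z_0 = z_k = 1` and `z_s = z_{k-s}`. -/
def cycZ (k ℓ s : ℕ) : CycField k ℓ :=
  if h : 1 ≤ min s (k - s) ∧ min s (k - s) ≤ k / 2 then cycVar (.z ⟨min s (k - s), h⟩) else 1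

/-- The coefficient group of `𝒜_cyc(k,ℓ)`. -/
def cycCoeff (k ℓ : ℕ) : Set (CycField k ℓ) :=
  laurentMonomials (Set.range (fun j => cycVar (.frozen j)) ∪ Set.range (fun s => cycVar (.z s)))

/-- The initial seed of `𝒜_cyc(k,ℓ)`, viewed as a non-normalized seed by absorbing the frozen
variables in the coefficient strings. -/
def cycSeed (k ℓ : ℕ) : CSSeed (CycField k ℓ) where
  x := cycX k ℓ
  B := exchange k ℓ
  d := degree k
  p i s := (if i = 1 then cycZ k ℓ s else 1) *
    ∏ j ∈ Icc (numMutable k ℓ + 1) (numMutable k ℓ + ℓ),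
      cycX k ℓ j ^ (s * (exchange k ℓ j i).toNat + (degree k i - s) * (-exchange k ℓ j i).toNat)

/-- Initial variables of `𝒜_GSV(k,ℓ)`: mutable `x_1,…,x_N`, frozen entries `M_{j,j}` and `M_{j,j+k}` with
`j` modulo `ℓ`, and coefficient string variables `c̃_1,…,c̃_{k-1}`. -/
inductive GSVVar (k ℓ : ℕ) : Type
  | x (i : Set.Icc 1 (numMutable k ℓ))
  | diag (j : ZMod ℓ)
  | outer (j : ZMod ℓ)
  | c (s : Set.Icc 1 (k - 1))

/-- The field generated by the initial variables of `𝒜_GSV(k,ℓ)`. -/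
abbrev GSVField (k ℓ : ℕ) : Type := FractionRing (MvPolynomial (GSVVar k ℓ) ℂ)

/-- An initial variable as an element of the field. -/
def gsvVar {k ℓ : ℕ} (v : GSVVar k ℓ) : GSVField k ℓ :=
  algebraMap (MvPolynomial (GSVVar k ℓ) ℂ) _ (MvPolynomial.X v)

/-- The mutable variable `x_i`, `1 ≤ i ≤ N`. -/
def gsvX (k ℓ i : ℕ) : GSVField k ℓ :=
  if h : 1 ≤ i ∧ i ≤ numMutable k ℓ then gsvVar (.x ⟨i, h⟩) else 1

/-- The frozen variable `M_{i,i}`. -/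
def gsvDiag (k ℓ : ℕ) (i : ℤ) : GSVField k ℓ := gsvVar (.diag (i : ZMod ℓ))

/-- The frozen variable `M_{i,i+k}`. -/
def gsvOuter (k ℓ : ℕ) (i : ℤ) : GSVField k ℓ := gsvVar (.outer (i : ZMod ℓ))

/-- The coefficient string variable `c̃_s`, `1 ≤ s ≤ k - 1`. -/
def gsvC (k ℓ s : ℕ) : GSVField k ℓ :=
  if h : 1 ≤ s ∧ s ≤ k - 1 then gsvVar (.c ⟨s, h⟩) else 1

/-- The coefficient group of `𝒜_GSV(k,ℓ)`. -/
def gsvCoeff (k ℓ : ℕ) : Set (GSVField k ℓ) :=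
  laurentMonomials (Set.range (fun j => gsvVar (.diag j)) ∪ Set.range (fun j => gsvVar (.outer j)) ∪
    Set.range (fun s => gsvVar (.c s)))

/-- The coefficients of the initial exchange polynomials of `𝒜_GSV(k,ℓ)`. For the special variable and
`k ≥ 3` the exchange relation is
`x_1 x_1' = ∏_{1≤i≤ℓ} M_{i,i} ∏_{2≤i≤ℓ} M_{i,i+k}^{k-1} x_{ℓ+1}^k
  + ∑_{0<s<k} c̃_{k-s} ∏_{2≤i≤ℓ} M_{i,i+k}^{k-1-s} x_2^s x_{ℓ+1}^{k-s} + M_{1,k+1} x_2^k`;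
for `k = 2`, where there is no mutable `x_{ℓ+1}`, it is
`x_1 x_1' = ∏_{i≠2} M_{i,i} ∏_{2≤i≤ℓ} M_{i,i+2} + c̃_1 x_2 + M_{1,3} M_{2,2} x_2^2`.
For `2 ≤ i ≤ N` it is `x_i x_i' = M_i^- + p M_i^+`, where `p` is the product of `M_{i,i+k}` (present when
`i ≤ ℓ`) and of `M_{i+k-1,i+k-1}` (present when `N - ℓ + 2 ≤ i`). -/
def gsvP (k ℓ i s : ℕ) : GSVField k ℓ :=
  if i = 1 then
    if k = 2 then
      if s = 0 then
        (∏ a ∈ (Icc 1 ℓ).erase 2, gsvDiag k ℓ a) * ∏ a ∈ Icc 2 ℓ, gsvOuter k ℓ a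
      else if s = 1 then gsvC k ℓ 1
      else gsvOuter k ℓ 1 * gsvDiag k ℓ 2
    else
      if s = 0 then
        (∏ a ∈ Icc 1 ℓ, gsvDiag k ℓ a) * ∏ a ∈ Icc 2 ℓ, gsvOuter k ℓ a ^ (k - 1)
      else if s < k then gsvC k ℓ (k - s) * ∏ a ∈ Icc 2 ℓ, gsvOuter k ℓ a ^ (k - 1 - s)
      else gsvOuter k ℓ 1
  else if s = 0 then 1
  else (if i ≤ ℓ then gsvOuter k ℓ i else 1) *
    (if numMutable k ℓ + 2 ≤ i + ℓ then gsvDiag k ℓ (i + k - 1) else 1)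

/-- The initial seed of `𝒜_GSV(k,ℓ)`. -/
def gsvSeed (k ℓ : ℕ) : CSSeed (GSVField k ℓ) where
  x := gsvX k ℓ
  B := exchange k ℓ
  d := degree k
  p := gsvP k ℓ

/-- The values at a band matrix of the initial variables of `𝒜_GSV(k,ℓ)`. -/
def gsvPoint (k ℓ : ℕ) (M : Matrix ℤ ℤ ℂ) : GSVVar k ℓ → ℂ
  | .x i => initMinor k ℓ i M
  | .diag j => M j.val j.val
  | .outer j => M j.val (j.val + k)
  | .c s => coeffString k ℓ s M

/-- The values of the initial variables of `𝒜_cyc(k,ℓ)` after the identification `x̄_i = Δ_{I_i}` and the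
specialization `z_s = η_s`. -/
def cycPoint {k n : ℕ} (ℓ p : ℕ) (X : Matrix (Fin k) (Fin n) ℂ) : CycVar k ℓ → ℂ
  | .x i => plucker X (initSet k ℓ i)
  | .frozen j => plucker X (initSet k ℓ (numMutable k ℓ + resIcc ℓ j.val))
  | .z s => eta k p s

/-- The defining formulas of `ψ^*` on the cluster variables and the frozen entries. -/
def PsiOnVariables (k ℓ : ℕ) (ψ : GSVField k ℓ → CycField k ℓ) : Prop :=
  (∀ i ∈ Icc 1 (numMutable k ℓ), ψ (gsvX k ℓ i) =
    cycX k ℓ i * ∏ b ∈ Ico i (numMutable k ℓ), cycX k ℓ (numMutable k ℓ + resIcc ℓ (b + k))) ∧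
  ∀ i : ℤ, ψ (gsvDiag k ℓ i) = cycX k ℓ (numMutable k ℓ + resIcc ℓ (i - 1)) ∧
    ψ (gsvOuter k ℓ (i - k - 1)) = cycX k ℓ (numMutable k ℓ + resIcc ℓ (i - 1))

/-- The defining formulas of `ψ^*` on the coefficient string variables. -/
def PsiOnCoefficients (k ℓ : ℕ) (ψ : GSVField k ℓ → CycField k ℓ) : Prop :=
  ∀ s ∈ Icc 1 (k - 1), ψ (gsvC k ℓ s) =
    cycZ k ℓ s * ∏ i ∈ Icc 1 ℓ, cycX k ℓ (numMutable k ℓ + i)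

end CyclicLocus

end

open CyclicLocus

/-!
The shift `ρ^ℓ` acts on the subspace represented by a point of its fixed locus. Its characteristic
polynomial there is continuous in the point and takes finitely many values, so it is constant on
the connected set `𝒟` and can be computed at a totally nonnegative fixed point. By the
Vandermonde formula, the eigenvectors of `ρ` with eigenvalues `exp(πi (k - 1 - 2j) / n)`,
`0 ≤ j < k`, form a matrix whose maximal minors are all positive up to a common factor. By
Cauchy-Binet it pairs nondegenerately with a totally nonnegative point, on which `ρ^ℓ` therefore
has the eigenvalues `exp(πi (k - 1 - 2j) / p)`. Their product is `1`, which makes the Plücker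
coordinates `ℓ`-periodic and `φ'(X)` a band matrix.

The entries of `φ'(X)` are, up to sign, the coefficients of the linear relations between `k + 1`
consecutive columns of `X`, so by duality the minors `x_i` are complementary minors of `X` times
frozen ones. The same relations turn `det(tB + A)` into the characteristic polynomial of `ρ^ℓ`
times the product of the frozen coordinates. As the eigenvalues form a geometric progression, the
Gauss binomial formula produces the `η_s`.

The map `ψ^*` substitutes monomials in the variables of `Σ_cyc` for those of `Σ_GSV`. Since
`ψ^*(x_i) / x̄_i` is a product over a final segment of the indices, the comparison of the `ŷ_{i;s}`
telescopes.
-/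

noncomputable section

namespace CyclicLocus

open Finset Polynomial

/-! ### The cyclic shift and Plücker coordinates -/

section Columns

variable {k n : ℕ}

theorem vecMul_rho_of_lt (x : Fin n → ℂ) {c : Fin n} (h : (c : ℕ) + 1 < n) :
    Matrix.vecMul x (rho k n) c = x ⟨c + 1, h⟩ := by
  rw [Matrix.vecMul, dotProduct, sum_eq_single ⟨c + 1, h⟩ _ (by simp)]
  · simp [rho]
  · intro b _ hb
    have hbc : (b : ℕ) ≠ c + 1 := fun h' => hb (Fin.ext h')
    simp [rho, hbc, h.ne]

theorem vecMul_rho_of_eq (x : Fin n → ℂ) {c : Fin n} (h : (c : ℕ) + 1 = n) :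
    Matrix.vecMul x (rho k n) c = (-1) ^ (k - 1) * x ⟨0, c.pos⟩ := by
  have hbc : ∀ b : Fin n, (b : ℕ) ≠ c + 1 := fun b => by omega
  rw [Matrix.vecMul, dotProduct, sum_eq_single ⟨0, c.pos⟩ _ (by simp)]
  · simp [rho, h, c.pos.ne, mul_comm]
  · intro b _ hb
    have hb0 : (b : ℕ) ≠ 0 := fun h' => hb (Fin.ext h')
    simp [rho, hbc, hb0]

theorem isUnit_rho : IsUnit (rho k n) := by
  rw [← Matrix.vecMul_injective_iff_isUnit]
  intro x y hxy
  ext b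
  rcases Nat.eq_zero_or_eq_succ_pred b with hb | hb
  · have hlast : n - 1 + 1 = n := Nat.sub_add_cancel b.pos
    have h := congrFun hxy ⟨n - 1, Nat.sub_lt b.pos one_pos⟩
    simp only [vecMul_rho_of_eq _ (c := ⟨n - 1, _⟩) hlast] at h
    rw [show b = ⟨0, b.pos⟩ from Fin.ext hb]
    exact mul_left_cancel₀ (pow_ne_zero _ (by norm_num)) h
  · have hlt : (b : ℕ).pred + 1 < n := hb ▸ b.2
    have h := congrFun hxy ⟨(b : ℕ).pred, by omega⟩
    simp only [vecMul_rho_of_lt _ (c := ⟨(b : ℕ).pred, _⟩) hlt] at h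
    rwa [show b = ⟨(b : ℕ).pred + 1, hlt⟩ from Fin.ext hb]

variable [NeZero n]

/-- The column number `a` of a matrix with `n` columns, counted from `1` and read modulo `n`. -/
def colIndex (n : ℕ) [NeZero n] (a : ℤ) : Fin n :=
  ⟨((a - 1) % n).toNat, by
    have := Int.emod_lt_of_pos (a - 1) (Int.natCast_pos.2 (NeZero.pos n))
    have := NeZero.pos n
    omega⟩

theorem val_colIndex (a : ℤ) : ((colIndex n a : ℕ) : ℤ) = (a - 1) % n :=
  Int.toNat_of_nonneg (Int.emod_nonneg _ (by simp [NeZero.ne n]))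

theorem colIndex_eq_iff {a : ℤ} {c : Fin n} : colIndex n a = c ↔ (c : ℤ) + 1 ≡ a [ZMOD n] := by
  have hc : (c : ℤ) % n = c := Int.emod_eq_of_lt (by positivity) (by exact_mod_cast c.2)
  obtain ⟨b, rfl⟩ : ∃ b, a = b + 1 := ⟨a - 1, by ring⟩
  rw [← Fin.val_inj, ← Int.natCast_inj, val_colIndex, add_sub_cancel_right]
  exact ⟨fun h => Int.ModEq.add_right 1 (hc.trans h.symm),
    fun h => Eq.trans (Int.ModEq.add_right_cancel' 1 h).symm hc⟩

theorem colIndex_add_period (a : ℤ) : colIndex n (a + n) = colIndex n a :=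
  colIndex_eq_iff.2 ((colIndex_eq_iff.1 rfl).trans (by simp [Int.ModEq]))

theorem colIndex_natCast_add_one (c : Fin n) : colIndex n (c + 1) = c :=
  colIndex_eq_iff.2 rfl

theorem residues_eq_image (I : Finset ℤ) : residues n I = I.image (colIndex n) := by
  ext c
  simp [residues, colIndex_eq_iff]

/-- The columns `v_a` of a `k × n` matrix, numbered by all integers: `v_1, …, v_n` are the actual
columns and `v_{a+n} = (-1)^{k-1} v_a`. With this sign the maximal minors of the columns in a
window of length `n` are the Plücker coordinates, wherever the window starts. -/
def col (X : Matrix (Fin k) (Fin n) ℂ) (a : ℤ) : Fin k → ℂ :=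
  ((-1 : ℂ) ^ (k - 1)) ^ ((a - 1) / (n : ℤ)) • fun i => X i (colIndex n a)

variable (X : Matrix (Fin k) (Fin n) ℂ)

theorem col_add_period (a : ℤ) : col X (a + n) = (-1 : ℂ) ^ (k - 1) • col X a := by
  have hn : (n : ℤ) ≠ 0 := by simp [NeZero.ne n]
  rw [col, colIndex_add_period, show a + n - 1 = a - 1 + n by ring,
    Int.add_ediv_of_dvd_right dvd_rfl, Int.ediv_self hn, zpow_add_one₀ (by simp), mul_comm,
    mul_smul, col]

theorem col_natCast_add_one (c : Fin n) : col X (c + 1) = fun i => X i c := by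
  rw [col, colIndex_natCast_add_one, add_sub_cancel_right,
    Int.ediv_eq_zero_of_lt (by positivity) (by exact_mod_cast c.2), zpow_zero, one_smul]

theorem eq_col_of_quasiperiodic {v : ℤ → Fin k → ℂ}
    (hv : ∀ a, v (a + n) = (-1 : ℂ) ^ (k - 1) • v a)
    (hX : ∀ c : Fin n, v (c + 1) = fun i => X i c) : v = col X := by
  have hquasi : ∀ (a q : ℤ), v (a + n * q) = ((-1 : ℂ) ^ (k - 1)) ^ q • v a := by
    intro a q
    induction q using Int.induction_on with
    | zero => simp
    | succ q ih =>
      rw [mul_add_one, ← add_assoc, hv, ih, smul_smul, zpow_add_one₀ (by simp), mul_comm]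
    | pred q ih =>
      rw [show a + n * (-(q : ℤ)) = a + n * (-q - 1) + n by ring, hv] at ih
      rw [zpow_sub_one₀ (by simp), mul_comm ((_ : ℂ) ^ _), mul_smul, ← ih, smul_smul,
        inv_mul_cancel₀ (by simp), one_smul]
  funext a
  have ha : a = (colIndex n a : ℤ) + 1 + n * ((a - 1) / n) := by
    have := Int.emod_add_mul_ediv (a - 1) n
    rw [val_colIndex]
    omega
  conv_lhs => rw [ha, hquasi, hX]
  rfl

theorem col_mul_rho (a : ℤ) : col (X * rho k n) a = col X (a + 1) := by
  suffices (fun a => col X (a + 1)) = col (X * rho k n) from (congrFun this a).symm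
  refine eq_col_of_quasiperiodic _ (fun a => ?_) fun c => ?_
  · rw [add_right_comm, col_add_period]
  · ext i
    rw [show (X * rho k n) i c = Matrix.vecMul (X i) (rho k n) c from rfl]
    rcases (show (c : ℕ) + 1 ≤ n from c.2).lt_or_eq with h | h
    · rw [vecMul_rho_of_lt _ h]
      exact_mod_cast congrFun (col_natCast_add_one X ⟨c + 1, h⟩) i
    · have hn : (c : ℤ) + 1 + 1 = ((⟨0, c.pos⟩ : Fin n) : ℕ) + 1 + n := by
        dsimp only
        omega
      rw [vecMul_rho_of_eq _ h, hn, col_add_period, col_natCast_add_one]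
      rfl

theorem col_mul_rho_pow (m : ℕ) (a : ℤ) : col (X * rho k n ^ m) a = col X (a + m) := by
  induction m generalizing a with
  | zero => simp
  | succ m ih =>
    rw [pow_succ, ← Matrix.mul_assoc, col_mul_rho, ih, Nat.cast_succ, add_assoc, add_comm (1 : ℤ)]

theorem col_mul_inv_rho_pow (m : ℕ) (a : ℤ) : col (X * (rho k n)⁻¹ ^ m) a = col X (a - m) := by
  have hρ : IsUnit (rho k n ^ m).det := (Matrix.isUnit_iff_isUnit_det _).1 (isUnit_rho.pow m)
  have hX : X * (rho k n)⁻¹ ^ m * rho k n ^ m = X := by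
    rw [Matrix.mul_assoc, Matrix.inv_pow', Matrix.nonsing_inv_mul _ hρ, Matrix.mul_one]
  conv_rhs => rw [← hX, col_mul_rho_pow, sub_add_cancel]

theorem col_mul_left (T : Matrix (Fin k) (Fin k) ℂ) (a : ℤ) :
    col (T * X) a = Matrix.mulVec T (col X a) := by
  rw [col, col, Matrix.mulVec_smul]
  rfl

end Columns

section ColMinor

variable {k : ℕ} {R : Type*} [CommRing R]

/-- The minor of a `ℤ`-indexed family of vectors `v_a ∈ R^k` with index set `I`, taken in increasing
order; `0` when `I` does not have `k` elements. -/
def colMinor (v : ℤ → Fin k → R) (I : Finset ℤ) : R :=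
  if h : I.card = k then (Matrix.of (v ∘ I.orderEmbOfFin h)).det else 0

theorem colMinor_of_card_ne (v : ℤ → Fin k → R) {I : Finset ℤ} (h : I.card ≠ k) :
    colMinor v I = 0 :=
  dif_neg h

theorem colMinor_image (v : ℤ → Fin k → R) {f : Fin k → ℤ} (hf : StrictMono f) :
    colMinor v (univ.image f) = (Matrix.of (v ∘ f)).det := by
  have hcard : (univ.image f).card = k := by simp [card_image_of_injective _ hf.injective]
  rw [colMinor, dif_pos hcard,
    ← orderEmbOfFin_unique hcard (fun t => mem_image_of_mem f (mem_univ t)) hf]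

theorem colMinor_mulVec (T : Matrix (Fin k) (Fin k) R) (v : ℤ → Fin k → R) (I : Finset ℤ) :
    colMinor (fun a => Matrix.mulVec T (v a)) I = T.det * colMinor v I := by
  unfold colMinor
  split_ifs
  · rw [← Matrix.det_transpose T, mul_comm, ← Matrix.det_mul]
    congr 1
    ext s i
    simp [Matrix.mul_apply, Matrix.mulVec, dotProduct, mul_comm]
  · rw [mul_zero]

theorem colMinor_comp_add (v : ℤ → Fin k → R) (m : ℤ) (I : Finset ℤ) :
    colMinor (fun a => v (a + m)) I = colMinor v (I.image (· + m)) := by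
  by_cases h : I.card = k
  · have hmono : StrictMono ((· + m) ∘ I.orderEmbOfFin h) := fun s t hst => by simpa using hst
    have himage : I.image (· + m) = univ.image ((· + m) ∘ I.orderEmbOfFin h) := by
      rw [← image_image, image_orderEmbOfFin_univ]
    rw [himage, colMinor_image v hmono]
    exact dif_pos h
  · rw [colMinor_of_card_ne _ h, colMinor_of_card_ne]
    rwa [card_image_of_injective _ (add_left_injective m)]

theorem strictMono_fin_cons {m : ℕ} {e : Fin m → ℤ} (he : StrictMono e) {a : ℤ}
    (ha : ∀ t, a < e t) : StrictMono (Fin.cons a e : Fin (m + 1) → ℤ) := by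
  intro s t
  refine Fin.cases ?_ (fun t => ?_) t
  · exact fun h => absurd h (Fin.not_lt_zero s)
  · refine Fin.cases (fun _ => ?_) (fun s h => ?_) s
    · simpa only [Fin.cons_zero, Fin.cons_succ] using ha t
    · simpa only [Fin.cons_succ] using he (Fin.succ_lt_succ_iff.1 h)

theorem strictMono_fin_snoc {m : ℕ} {e : Fin m → ℤ} (he : StrictMono e) {a : ℤ}
    (ha : ∀ t, e t < a) : StrictMono (Fin.snoc e a : Fin (m + 1) → ℤ) := by
  intro s t
  refine Fin.lastCases (fun h => ?_) (fun s => ?_) s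
  · exact absurd h (Fin.le_last t).not_gt
  · refine Fin.lastCases (fun _ => ?_) (fun t h => ?_) t
    · simpa only [Fin.snoc_last, Fin.snoc_castSucc] using ha s
    · simpa only [Fin.snoc_castSucc] using he (Fin.castSucc_lt_castSucc_iff.1 h)

theorem det_fin_snoc {m : ℕ} (e : Fin m → Fin (m + 1) → R) (w : Fin (m + 1) → R) :
    (Matrix.of (Fin.snoc e w : Fin (m + 1) → Fin (m + 1) → R)).det =
      (-1) ^ m * (Matrix.of (Fin.cons w e : Fin (m + 1) → Fin (m + 1) → R)).det := by
  rw [Matrix.det_succ_row _ (Fin.last m), Matrix.det_succ_row_zero, mul_sum]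
  refine sum_congr rfl fun i _ => ?_
  have hminor : (Matrix.of (Fin.snoc e w : Fin (m + 1) → Fin (m + 1) → R)).submatrix
      (Fin.last m).succAbove i.succAbove =
      (Matrix.of (Fin.cons w e : Fin (m + 1) → Fin (m + 1) → R)).submatrix Fin.succ
        i.succAbove := by
    ext s t
    simp [Fin.succAbove_last]
  rw [hminor]
  simp only [Matrix.of_apply, Fin.snoc_last, Fin.cons_zero, Fin.val_last, pow_add, mul_assoc]

theorem det_fin_cons_smul {m : ℕ} (e : Fin m → Fin (m + 1) → R) (c : R) (w : Fin (m + 1) → R) :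
    (Matrix.of (Fin.cons (c • w) e : Fin (m + 1) → Fin (m + 1) → R)).det =
      c * (Matrix.of (Fin.cons w e : Fin (m + 1) → Fin (m + 1) → R)).det := by
  rw [← Fin.update_cons_zero w]
  refine (Matrix.det_updateRow_smul (Matrix.of (Fin.cons w e)) 0 c w).trans ?_
  exact congrArg (c * Matrix.det ·) (Matrix.updateRow_eq_self _ 0)

theorem colMinor_insert_add_period {v : ℤ → Fin k → R} {n : ℤ}
    (hv : ∀ a, v (a + n) = (-1 : R) ^ (k - 1) • v a) {a : ℤ} {J : Finset ℤ}
    (hJ : J ⊆ Ioo a (a + n)) : colMinor v (insert (a + n) J) = colMinor v (insert a J) := by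
  have ha : a ∉ J := fun h => by simpa using hJ h
  have han : a + n ∉ J := fun h => by simpa using hJ h
  by_cases hcard : J.card + 1 = k
  swap
  · rw [colMinor_of_card_ne _ (by rwa [card_insert_of_notMem han]),
      colMinor_of_card_ne _ (by rwa [card_insert_of_notMem ha])]
  subst hcard
  have hmem : ∀ t, J.orderEmbOfFin rfl t ∈ Ioo a (a + n) := fun t => hJ (orderEmbOfFin_mem J rfl t)
  have hcons : insert a J = univ.image (Fin.cons a (J.orderEmbOfFin rfl)) := by
    rw [← coe_inj, coe_image, coe_univ, Set.image_univ, Fin.range_cons, range_orderEmbOfFin,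
      coe_insert]
  have hsnoc : insert (a + n) J = univ.image (Fin.snoc (J.orderEmbOfFin rfl) (a + n)) := by
    rw [← coe_inj, coe_image, coe_univ, Set.image_univ, Fin.range_snoc, range_orderEmbOfFin,
      coe_insert]
  have hsign : (-1 : R) ^ #J * (-1) ^ (#J + 1 - 1) = 1 := by simp [← mul_pow]
  rw [hsnoc, colMinor_image v (strictMono_fin_snoc (J.orderEmbOfFin rfl).strictMono
      fun t => (mem_Ioo.1 (hmem t)).2), hcons,
    colMinor_image v (strictMono_fin_cons (J.orderEmbOfFin rfl).strictMono
      fun t => (mem_Ioo.1 (hmem t)).1), Fin.comp_snoc, Fin.comp_cons, det_fin_snoc, hv,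
    det_fin_cons_smul, ← mul_assoc, hsign, one_mul]

end ColMinor

section Window

variable {k n : ℕ} [NeZero n] (X : Matrix (Fin k) (Fin n) ℂ)

theorem maxMinor_eq_colMinor (S : Finset (Fin n)) :
    maxMinor X S = colMinor (col X) (S.image fun c : Fin n => (c : ℤ) + 1) := by
  by_cases h : S.card = k
  · have hmono : StrictMono ((fun c : Fin n => (c : ℤ) + 1) ∘ S.orderEmbOfFin h) :=
      fun s t hst => by simpa using (S.orderEmbOfFin h).strictMono hst
    have himage : S.image (fun c : Fin n => (c : ℤ) + 1) =
        univ.image ((fun c : Fin n => (c : ℤ) + 1) ∘ S.orderEmbOfFin h) := by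
      rw [← image_image, image_orderEmbOfFin_univ]
    rw [maxMinor, dif_pos h, ← Matrix.det_transpose, himage, colMinor_image _ hmono]
    congr 1
    ext s i
    exact (congrFun (col_natCast_add_one X (S.orderEmbOfFin h s)) i).symm
  · rw [maxMinor, dif_neg h, colMinor_of_card_ne]
    rwa [card_image_of_injective _ fun c d h => by simpa [Fin.ext_iff] using h]

theorem plucker_eq_colMinor_of_subset_Ico_one {I : Finset ℤ} (hI : I ⊆ Ico 1 (1 + n)) :
    plucker X I = colMinor (col X) I := by
  rw [plucker, maxMinor_eq_colMinor, residues_eq_image, image_image]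
  congr 1
  conv_rhs => rw [← image_id (s := I)]
  refine image_congr fun a ha => ?_
  have ha' := mem_Ico.1 (hI ha)
  rw [Function.comp_apply, val_colIndex, Int.emod_eq_of_lt (by lia) (by lia), sub_add_cancel, id]

theorem plucker_insert_add_period (a : ℤ) (J : Finset ℤ) :
    plucker X (insert (a + n) J) = plucker X (insert a J) := by
  simp only [plucker, residues_eq_image, image_insert, colIndex_add_period]

/-- The sign in the definition of `col` makes moving the window by one step harmless. -/
theorem forall_plucker_eq_colMinor_iff_add_one (a : ℤ) :
    (∀ I ⊆ Ico a (a + n), plucker X I = colMinor (col X) I) ↔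
      ∀ I ⊆ Ico (a + 1) (a + 1 + n), plucker X I = colMinor (col X) I := by
  have hswap : ∀ J ⊆ Ioo a (a + n),
      plucker X (insert (a + n) J) = colMinor (col X) (insert (a + n) J) ↔
        plucker X (insert a J) = colMinor (col X) (insert a J) := by
    intro J hJ
    rw [plucker_insert_add_period, colMinor_insert_add_period (col_add_period X) hJ]
  have hn := NeZero.pos n
  constructor
  · intro h I hI
    by_cases ha : a + n ∈ I
    · have hJ : I.erase (a + n) ⊆ Ioo a (a + n) := fun b hb => by
        have := mem_Ico.1 (hI (mem_of_mem_erase hb))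
        have := ne_of_mem_erase hb
        exact mem_Ioo.2 (by lia)
      rw [← insert_erase ha, hswap _ hJ]
      exact h _ (insert_subset (by simpa) (hJ.trans Ioo_subset_Ico_self))
    · refine h I fun b hb => ?_
      have := mem_Ico.1 (hI hb)
      have : b ≠ a + n := fun h => ha (h ▸ hb)
      exact mem_Ico.2 (by lia)
  · intro h I hI
    by_cases ha : a ∈ I
    · have hJ : I.erase a ⊆ Ioo a (a + n) := fun b hb => by
        have := mem_Ico.1 (hI (mem_of_mem_erase hb))
        have := ne_of_mem_erase hb
        exact mem_Ioo.2 (by lia)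
      rw [← insert_erase ha, ← hswap _ hJ]
      refine h _ (insert_subset (by simp; lia) (hJ.trans fun b hb => ?_))
      have := mem_Ioo.1 hb
      exact mem_Ico.2 (by lia)
    · refine h I fun b hb => ?_
      have := mem_Ico.1 (hI hb)
      have : b ≠ a := fun h => ha (h ▸ hb)
      exact mem_Ico.2 (by lia)

theorem plucker_eq_colMinor (a : ℤ) {I : Finset ℤ} (hI : I ⊆ Ico a (a + n)) :
    plucker X I = colMinor (col X) I := by
  induction a using Int.inductionOn' (b := 1) generalizing I with
  | zero => exact plucker_eq_colMinor_of_subset_Ico_one X hI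
  | succ a _ ih => exact (forall_plucker_eq_colMinor_iff_add_one X a).1 (fun _ => ih) I hI
  | pred a _ ih =>
    refine (forall_plucker_eq_colMinor_iff_add_one X (a - 1)).2 (fun J hJ => ih ?_) I hI
    rwa [sub_add_cancel] at hJ

theorem phi'_apply (hkn : k < n) (i j : ℤ) :
    phi' X i j = colMinor (col X) ((Icc (j - k) j).erase i) := by
  have hsub : (Icc j (j + k)).erase (i + k) ⊆ Ico j (j + n) := (erase_subset _ _).trans
    fun a ha => by have := mem_Icc.1 ha; exact mem_Ico.2 (by lia)
  have hcol : col (X * (rho k n)⁻¹ ^ k) = fun a => col X (a + (-k : ℤ)) :=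
    funext fun a => col_mul_inv_rho_pow X k a
  have himage : ((Icc j (j + k)).erase (i + k)).image (· + (-k : ℤ)) = (Icc (j - k) j).erase i := by
    rw [image_erase (add_left_injective _), image_add_right_Icc]
    simp [sub_eq_add_neg]
  rw [phi', tau, phi, plucker_eq_colMinor _ j hsub, hcol, colMinor_comp_add, himage]

end Window

/-! ### Points of the fixed locus -/

section FixedLocus

variable {k n ℓ : ℕ}

theorem vecMul_injective_of_rank_eq {X : Matrix (Fin k) (Fin n) ℂ} (hX : X.rank = k) :
    Function.Injective X.vecMul := by
  rw [Matrix.vecMul_injective_iff, linearIndependent_iff_card_eq_finrank_span, Fintype.card_fin]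
  exact (X.rank_eq_finrank_span_row ▸ hX).symm

theorem mul_right_cancel_of_rank_eq {X : Matrix (Fin k) (Fin n) ℂ} (hX : X.rank = k)
    {A B : Matrix (Fin k) (Fin k) ℂ} (h : A * X = B * X) : A = B :=
  Matrix.ext fun i j => congrFun (vecMul_injective_of_rank_eq hX (congrFun h i)) j

theorem exists_mul_rho_pow_eq {X : Matrix (Fin k) (Fin n) ℂ} (hX : X ∈ fixedLocus k n ℓ) :
    ∃ T : Matrix (Fin k) (Fin k) ℂ, X * rho k n ^ ℓ = T * X := by
  have hrow : ∀ i, ∃ u : Fin k → ℂ, Matrix.vecMul u X = (X * rho k n ^ ℓ) i := by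
    intro i
    have hmem : (X * rho k n ^ ℓ) i ∈ rowSpan X := hX.2 ▸ Submodule.subset_span ⟨i, rfl⟩
    rwa [rowSpan, ← range_vecMulLinear] at hmem
  choose T hT using hrow
  exact ⟨T, Matrix.ext fun i j => congrFun (hT i).symm j⟩

variable {X : Matrix (Fin k) (Fin n) ℂ} {T : Matrix (Fin k) (Fin k) ℂ}

theorem mul_rho_pow_mul (hT : X * rho k n ^ ℓ = T * X) (m : ℕ) :
    X * rho k n ^ (ℓ * m) = T ^ m * X := by
  induction m with
  | zero => simp
  | succ m ih =>
    rw [mul_add_one, pow_add, ← Matrix.mul_assoc, ih, Matrix.mul_assoc, hT, ← Matrix.mul_assoc,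
      pow_succ]

variable [NeZero n]

theorem mul_rho_pow_self (X : Matrix (Fin k) (Fin n) ℂ) :
    X * rho k n ^ n = (-1 : ℂ) ^ (k - 1) • X := by
  ext i c
  have h : col (X * rho k n ^ n) (c + 1) = (-1 : ℂ) ^ (k - 1) • col X (c + 1) := by
    rw [col_mul_rho_pow, col_add_period]
  rw [col_natCast_add_one, col_natCast_add_one] at h
  exact congrFun h i

theorem pow_eq_of_mul_rho_pow_eq {p : ℕ} (hn : n = p * ℓ) (hX : X.rank = k)
    (hT : X * rho k n ^ ℓ = T * X) : T ^ p = (-1 : ℂ) ^ (k - 1) • 1 := by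
  apply mul_right_cancel_of_rank_eq hX
  rw [← mul_rho_pow_mul hT, mul_comm ℓ p, ← hn, mul_rho_pow_self, Matrix.smul_mul, Matrix.one_mul]

theorem col_add_of_mul_rho_pow_eq (hT : X * rho k n ^ ℓ = T * X) (a : ℤ) :
    col X (a + ℓ) = Matrix.mulVec T (col X a) := by
  rw [← col_mul_rho_pow, hT, col_mul_left]

end FixedLocus

/-! ### Total nonnegativity and the eigenvalues of the cyclic shift -/

section CauchyBinet

variable {k : ℕ} {ι R : Type*} [CommRing R]

theorem det_submatrix_of_not_injective {κ : Type*} [Fintype κ] [DecidableEq κ] (A : Matrix κ ι R)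
    {f : κ → ι} (hf : ¬Function.Injective f) : (A.submatrix id f).det = 0 := by
  obtain ⟨i, j, hij, hne⟩ := Function.not_injective_iff.1 hf
  exact Matrix.det_zero_of_column_eq hne fun t => congrArg (A t) hij

theorem det_mul_eq_sum_fun {κ : Type*} [Fintype κ] [DecidableEq κ] [Fintype ι]
    (A : Matrix κ ι R) (B : Matrix ι κ R) :
    (A * B).det = ∑ f : κ → ι, (A.submatrix id f).det * ∏ i, B (f i) i := by
  classical
  simp only [Matrix.det_apply', Matrix.mul_apply, prod_univ_sum, mul_sum, Fintype.piFinset_univ]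
  rw [Finset.sum_comm]
  simp only [prod_mul_distrib, sum_mul, mul_assoc, Matrix.submatrix_apply, id]

variable [LinearOrder ι]

theorem image_orderEmbOfFin_comp_perm (S : {S : Finset ι // #S = k}) (σ : Equiv.Perm (Fin k)) :
    univ.image (S.1.orderEmbOfFin S.2 ∘ σ) = S.1 := by
  rw [← image_image, image_univ_equiv, image_orderEmbOfFin_univ]

theorem injective_orderEmbOfFin_comp_perm :
    Function.Injective fun x : {S : Finset ι // #S = k} × Equiv.Perm (Fin k) =>
      (x.1.1.orderEmbOfFin x.1.2 : Fin k → ι) ∘ x.2 := by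
  rintro ⟨S, σ⟩ ⟨S', σ'⟩ h
  obtain rfl : S = S' := Subtype.ext <| by
    rw [← image_orderEmbOfFin_comp_perm S σ, ← image_orderEmbOfFin_comp_perm S' σ']
    exact congrArg (univ.image ·) h
  exact Prod.ext rfl (Equiv.ext fun t => (S.1.orderEmbOfFin S.2).injective (congrFun h t))

theorem exists_orderEmbOfFin_comp_perm {f : Fin k → ι} (hf : Function.Injective f) :
    ∃ x : {S : Finset ι // #S = k} × Equiv.Perm (Fin k), x.1.1.orderEmbOfFin x.1.2 ∘ x.2 = f := by
  have hcard : #(univ.image f) = k := by simp [card_image_of_injective _ hf]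
  refine ⟨(⟨univ.image f, hcard⟩, (Tuple.sort f)⁻¹), ?_⟩
  have hmono : StrictMono (f ∘ Tuple.sort f) :=
    (Tuple.monotone_sort f).strictMono_of_injective (hf.comp (Tuple.sort f).injective)
  rw [← orderEmbOfFin_unique hcard (fun t => mem_image_of_mem f (mem_univ _)) hmono]
  ext t
  simp

theorem det_mul_eq_sum_det_mul_det [Fintype ι] (A : Matrix (Fin k) ι R) (B : Matrix ι (Fin k) R) :
    (A * B).det = ∑ S : {S : Finset ι // #S = k},
      (A.submatrix id (S.1.orderEmbOfFin S.2)).det *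
        (B.submatrix (S.1.orderEmbOfFin S.2) id).det := by
  rw [det_mul_eq_sum_fun, ← Fintype.sum_of_injective _ injective_orderEmbOfFin_comp_perm
    (fun x => (A.submatrix id (x.1.1.orderEmbOfFin x.1.2 ∘ x.2)).det *
      ∏ i, B (x.1.1.orderEmbOfFin x.1.2 (x.2 i)) i) _ ?_ fun _ => rfl, Fintype.sum_prod_type]
  · refine sum_congr rfl fun S _ => ?_
    rw [Matrix.det_apply' (B.submatrix _ _), mul_sum]
    refine sum_congr rfl fun σ _ => ?_
    have hσ : A.submatrix id (S.1.orderEmbOfFin S.2 ∘ σ) =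
        (A.submatrix id (S.1.orderEmbOfFin S.2)).submatrix id σ := rfl
    rw [hσ, Matrix.det_permute', mul_assoc, mul_left_comm]
    rfl
  · intro f hf
    rw [det_submatrix_of_not_injective A fun h => hf (exists_orderEmbOfFin_comp_perm h), zero_mul]

end CauchyBinet

section TotallyNonnegative

variable {k n : ℕ} {X : Matrix (Fin k) (Fin n) ℂ}

open scoped ComplexOrder in
theorem det_mul_conjTranspose_ne_zero (hX : X.rank = k) : (X * X.conjTranspose).det ≠ 0 := by
  refine isUnit_iff_ne_zero.1 ((Matrix.isUnit_iff_isUnit_det _).1 ?_)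
  rw [← Matrix.vecMul_injective_iff_isUnit]
  exact vecMul_injective_of_rank_eq ((Matrix.rank_self_mul_conjTranspose X).trans hX)

theorem exists_det_submatrix_ne_zero (hX : X.rank = k) :
    ∃ S : {S : Finset (Fin n) // #S = k}, (X.submatrix id (S.1.orderEmbOfFin S.2)).det ≠ 0 := by
  by_contra! h
  exact det_mul_conjTranspose_ne_zero hX
    ((det_mul_eq_sum_det_mul_det _ _).trans (sum_eq_zero fun S _ => by rw [h, zero_mul]))

theorem IsTNN.det_mul_ne_zero (hX : X.rank = k) (hTNN : IsTNN X) {W : Matrix (Fin n) (Fin k) ℂ}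
    {c : ℂ} (hc : c ≠ 0)
    (hW : ∀ g : Fin k → Fin n, StrictMono g → ∃ r : ℝ, 0 < r ∧ (W.submatrix g id).det = c * r) :
    (X * W).det ≠ 0 := by
  obtain ⟨b, hb, hTNN⟩ := hTNN
  have hminor : ∀ S : {S : Finset (Fin n) // #S = k}, ∃ r : ℝ, 0 ≤ r ∧
      (X.submatrix id (S.1.orderEmbOfFin S.2)).det = b * r := by
    intro S
    simpa only [maxMinor, dif_pos S.2] using hTNN S.1 S.2
  choose r hr hXr using hminor
  choose s hs hWs using fun S : {S : Finset (Fin n) // #S = k} =>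
    hW _ (S.1.orderEmbOfFin S.2).strictMono
  obtain ⟨S₀, hS₀⟩ := exists_det_submatrix_ne_zero hX
  have hr₀ : 0 < r S₀ := (hr S₀).lt_of_ne' fun h => hS₀ (by rw [hXr, h]; simp)
  have hsum : 0 < ∑ S, r S * s S :=
    sum_pos' (fun S _ => mul_nonneg (hr S) (hs S).le) ⟨S₀, mem_univ _, mul_pos hr₀ (hs S₀)⟩
  have hdet : (X * W).det = b * c * (∑ S, r S * s S : ℝ) := by
    rw [det_mul_eq_sum_det_mul_det, Complex.ofReal_sum, mul_sum]
    refine sum_congr rfl fun S _ => ?_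
    rw [hXr, hWs]
    push_cast
    ring
  rw [hdet]
  exact mul_ne_zero (mul_ne_zero hb hc) (Complex.ofReal_ne_zero.2 hsum.ne')

end TotallyNonnegative

section ShiftEigenvectors

variable {k n : ℕ}

/-- The number `exp(πi (k - 1 - 2j) / n)`. For `0 ≤ j < k` these are the eigenvalues of the cyclic
shift `ρ` on its totally nonnegative fixed point in `Gr(k,n)`. -/
def shiftEigenvalue (k n j : ℕ) : ℂ :=
  Complex.exp (Real.pi * Complex.I / n) ^ ((k : ℤ) - 1 - 2 * j)

theorem shiftEigenvalue_ne_zero (k n j : ℕ) : shiftEigenvalue k n j ≠ 0 :=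
  zpow_ne_zero _ (Complex.exp_ne_zero _)

theorem exp_pi_mul_I_div_pow_self (hn : n ≠ 0) :
    Complex.exp (Real.pi * Complex.I / n) ^ n = -1 := by
  rw [← Complex.exp_nat_mul, mul_div_cancel₀ _ (Nat.cast_ne_zero.2 hn), Complex.exp_pi_mul_I]

theorem shiftEigenvalue_mul_pow {p ℓ : ℕ} (hℓ : ℓ ≠ 0) (j : ℕ) :
    shiftEigenvalue k (p * ℓ) j ^ ℓ = shiftEigenvalue k p j := by
  have hexp : Complex.exp (Real.pi * Complex.I / (p * ℓ : ℕ)) ^ ℓ =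
      Complex.exp (Real.pi * Complex.I / p) := by
    have : (ℓ : ℂ) ≠ 0 := Nat.cast_ne_zero.2 hℓ
    rw [← Complex.exp_nat_mul]
    congr 1
    push_cast
    field_simp
  rw [shiftEigenvalue, ← zpow_natCast, ← zpow_mul, zpow_mul', zpow_natCast, hexp,
    shiftEigenvalue]

theorem shiftEigenvalue_pow_self (hk : 0 < k) (hn : n ≠ 0) (j : ℕ) :
    shiftEigenvalue k n j ^ n = (-1) ^ (k - 1) := by
  rw [shiftEigenvalue, ← zpow_natCast, ← zpow_mul, zpow_mul', zpow_natCast,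
    exp_pi_mul_I_div_pow_self hn, zpow_sub₀ (by norm_num), zpow_mul, zpow_ofNat, neg_one_sq,
    one_zpow, div_one, ← Nat.cast_pred hk, zpow_natCast]

theorem rho_mulVec_inv_pow {z : ℂ} (hz : z ≠ 0) (hzn : z ^ n = (-1) ^ (k - 1)) :
    Matrix.mulVec (rho k n) (fun c : Fin n => (z ^ (c : ℕ))⁻¹) =
      z • fun c : Fin n => (z ^ (c : ℕ))⁻¹ := by
  ext c
  rw [Matrix.mulVec, dotProduct, Pi.smul_apply, smul_eq_mul]
  rcases eq_or_ne (c : ℕ) 0 with hc | hc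
  · have hlast : n - 1 + 1 = n := Nat.sub_add_cancel c.pos
    rw [sum_eq_single ⟨n - 1, by omega⟩ _ (by simp)]
    · have hrho : rho k n c ⟨n - 1, by omega⟩ = (-1) ^ (k - 1) := by
        simp [rho, hc, hlast, c.pos.ne]
      rw [hrho, hc, ← hzn, ← pow_sub_one_mul c.pos.ne' z, pow_zero, inv_one, mul_one,
        mul_right_comm, mul_inv_cancel₀ (pow_ne_zero _ hz), one_mul]
    · intro b _ hb
      have hbn : (b : ℕ) + 1 ≠ n := fun h => hb (Fin.ext (by dsimp only; omega))
      simp [rho, hc, hbn]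
  · obtain ⟨m, hm⟩ := Nat.exists_eq_add_one_of_ne_zero hc
    rw [sum_eq_single ⟨m, by omega⟩ _ (by simp)]
    · have hrho : rho k n c ⟨m, by omega⟩ = 1 := by simp [rho, hm]
      rw [hrho, one_mul, hm, pow_succ, mul_inv, mul_comm z, mul_assoc, inv_mul_cancel₀ hz,
        mul_one]
    · intro b _ hb
      have hcb : (c : ℕ) ≠ b + 1 := fun h => hb (Fin.ext (by dsimp only; omega))
      simp [rho, hc, hcb]

/-- The matrix whose columns are eigenvectors of `ρ` with the eigenvalues `shiftEigenvalue k n j`,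
scaled so that it is of Vandermonde type. -/
def shiftEigenvectors (k n : ℕ) : Matrix (Fin n) (Fin k) ℂ :=
  Matrix.rectVandermonde (fun c : Fin n => Complex.exp (Real.pi * Complex.I / n) ^ (c : ℕ))
    (fun c : Fin n => (Complex.exp (Real.pi * Complex.I / n) ^ (c : ℕ))⁻¹) k

theorem shiftEigenvectors_apply (c : Fin n) (j : Fin k) :
    shiftEigenvectors k n c j = (shiftEigenvalue k n j ^ (c : ℕ))⁻¹ := by
  have hexp : Complex.exp (Real.pi * Complex.I / n) ≠ 0 := Complex.exp_ne_zero _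
  have hrev : ((j.rev : ℕ) : ℤ) = k - 1 - j := by
    rw [Fin.val_rev]
    omega
  rw [shiftEigenvectors, Matrix.rectVandermonde_apply, shiftEigenvalue]
  simp only [← zpow_natCast, ← zpow_mul, ← zpow_neg, ← zpow_add₀ hexp, hrev]
  congr 1
  ring

theorem rho_mul_shiftEigenvectors (hk : 0 < k) (hn : n ≠ 0) :
    rho k n * shiftEigenvectors k n =
      shiftEigenvectors k n * Matrix.diagonal fun j : Fin k => shiftEigenvalue k n j := by
  ext c j
  have hcol : (fun c => shiftEigenvectors k n c j) =
      fun c : Fin n => (shiftEigenvalue k n j ^ (c : ℕ))⁻¹ :=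
    funext fun c => shiftEigenvectors_apply c j
  rw [Matrix.mul_diagonal, Matrix.mul_apply_eq_vecMul, Matrix.vecMul, dotProduct]
  have h := congrFun (rho_mulVec_inv_pow (k := k) (shiftEigenvalue_ne_zero k n j)
    (shiftEigenvalue_pow_self hk hn j)) c
  rw [← hcol] at h
  exact h.trans (mul_comm _ _)

theorem exp_sub_exp_inv_eq_two_mul_I_mul_sin (a b : ℕ) :
    Complex.exp (Real.pi * Complex.I / n) ^ b * (Complex.exp (Real.pi * Complex.I / n) ^ a)⁻¹ -
      Complex.exp (Real.pi * Complex.I / n) ^ a * (Complex.exp (Real.pi * Complex.I / n) ^ b)⁻¹ =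
      2 * Complex.I * Real.sin (((b : ℝ) - a) * Real.pi / n) := by
  have hpow : ∀ c d : ℕ, Complex.exp (Real.pi * Complex.I / n) ^ d *
      (Complex.exp (Real.pi * Complex.I / n) ^ c)⁻¹ =
        Complex.exp (((d : ℂ) - c) * Real.pi / n * Complex.I) := by
    intro c d
    rw [← Complex.exp_nat_mul, ← Complex.exp_nat_mul, ← Complex.exp_neg, ← Complex.exp_add]
    congr 1
    ring
  have hneg : ((a : ℂ) - b) * Real.pi / n = -(((b : ℂ) - a) * Real.pi / n) := by ring
  rw [hpow, hpow, hneg, mul_assoc 2, mul_left_comm]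
  push_cast
  rw [Complex.two_sin]
  linear_combination (Complex.exp (-(((b : ℂ) - a) * Real.pi / n) * Complex.I) -
    Complex.exp (((b : ℂ) - a) * Real.pi / n * Complex.I)) * (-Complex.I_mul_I)

theorem exists_det_shiftEigenvectors_eq (g : Fin k → Fin n) (hg : StrictMono g) :
    ∃ r : ℝ, 0 < r ∧ ((shiftEigenvectors k n).submatrix g id).det =
      (∏ i : Fin k, ∏ _j ∈ Ioi i, (2 * Complex.I)) * r := by
  refine ⟨∏ i : Fin k, ∏ j ∈ Ioi i, Real.sin (((g j : ℝ) - g i) * Real.pi / n),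
    prod_pos fun i _ => prod_pos fun j hj => ?_, ?_⟩
  · have hij : ((g i : ℕ) : ℝ) < g j := Nat.cast_lt.2 (hg (mem_Ioi.1 hj))
    have hjn : ((g j : ℕ) : ℝ) < n := Nat.cast_lt.2 (g j).2
    have hn : (0 : ℝ) < n := (Nat.cast_nonneg _).trans_lt hjn
    have : (0 : ℝ) ≤ g i := Nat.cast_nonneg _
    refine Real.sin_pos_of_pos_of_lt_pi
      (div_pos (mul_pos (sub_pos.2 hij) Real.pi_pos) hn) ?_
    rw [div_lt_iff₀ hn, mul_comm]
    exact mul_lt_mul_of_pos_left (by linarith) Real.pi_pos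
  · refine (Matrix.det_projVandermonde (fun t => Complex.exp (Real.pi * Complex.I / n) ^ (g t : ℕ))
      fun t => (Complex.exp (Real.pi * Complex.I / n) ^ (g t : ℕ))⁻¹).trans ?_
    simp only [exp_sub_exp_inv_eq_two_mul_I_mul_sin, Complex.ofReal_prod, prod_mul_distrib]

end ShiftEigenvectors

section Charpoly

variable {k n ℓ p : ℕ} {X : Matrix (Fin k) (Fin n) ℂ} {T : Matrix (Fin k) (Fin k) ℂ}

theorem charpoly_eq_of_isTNN (hk : 0 < k) (hℓ : ℓ ≠ 0) (hn : n ≠ 0) (hpn : n = p * ℓ)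
    (hX : X.rank = k) (hTNN : IsTNN X) (hT : X * rho k n ^ ℓ = T * X) :
    T.charpoly = ∏ j : Fin k, (Polynomial.X - C (shiftEigenvalue k p j)) := by
  set W := shiftEigenvectors k n
  set Λ : Matrix (Fin k) (Fin k) ℂ := Matrix.diagonal fun j : Fin k => shiftEigenvalue k n j
  have hdet : (X * W).det ≠ 0 := by
    refine hTNN.det_mul_ne_zero hX (c := ∏ i : Fin k, ∏ _j ∈ Ioi i, (2 * Complex.I)) ?_
      exists_det_shiftEigenvectors_eq
    exact prod_ne_zero_iff.2 fun i _ => prod_ne_zero_iff.2 fun j _ => by simp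
  have hpow : ∀ m, rho k n ^ m * W = W * Λ ^ m := by
    intro m
    induction m with
    | zero => simp
    | succ m ih =>
      rw [pow_succ, Matrix.mul_assoc, rho_mul_shiftEigenvectors hk hn, ← Matrix.mul_assoc, ih,
        Matrix.mul_assoc, pow_succ]
  have hΛ : Λ ^ ℓ = Matrix.diagonal fun j : Fin k => shiftEigenvalue k p j := by
    rw [Matrix.diagonal_pow]
    congr 1
    funext j
    rw [Pi.pow_apply, hpn, shiftEigenvalue_mul_pow hℓ]
  obtain ⟨U, hU⟩ := (Matrix.isUnit_iff_isUnit_det _).2 hdet.isUnit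
  have hconj : T * (X * W) = X * W * Λ ^ ℓ := by
    rw [← Matrix.mul_assoc, ← hT, Matrix.mul_assoc, hpow, Matrix.mul_assoc]
  rw [← Matrix.charpoly_diagonal, ← hΛ, ← Matrix.charpoly_units_conj' U, mul_assoc, hU, hconj,
    ← mul_assoc, Matrix.nonsing_inv_mul _ hdet.isUnit, one_mul]

theorem finite_charpoly_of_pow_eq {κ : Type*} [Fintype κ] [DecidableEq κ] [Nonempty κ]
    {K : Type*} [Field K] [IsAlgClosed K] (hp : 0 < p) (ε : K) :
    {P : K[X] | ∃ T : Matrix κ κ K, T ^ p = ε • 1 ∧ T.charpoly = P}.Finite := by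
  classical
  refine ((((nthRoots p ε).toFinset.sym (Fintype.card κ)).image fun m : Sym K _ =>
    ((m : Multiset K).map fun r => Polynomial.X - C r).prod).finite_toSet).subset ?_
  rintro _ ⟨T, hT, rfl⟩
  have hs : T.charpoly.Splits := IsAlgClosed.splits _
  have hcard : Multiset.card T.charpoly.roots = Fintype.card κ := by
    rw [← hs.natDegree_eq_card_roots, Matrix.charpoly_natDegree_eq_dim]
  refine mem_coe.2 (mem_image.2 ⟨Sym.mk T.charpoly.roots hcard, mem_sym_iff.2 fun r hr => ?_,
    (hs.eq_prod_roots_of_monic T.charpoly_monic).symm⟩)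
  have hr : r ^ p ∈ spectrum K (T ^ p) := spectrum.pow_mem_pow T p
    (Matrix.mem_spectrum_iff_isRoot_charpoly.2 (isRoot_of_mem_roots hr))
  rw [hT, ← Algebra.algebraMap_eq_smul_one, spectrum.scalar_eq] at hr
  exact Multiset.mem_toFinset.2 ((mem_nthRoots hp).2 hr)

/-- The value at `z` of the characteristic polynomial of `ρ ^ ℓ` on the subspace represented by `X`,
written as a continuous function of `X`. -/
def locusCharEval (k n ℓ : ℕ) (z : ℂ) (X : Matrix (Fin k) (Fin n) ℂ) : ℂ :=
  (z • (X * X.conjTranspose) - X * rho k n ^ ℓ * X.conjTranspose).det /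
    (X * X.conjTranspose).det

theorem locusCharEval_eq (z : ℂ) (hX : X.rank = k) (hT : X * rho k n ^ ℓ = T * X) :
    locusCharEval k n ℓ z X = T.charpoly.eval z := by
  rw [locusCharEval, hT, div_eq_iff (det_mul_conjTranspose_ne_zero hX), Matrix.eval_charpoly,
    Matrix.scalar_apply, ← Matrix.smul_one_eq_diagonal, ← Matrix.det_mul, sub_mul,
    Matrix.smul_mul, Matrix.one_mul, Matrix.mul_assoc]

theorem continuousOn_locusCharEval (z : ℂ) :
    ContinuousOn (locusCharEval k n ℓ z) (fixedLocus k n ℓ) :=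
  ContinuousOn.div (Continuous.continuousOn (by fun_prop)) (Continuous.continuousOn (by fun_prop))
    fun _ hX => det_mul_conjTranspose_ne_zero hX.1

theorem finite_image_locusCharEval [NeZero k] [NeZero n] (hpn : n = p * ℓ) (z : ℂ) :
    (locusCharEval k n ℓ z '' fixedLocus k n ℓ).Finite := by
  have hp : 0 < p := Nat.pos_of_ne_zero fun h => NeZero.ne n (by simp [hpn, h])
  refine ((finite_charpoly_of_pow_eq (κ := Fin k) hp ((-1 : ℂ) ^ (k - 1))).image
    (eval z)).subset ?_
  rintro _ ⟨X, hX, rfl⟩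
  obtain ⟨T, hT⟩ := exists_mul_rho_pow_eq hX
  exact ⟨_, ⟨T, pow_eq_of_mul_rho_pow_eq hpn hX.1 hT, rfl⟩, (locusCharEval_eq z hX.1 hT).symm⟩

theorem mem_fixedLocus_of_mem_distinguished (hX : X ∈ distinguished k n ℓ) :
    X ∈ fixedLocus k n ℓ := by
  obtain ⟨X₀, _, _, hXc⟩ := hX
  exact connectedComponentIn_subset _ _ hXc

theorem charpoly_eq_of_mem_distinguished [NeZero k] [NeZero n] (hpn : n = p * ℓ)
    (hX : X ∈ distinguished k n ℓ) (hT : X * rho k n ^ ℓ = T * X) :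
    T.charpoly = ∏ j : Fin k, (Polynomial.X - C (shiftEigenvalue k p j)) := by
  obtain ⟨X₀, hX₀, hTNN, hXc⟩ := hX
  have hsub := connectedComponentIn_subset (fixedLocus k n ℓ) X₀
  obtain ⟨T₀, hT₀⟩ := exists_mul_rho_pow_eq hX₀
  have hℓ : ℓ ≠ 0 := fun h => NeZero.ne n (by simp [hpn, h])
  rw [← charpoly_eq_of_isTNN (NeZero.pos k) hℓ (NeZero.ne n) hpn hX₀.1 hTNN hT₀]
  refine Polynomial.funext fun z => ?_
  have hconn := (isPreconnected_connectedComponentIn (x := X₀) (F := fixedLocus k n ℓ)).image _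
    ((continuousOn_locusCharEval z).mono hsub)
  have hfin := (finite_image_locusCharEval hpn z).subset (Set.image_mono hsub)
  rw [← locusCharEval_eq z (hsub hXc).1 hT, ← locusCharEval_eq z hX₀.1 hT₀]
  exact hconn.isDiscrete_iff_subsingleton.1 hfin.isDiscrete ⟨X, hXc, rfl⟩
    ⟨X₀, mem_connectedComponentIn hX₀, rfl⟩

theorem prod_shiftEigenvalue (k p : ℕ) : ∏ j : Fin k, shiftEigenvalue k p j = 1 := by
  set h := Complex.exp (Real.pi * Complex.I / p)
  have hh : h ≠ 0 := Complex.exp_ne_zero _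
  have hfactor : ∀ j : ℕ, shiftEigenvalue k p j = h ^ ((k : ℤ) - 1) / (h ^ 2) ^ j := fun j => by
    rw [shiftEigenvalue, zpow_sub₀ hh, ← pow_mul, ← zpow_natCast h (2 * j)]
    push_cast
    rfl
  simp_rw [hfactor]
  rw [Fin.prod_univ_eq_prod_range (fun j => h ^ ((k : ℤ) - 1) / (h ^ 2) ^ j) k, prod_div_distrib,
    prod_const, card_range, prod_pow_eq_pow_sum, ← pow_mul, mul_comm 2, sum_range_id_mul_two,
    div_eq_one_iff_eq (pow_ne_zero _ hh), ← zpow_natCast, ← zpow_mul, ← zpow_natCast]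
  congr 1
  cases k <;> simp [mul_comm]

theorem det_eq_one_of_mem_distinguished [NeZero k] [NeZero n] (hpn : n = p * ℓ)
    (hX : X ∈ distinguished k n ℓ) (hT : X * rho k n ^ ℓ = T * X) : T.det = 1 := by
  rw [Matrix.det_eq_sign_charpoly_coeff, charpoly_eq_of_mem_distinguished hpn hX hT,
    coeff_zero_eq_eval_zero, eval_prod, Fintype.card_fin]
  simp only [eval_sub, eval_X, eval_C, zero_sub]
  rw [prod_neg, card_univ, Fintype.card_fin, ← mul_assoc, ← mul_pow, neg_one_mul, neg_neg,
    one_pow, one_mul, prod_shiftEigenvalue]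

end Charpoly

/-! ### Minors of the relations between consecutive vectors -/

section Laplace

variable {R : Type*} [CommRing R]

theorem exists_strictMono_succAbove_comp {ι : Type*} [Preorder ι] {m : ℕ} {q : Fin (m + 1)}
    {f : ι → Fin (m + 1)} (hf : StrictMono f) (hq : ∀ i, f i ≠ q) :
    ∃ g : ι → Fin m, StrictMono g ∧ q.succAbove ∘ g = f := by
  choose g hg using fun i => Fin.exists_succAbove_eq (hq i)
  refine ⟨g, fun i j hij => (Fin.strictMono_succAbove q).lt_iff_lt.1 ?_, funext hg⟩
  rw [hg, hg]
  exact hf hij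

theorem det_eq_of_last_row_eq_single {m : ℕ} (A : Matrix (Fin (m + 1)) (Fin (m + 1)) R)
    {q : Fin (m + 1)} (hA : A (Fin.last m) = Pi.single q 1) :
    A.det = (-1) ^ ((q : ℕ) + m) * (A.submatrix Fin.castSucc q.succAbove).det := by
  rw [Matrix.det_succ_row A (Fin.last m), hA, sum_eq_single q]
  · rw [Pi.single_eq_same, mul_one, Fin.val_last, add_comm m]
    congr 3
    exact funext Fin.succAbove_last_apply
  · intro j _ hj
    rw [Pi.single_eq_of_ne hj, mul_zero, zero_mul]
  · exact fun h => absurd (mem_univ q) h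

theorem val_succAbove_of_lt {m : ℕ} {q : Fin (m + 1)} {b : Fin m} (h : q.succAbove b < q) :
    (q.succAbove b : ℕ) = b := by
  rw [Fin.succAbove_of_castSucc_lt _ _ ((Fin.succAbove_lt_iff_castSucc_lt _ _).1 h),
    Fin.val_castSucc]

theorem fromRows_one_submatrix_succAbove {k m : ℕ} (V : Matrix (Fin k) (Fin (k + m + 1)) R)
    {q : Fin (k + m + 1)} {r : Fin (m + 1) → Fin (k + m + 1)} {r' : Fin m → Fin (k + m)}
    (hrr' : q.succAbove ∘ r' = r ∘ Fin.castSucc) :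
    ((Matrix.fromRows V ((1 : Matrix _ _ R).submatrix r id)).submatrix
        (finSumFinEquiv (m := k) (n := m + 1)).symm id).submatrix Fin.castSucc q.succAbove =
      (Matrix.fromRows (V.submatrix id q.succAbove)
        ((1 : Matrix _ _ R).submatrix r' id)).submatrix finSumFinEquiv.symm id := by
  ext a b
  obtain ⟨a | a, rfl⟩ := finSumFinEquiv.surjective a <;>
    simp only [Matrix.submatrix_apply, Equiv.symm_apply_apply, Matrix.fromRows_apply_inl,
      Matrix.fromRows_apply_inr]
  · exact congrArg (Matrix.fromRows V _ · _) (finSumFinEquiv_symm_apply_castAdd a)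
  · refine (congrArg (Matrix.fromRows V _ · _)
      (finSumFinEquiv_symm_apply_natAdd (m := k) a.castSucc)).trans ?_
    rw [Matrix.fromRows_apply_inr, Matrix.submatrix_apply, ← Function.comp_apply (f := r), ← hrr']
    simp only [Function.comp_apply, id, Matrix.one_apply, q.succAbove_right_injective.eq_iff]

theorem det_fromRows_one_submatrix {k m : ℕ} (V : Matrix (Fin k) (Fin (k + m)) R)
    {r : Fin m → Fin (k + m)} {s : Fin k → Fin (k + m)} (hr : StrictMono r) (hs : StrictMono s)
    (hrs : ∀ a t, s t ≠ r a) :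
    ((Matrix.fromRows V ((1 : Matrix _ _ R).submatrix r id)).submatrix
        finSumFinEquiv.symm id).det =
      (-1) ^ (∑ a : Fin m, ((r a : ℕ) + (k + a))) * (V.submatrix id s).det := by
  induction m with
  | zero =>
    obtain rfl : s = id := (hs.range_inj strictMono_id).1 (by
      rw [Set.range_id, Set.range_eq_univ]
      exact Finite.surjective_of_injective (α := Fin k) hs.injective)
    rw [univ_eq_empty, sum_empty, pow_zero, one_mul]
    congr 1
    ext i j
    exact congrArg (Matrix.fromRows V _ · j) (finSumFinEquiv_symm_apply_castAdd i)
  | succ m ih =>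
    set q := r (Fin.last m) with hq
    have hlt : ∀ a : Fin m, r a.castSucc < q := fun a => hr (Fin.castSucc_lt_last a)
    obtain ⟨r', hr', hrr'⟩ := exists_strictMono_succAbove_comp
      (hr.comp (Fin.strictMono_castSucc (n := m))) fun a => (hlt a).ne
    obtain ⟨s', hs', rfl⟩ := exists_strictMono_succAbove_comp hs (hrs (Fin.last m))
    have hr'a : ∀ a, q.succAbove (r' a) = r a.castSucc := congrFun hrr'
    have hval : ∀ a, (r' a : ℕ) = r a.castSucc := fun a => by
      rw [← hr'a, val_succAbove_of_lt (hr'a a ▸ hlt a)]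
    have hrs' : ∀ a t, s' t ≠ r' a := fun a t h => hrs a.castSucc t (by
      rw [Function.comp_apply, h, ← hr'a])
    have hlast : (Matrix.fromRows V ((1 : Matrix _ _ R).submatrix r id)).submatrix
        finSumFinEquiv.symm id (Fin.last (k + m)) = Pi.single q 1 := by
      ext j
      rw [Matrix.submatrix_apply, ← Fin.natAdd_last, finSumFinEquiv_symm_apply_natAdd,
        Matrix.fromRows_apply_inr, Matrix.submatrix_apply, Matrix.one_eq_pi_single]
      rfl
    refine (det_eq_of_last_row_eq_single (m := k + m) _ hlast).trans ?_
    rw [fromRows_one_submatrix_succAbove V hrr', ih _ hr' hs' hrs', Fin.sum_univ_castSucc,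
      ← mul_assoc, ← pow_add, add_comm ((q : ℕ) + _)]
    simp only [hval, Fin.val_castSucc, Fin.val_last, ← hq]
    rfl

theorem det_mul_of_equiv {ι κ : Type*} [Fintype ι] [DecidableEq ι] [Fintype κ] [DecidableEq κ]
    (P : Matrix ι κ R) (Q : Matrix κ ι R) (e : ι ≃ κ) :
    (P * Q).det = (P.submatrix e.symm id).det * (Q.submatrix e id).det := by
  rw [← Matrix.det_submatrix_equiv_self e (P.submatrix e.symm id), ← Matrix.det_mul,
    Matrix.submatrix_submatrix, e.symm_comp_self, Function.id_comp, Matrix.submatrix_mul_equiv,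
    Matrix.submatrix_id_id]

end Laplace

section DualMinors

variable {R : Type*} [CommRing R] {k m : ℕ}

theorem Ico_add_eq_image (c : ℤ) (w : ℕ) :
    Ico c (c + w) = univ.image fun t : Fin w => ((t : ℕ) : ℤ) + c := by
  ext x
  simp only [mem_image, mem_univ, true_and, mem_Ico]
  exact ⟨fun h => ⟨⟨(x - c).toNat, by omega⟩, by dsimp only; omega⟩, by rintro ⟨t, rfl⟩; omega⟩

theorem strictMono_natCast_val_add (c : ℤ) : StrictMono fun t : Fin k => ((t : ℕ) : ℤ) + c :=
  fun _ _ h => add_lt_add_left (Nat.cast_lt.2 h) c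

theorem colMinor_Ico_zero (v : ℤ → Fin k → R) :
    colMinor v (Ico 0 k) = (Matrix.of fun t : Fin k => v (t : ℕ)).det := by
  rw [← zero_add (k : ℤ), Ico_add_eq_image, colMinor_image v (strictMono_natCast_val_add 0)]
  simp only [Function.comp_def, add_zero]

theorem colMinor_map {S : Type*} [CommRing S] (φ : R →+* S) (v : ℤ → Fin k → R) (I : Finset ℤ) :
    colMinor (fun a i => φ (v a i)) I = φ (colMinor v I) := by
  unfold colMinor
  split_ifs
  · rw [RingHom.map_det]
    rfl
  · rw [map_zero]

/-- The minor of a family of vectors formed by `v_c, …, v_{c+k}` without `v_a`. These minors are the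
entries of the band matrix `φ'(X)`, and also the coefficients of the linear relation between
`v_c, …, v_{c+k}`. -/
def bandEntry (v : ℤ → Fin k → R) (a c : ℤ) : R := colMinor v ((Icc c (c + k)).erase a)

theorem bandEntry_map {S : Type*} [CommRing S] (φ : R →+* S) (v : ℤ → Fin k → R) (a c : ℤ) :
    bandEntry (fun b i => φ (v b i)) a c = φ (bandEntry v a c) :=
  colMinor_map φ v _

theorem bandEntry_eq_zero (v : ℤ → Fin k → R) {a c : ℤ} (h : a ∉ Icc c (c + k)) :
    bandEntry v a c = 0 := by
  rw [bandEntry, erase_eq_of_notMem h]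
  refine colMinor_of_card_ne v ?_
  rw [Int.card_Icc]
  omega

theorem bandEntry_add_right (v : ℤ → Fin k → R) (c : ℤ) :
    bandEntry v (c + k) c = colMinor v (Ico c (c + k)) := by
  rw [bandEntry, Icc_erase_right]

theorem bandEntry_self (v : ℤ → Fin k → R) (c : ℤ) :
    bandEntry v c c = colMinor v (Ioc c (c + k)) := by
  rw [bandEntry, Icc_erase_left]

theorem bandEntry_comp_add (v : ℤ → Fin k → R) (d a c : ℤ) :
    bandEntry (fun b => v (b + d)) a c = bandEntry v (a + d) (c + d) := by
  rw [bandEntry, colMinor_comp_add, image_erase (add_left_injective d), image_add_right_Icc,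
    bandEntry, add_right_comm]

theorem bandEntry_add_fin (v : ℤ → Fin k → R) (c : ℤ) (s : Fin (k + 1)) :
    bandEntry v (c + (s : ℕ)) c =
      (Matrix.of fun t : Fin k => v (c + (s.succAbove t : ℕ))).det := by
  have hmono : StrictMono fun t : Fin k => c + ((s.succAbove t : ℕ) : ℤ) := fun t u htu => by
    have := Fin.strictMono_succAbove s htu
    simpa using this
  have himage : (Icc c (c + k)).erase (c + (s : ℕ)) =
      univ.image fun t : Fin k => c + ((s.succAbove t : ℕ) : ℤ) := by
    ext x
    simp only [mem_erase, mem_Icc, mem_image, mem_univ, true_and]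
    constructor
    · rintro ⟨hxs, hcx, hxk⟩
      obtain ⟨t, ht⟩ := Fin.exists_succAbove_eq (y := s)
        (x := ⟨(x - c).toNat, by omega⟩) (by rw [Ne, Fin.ext_iff]; dsimp only; omega)
      exact ⟨t, by rw [ht]; dsimp only; omega⟩
    · rintro ⟨t, rfl⟩
      have := Fin.val_ne_of_ne (Fin.succAbove_ne s t)
      omega
  rw [bandEntry, himage, colMinor_image v hmono]
  rfl

/-- Laplace expansion of a determinant with two equal rows. -/
theorem sum_fin_bandEntry_mul (v : ℤ → Fin k → R) (c : ℤ) (i : Fin k) :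
    ∑ s : Fin (k + 1), (-1) ^ (s : ℕ) * (bandEntry v (c + (s : ℕ)) c * v (c + (s : ℕ)) i) = 0 := by
  have hdet : (Matrix.of fun s : Fin (k + 1) =>
      (Fin.cons (v (c + (s : ℕ)) i) (v (c + (s : ℕ))) : Fin (k + 1) → R)).det = 0 :=
    Matrix.det_zero_of_column_eq (Fin.succ_ne_zero i).symm fun s => by simp
  rw [Matrix.det_succ_column_zero] at hdet
  rw [← hdet]
  refine sum_congr rfl fun s _ => ?_
  rw [bandEntry_add_fin, mul_comm (Matrix.det _), mul_assoc]
  rfl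

theorem sum_range_bandEntry_mul (v : ℤ → Fin k → R) {c w : ℕ} (hw : c + k < w) (i : Fin k) :
    ∑ a ∈ range w, (-1) ^ a * (bandEntry v a c * v a i) = 0 := by
  have hIco : Ico c (c + (k + 1)) ⊆ range w := fun a ha => by
    rw [mem_Ico] at ha
    exact mem_range.2 (by omega)
  rw [← sum_subset hIco fun a _ ha => ?_]
  · rw [sum_Ico_eq_sum_range, Nat.add_sub_cancel_left, ← Fin.sum_univ_eq_sum_range
      fun s => (-1) ^ (c + s) * (bandEntry v (c + s : ℕ) c * v (c + s : ℕ) i)]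
    simp only [pow_add, mul_assoc, ← mul_sum, Nat.cast_add, sum_fin_bandEntry_mul, mul_zero]
  · rw [bandEntry_eq_zero, zero_mul, mul_zero]
    rw [mem_Ico] at ha
    rw [mem_Icc]
    omega

/-- The columns are, up to sign, the relations between `v_c, …, v_{c+k}` for `0 ≤ c < m`; the signs
make the lowest nonzero entry of each column a minor of `v`. -/
def relationMatrix (v : ℤ → Fin k → R) (m : ℕ) : Matrix (Fin (k + m)) (Fin m) R :=
  Matrix.of fun a c => (-1) ^ (a : ℕ) * ((-1) ^ (k + c : ℕ) * bandEntry v (a : ℕ) (c : ℕ))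

/-- The matrix whose columns are `v_0, …, v_{w-1}`. -/
def columnMatrix (v : ℤ → Fin k → R) (w : ℕ) : Matrix (Fin k) (Fin w) R :=
  Matrix.of fun i a => v (a : ℕ) i

theorem columnMatrix_mul_relationMatrix (v : ℤ → Fin k → R) (m : ℕ) :
    columnMatrix v (k + m) * relationMatrix v m = 0 := by
  ext i c
  rw [Matrix.mul_apply, Matrix.zero_apply, ← mul_zero ((-1 : R) ^ (k + c : ℕ)),
    ← sum_range_bandEntry_mul v (show (c : ℕ) + k < k + m by omega) i, mul_sum,
    ← Fin.sum_univ_eq_sum_range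
      fun a => (-1 : R) ^ (k + c : ℕ) * ((-1) ^ a * (bandEntry v a (c : ℕ) * v a i))]
  refine sum_congr rfl fun a _ => ?_
  simp only [columnMatrix, relationMatrix, Matrix.of_apply]
  ring

theorem det_fromCols_relationMatrix (v : ℤ → Fin k → R) (m : ℕ) :
    ((Matrix.fromCols ((1 : Matrix _ _ R).submatrix id (Fin.castAdd (n := k) m))
        (relationMatrix v m)).submatrix finSumFinEquiv id).det =
      ∏ c : Fin m, colMinor v (Ico (c : ℕ) ((c : ℕ) + k)) := by
  have hblocks : (Matrix.fromCols ((1 : Matrix _ _ R).submatrix id (Fin.castAdd (n := k) m))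
      (relationMatrix v m)).submatrix finSumFinEquiv id =
      Matrix.fromBlocks 1 ((relationMatrix v m).submatrix (Fin.castAdd m) id) 0
        ((relationMatrix v m).submatrix (Fin.natAdd k) id) := by
    ext a b
    rcases a with a | a <;> rcases b with b | b
    · simp [Matrix.one_apply]
    · simp
    · simp [Fin.ext_iff, (b.2.trans_le (Nat.le_add_right k a)).ne']
    · simp
  rw [hblocks, Matrix.det_fromBlocks_zero₂₁, Matrix.det_one, one_mul,
    Matrix.det_of_isUpperTriangular]
  · refine prod_congr rfl fun c _ => ?_
    rw [Matrix.submatrix_apply, id, relationMatrix, Matrix.of_apply, Fin.val_natAdd, ← mul_assoc,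
      ← mul_pow, neg_one_mul, neg_neg, one_pow, one_mul, ← bandEntry_add_right, add_comm k,
      Nat.cast_add]
  · intro a c hac
    have hac' : (c : ℕ) < a := hac
    rw [Matrix.submatrix_apply, relationMatrix, Matrix.of_apply, bandEntry_eq_zero, mul_zero,
      mul_zero]
    rw [mem_Icc, Fin.val_natAdd, id]
    omega

theorem det_submatrix_relationMatrix (v : ℤ → Fin k → R) (r : Fin m → Fin (k + m)) :
    ((relationMatrix v m).submatrix r id).det = (-1) ^ (∑ a : Fin m, ((r a : ℕ) + (k + a))) *
      (Matrix.of fun a c : Fin m => bandEntry v (r a : ℕ) (c : ℕ)).det := by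
  rw [sum_add_distrib, pow_add, ← prod_pow_eq_pow_sum, ← prod_pow_eq_pow_sum, mul_assoc,
    ← Matrix.det_mul_row, ← Matrix.det_mul_column]
  rfl

theorem colMinor_mul_det_bandEntry (v : ℤ → Fin k → R) {r : Fin m → Fin (k + m)}
    {s : Fin k → Fin (k + m)} (hr : StrictMono r) (hs : StrictMono s) (hrs : ∀ a t, s t ≠ r a) :
    colMinor v (Ico 0 k) * (Matrix.of fun a c : Fin m => bandEntry v (r a : ℕ) (c : ℕ)).det =
      (Matrix.of fun t : Fin k => v (s t : ℕ)).det *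
        ∏ c : Fin m, colMinor v (Ico (c : ℕ) ((c : ℕ) + k)) := by
  set V := columnMatrix v (k + m)
  set D := relationMatrix v m
  have hmul : Matrix.fromRows V ((1 : Matrix _ _ R).submatrix r id) *
      Matrix.fromCols ((1 : Matrix _ _ R).submatrix id (Fin.castAdd (n := k) m)) D =
      Matrix.fromBlocks (V.submatrix id (Fin.castAdd m)) 0
        ((1 : Matrix _ _ R).submatrix r (Fin.castAdd m)) (D.submatrix r id) := by
    rw [Matrix.fromRows_mul_fromCols, columnMatrix_mul_relationMatrix]
    congr 1
    · exact Matrix.mul_submatrix_one (Equiv.refl _) _ V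
    · exact Matrix.mul_submatrix_one (Equiv.refl _) _ _
    · exact Matrix.one_submatrix_mul _ (Equiv.refl _) D
  have hdet := congrArg Matrix.det hmul
  rw [det_mul_of_equiv _ _ finSumFinEquiv, det_fromRows_one_submatrix V hr hs hrs,
    det_fromCols_relationMatrix, Matrix.det_fromBlocks_zero₁₂, det_submatrix_relationMatrix,
    mul_assoc, mul_left_comm (V.submatrix id (Fin.castAdd m)).det] at hdet
  have hcancel := (isUnit_one.neg.pow _).mul_left_cancel hdet
  have hIco : colMinor v (Ico 0 k) = (V.submatrix id (Fin.castAdd m)).transpose.det := by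
    rw [colMinor_Ico_zero]
    rfl
  rw [hIco, Matrix.det_transpose, ← hcancel, ← Matrix.det_transpose (V.submatrix id s)]
  rfl

theorem det_generic_ne_zero (k : ℕ) : colMinor (fun (a : ℤ) (i : Fin k) =>
    (MvPolynomial.X (a, i) : MvPolynomial (ℤ × Fin k) ℤ)) (Ico 0 k) ≠ 0 := by
  intro h
  have heval := congrArg (MvPolynomial.eval fun x : ℤ × Fin k => if x.1 = (x.2 : ℕ) then 1 else 0) h
  rw [← colMinor_map, map_zero, colMinor_Ico_zero] at heval
  refine one_ne_zero (heval.symm.trans ?_).symm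
  rw [← Matrix.det_one (n := Fin k)]
  congr 1
  ext a b
  simp [Matrix.one_apply, Fin.ext_iff]

/-- Dividing by `colMinor v (Ico 0 k)` is legitimate for the generic family of vectors. -/
theorem det_bandEntry (v : ℤ → Fin k → R) {r : Fin (m + 1) → Fin (k + (m + 1))}
    {s : Fin k → Fin (k + (m + 1))} (hr : StrictMono r) (hs : StrictMono s)
    (hrs : ∀ a t, s t ≠ r a) :
    (Matrix.of fun a c : Fin (m + 1) => bandEntry v (r a : ℕ) (c : ℕ)).det =
      (Matrix.of fun t : Fin k => v (s t : ℕ)).det *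
        ∏ c : Fin m, colMinor v (Ico ((c : ℕ) + 1) ((c : ℕ) + 1 + k)) := by
  let w : ℤ → Fin k → MvPolynomial (ℤ × Fin k) ℤ := fun a i => MvPolynomial.X (a, i)
  let φ : MvPolynomial (ℤ × Fin k) ℤ →+* R :=
    MvPolynomial.eval₂Hom (Int.castRingHom R) fun x => v x.1 x.2
  have hφ : (fun a i => φ (w a i)) = v := by
    ext a i
    exact MvPolynomial.eval₂Hom_X' _ _ _
  have hgeneric : (Matrix.of fun a c : Fin (m + 1) => bandEntry w (r a : ℕ) (c : ℕ)).det =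
      (Matrix.of fun t : Fin k => w (s t : ℕ)).det *
        ∏ c : Fin m, colMinor w (Ico ((c : ℕ) + 1) ((c : ℕ) + 1 + k)) := by
    refine mul_left_cancel₀ (det_generic_ne_zero k) ?_
    rw [colMinor_mul_det_bandEntry w hr hs hrs, Fin.prod_univ_succ, mul_left_comm]
    simp only [Fin.val_zero, Fin.val_succ, Nat.cast_zero, Nat.cast_succ, zero_add]
    rfl
  calc
    _ = φ (Matrix.of fun a c : Fin (m + 1) => bandEntry w (r a : ℕ) (c : ℕ)).det := by
      rw [RingHom.map_det, ← hφ]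
      simp only [bandEntry_map]
      rfl
    _ = φ (Matrix.of fun t : Fin k => w (s t : ℕ)).det *
        ∏ c : Fin m, φ (colMinor w (Ico ((c : ℕ) + 1) ((c : ℕ) + 1 + k))) := by
      rw [hgeneric, map_mul, map_prod]
    _ = _ := by
      rw [RingHom.map_det, ← hφ]
      simp only [colMinor_map]
      rfl

end DualMinors

section Minor

variable {k : ℕ}

theorem minor_image (M : Matrix ℤ ℤ ℂ) {m : ℕ} {r c : Fin m → ℤ} (hr : StrictMono r)
    (hc : StrictMono c) : minor M (univ.image r) (univ.image c) = (M.submatrix r c).det := by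
  have hR : (univ.image r).card = m := by simp [card_image_of_injective _ hr.injective]
  have hC : (univ.image c).card = m := by simp [card_image_of_injective _ hc.injective]
  have hr' : (univ.image r).orderEmbOfFin rfl = r ∘ finCongr hR :=
    (orderEmbOfFin_unique rfl (fun t => mem_image_of_mem r (mem_univ _))
      (hr.comp (Fin.castOrderIso hR).strictMono)).symm
  have hc' : (univ.image c).orderEmbOfFin (hC.trans hR.symm) = c ∘ finCongr hR :=
    (orderEmbOfFin_unique _ (fun t => mem_image_of_mem c (mem_univ _))
      (hc.comp (Fin.castOrderIso hR).strictMono)).symm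
  rw [minor, dif_pos (hC.trans hR.symm), hr', hc', ← Matrix.submatrix_submatrix,
    Matrix.det_submatrix_equiv_self]

theorem exists_strictMono_image_add {c : ℤ} {w m : ℕ} {S : Finset ℤ} (hS : S ⊆ Ico c (c + w))
    (hcard : S.card = m) :
    ∃ r : Fin m → Fin w, StrictMono r ∧ univ.image (fun t => ((r t : ℕ) : ℤ) + c) = S := by
  have hmem : ∀ t, c ≤ S.orderEmbOfFin hcard t ∧ S.orderEmbOfFin hcard t < c + w := fun t =>
    mem_Ico.1 (hS (orderEmbOfFin_mem S hcard t))
  refine ⟨fun t => ⟨(S.orderEmbOfFin hcard t - c).toNat, by have := hmem t; omega⟩,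
    fun t u htu => ?_, ?_⟩
  · have := (S.orderEmbOfFin hcard).strictMono htu
    have := hmem t
    exact Fin.mk_lt_mk.2 (by omega)
  · refine Eq.trans (image_congr fun t _ => ?_) (image_orderEmbOfFin_univ S hcard)
    have := hmem t
    dsimp only
    omega

/-- Duality between the maximal minors of a family of vectors and those of its relations. -/
theorem minor_bandEntry (v : ℤ → Fin k → ℂ) (c : ℤ) (m : ℕ) {I : Finset ℤ}
    (hI : I ⊆ Icc c (c + k + m)) (hcard : I.card = k) :
    minor (Matrix.of fun a b => bandEntry v a (b - k)) (Icc c (c + k + m) \ I)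
        (Icc (c + k) (c + k + m)) =
      colMinor v I * ∏ b ∈ Ioc c (c + m), colMinor v (Ico b (b + k)) := by
  have hIco : Icc c (c + k + m) = Ico c (c + (k + (m + 1) : ℕ)) := by
    ext x
    rw [mem_Icc, mem_Ico]
    omega
  have hcard' : (Icc c (c + k + m) \ I).card = m + 1 := by
    rw [card_sdiff_of_subset hI, Int.card_Icc, hcard]
    omega
  obtain ⟨s, hs, hsI⟩ := exists_strictMono_image_add (hIco ▸ hI) hcard
  obtain ⟨r, hr, hrI⟩ := exists_strictMono_image_add (sdiff_subset.trans_eq hIco) hcard'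
  have hrs : ∀ a t, s t ≠ r a := fun a t h => by
    have hmem := mem_image_of_mem (fun t => ((r t : ℕ) : ℤ) + c) (mem_univ a)
    rw [hrI, mem_sdiff, ← hsI, ← h] at hmem
    exact hmem.2 (mem_image_of_mem (fun t => ((s t : ℕ) : ℤ) + c) (mem_univ t))
  have hcols : Icc (c + k) (c + k + m) =
      univ.image fun t : Fin (m + 1) => ((t : ℕ) : ℤ) + (c + k) := by
    rw [← Ico_add_eq_image]
    ext x
    rw [mem_Icc, mem_Ico]
    omega
  have hprod : Ioc c (c + m) = univ.image fun t : Fin m => ((t : ℕ) : ℤ) + (c + 1) := by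
    rw [← Ico_add_eq_image]
    ext x
    rw [mem_Ioc, mem_Ico]
    omega
  have hr' : StrictMono fun t => ((r t : ℕ) : ℤ) + c := (strictMono_natCast_val_add c).comp hr
  have hs' : StrictMono fun t => ((s t : ℕ) : ℤ) + c := (strictMono_natCast_val_add c).comp hs
  rw [hcols, ← hrI, minor_image _ hr' (strictMono_natCast_val_add _), hprod,
    prod_image (strictMono_natCast_val_add _).injective.injOn, ← hsI, colMinor_image v hs']
  have hdet := det_bandEntry (fun b => v (b + c)) hr hs hrs
  simp only [bandEntry_comp_add, colMinor_comp_add, image_add_right_Ico] at hdet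
  convert hdet using 2
  · ext a b
    exact congrArg (bandEntry v _) (by ring)
  · rfl
  · exact prod_congr rfl fun t _ => by ring_nf

end Minor

/-! ### Frozen entries and initial minors of the image -/

section InitialSets

theorem largest_eq {m : ℕ} {S U : Finset ℤ} (hUS : U ⊆ S) (hU : ∀ a ∈ U, ∀ b ∈ S, a < b → b ∈ U)
    (hm : U.card = m) : largest m S = U := by
  subst hm
  ext a
  rw [largest, mem_filter]
  constructor
  · rintro ⟨haS, hcard⟩
    by_contra haU
    refine (card_le_card fun b hb => ?_).not_gt hcard
    refine mem_filter.2 ⟨hUS hb, lt_of_not_ge fun hba => haU ?_⟩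
    rcases hba.lt_or_eq with h | rfl
    · exact hU b hb a haS h
    · exact hb
  · refine fun haU => ⟨hUS haU, card_lt_card ⟨fun b hb => ?_, fun h => ?_⟩⟩
    · exact hU a haU b (mem_filter.1 hb).1 (mem_filter.1 hb).2
    · exact lt_irrefl a (mem_filter.1 (h haU)).2

variable {k ℓ i : ℕ}

theorem numMutable_add (hk : 1 ≤ k) (hℓ : 1 ≤ ℓ) : numMutable k ℓ + k = (k - 1) * ℓ + 1 := by
  obtain ⟨d, rfl⟩ := Nat.exists_eq_add_of_le' hk
  obtain ⟨e, rfl⟩ := Nat.exists_eq_add_of_le' hℓ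
  simp only [numMutable, Nat.add_sub_cancel]
  ring

theorem two_le_of_mem_Icc_numMutable (hi : i ∈ Icc 1 (numMutable k ℓ)) : 2 ≤ k ∧ 2 ≤ ℓ := by
  have hN : 0 < (k - 1) * (ℓ - 1) := (mem_Icc.1 hi).1.trans (mem_Icc.1 hi).2
  have := Nat.pos_of_mul_pos_right hN
  have := Nat.pos_of_mul_pos_left hN
  omega

/-- The number `j - 1` of the block of the index `i = (j - 1)(ℓ - 1) + r`, `1 ≤ r ≤ ℓ - 1`. -/
def blockIndex (ℓ i : ℕ) : ℕ := (i - 1) / (ℓ - 1)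

theorem blockIndex_add_one_lt (hi : i ∈ Icc 1 (numMutable k ℓ)) : blockIndex ℓ i + 1 < k := by
  have := two_le_of_mem_Icc_numMutable hi
  have hlt : blockIndex ℓ i < k - 1 := by
    rw [blockIndex, Nat.div_lt_iff_lt_mul (by omega)]
    rw [mem_Icc, numMutable] at hi
    omega
  omega

theorem blockIndex_mul_lt (hi : 1 ≤ i) (hℓ : 2 ≤ ℓ) :
    (blockIndex ℓ i : ℤ) * ℓ < i + blockIndex ℓ i := by
  obtain ⟨e, rfl⟩ := Nat.exists_eq_add_of_le' hℓ
  have h : blockIndex (e + 2) i * (e + 1) ≤ i - 1 := Nat.div_mul_le_self _ _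
  zify [hi] at h
  push_cast
  linarith

theorem add_blockIndex_le (hi : 1 ≤ i) (hℓ : 2 ≤ ℓ) :
    (i : ℤ) + blockIndex ℓ i ≤ (blockIndex ℓ i + 1) * ℓ := by
  obtain ⟨e, rfl⟩ := Nat.exists_eq_add_of_le' hℓ
  have h : i - 1 < (blockIndex (e + 2) i + 1) * (e + 1) :=
    (Nat.div_lt_iff_lt_mul e.succ_pos).1 (Nat.lt_succ_self _)
  zify [hi] at h
  push_cast
  linarith

theorem initSet_of_mem (hi : i ∈ Icc 1 (numMutable k ℓ)) :
    initSet k ℓ i = Icc (i : ℤ) (i + blockIndex ℓ i) ∪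
      (Ico (blockIndex ℓ i + 1) k).image fun t : ℕ => 1 + (t : ℤ) * ℓ := by
  simp only [initSet, if_pos (mem_Icc.1 hi).2, blockIndex, Nat.cast_add, Nat.cast_one, ← add_assoc,
    add_sub_cancel_right]

theorem mem_initSet_iff (hi : i ∈ Icc 1 (numMutable k ℓ)) {x : ℤ} :
    x ∈ initSet k ℓ i ↔ x ∈ Icc (i : ℤ) ((k - 1 : ℕ) * ℓ + 1) ∧
      (x ≤ i + blockIndex ℓ i ∨ x ≡ 1 [ZMOD ℓ]) := by
  have hb := blockIndex_add_one_lt hi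
  have hℓ := (two_le_of_mem_Icc_numMutable hi).2
  have hlow := blockIndex_mul_lt (mem_Icc.1 hi).1 hℓ
  have hhigh := add_blockIndex_le (mem_Icc.1 hi).1 hℓ
  simp only [initSet_of_mem hi, mem_union, mem_Icc, mem_image, mem_Ico]
  constructor
  · rintro (⟨hix, hxb⟩ | ⟨t, ⟨hbt, htk⟩, rfl⟩)
    · have : ((blockIndex ℓ i : ℤ) + 1) * ℓ ≤ (k - 1 : ℕ) * ℓ := by gcongr; omega
      exact ⟨⟨hix, by omega⟩, .inl hxb⟩
    · have : ((blockIndex ℓ i : ℤ) + 1) * ℓ ≤ t * ℓ := by gcongr; omega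
      have : (t : ℤ) * ℓ ≤ (k - 1 : ℕ) * ℓ := by gcongr; omega
      exact ⟨⟨by omega, by omega⟩, .inr (by simp)⟩
  · rintro ⟨⟨hix, hxk⟩, hx⟩
    by_cases hxb : x ≤ i + blockIndex ℓ i
    · exact .inl ⟨hix, hxb⟩
    obtain ⟨t, ht⟩ := (hx.resolve_left hxb).symm.dvd
    obtain rfl : x = 1 + t * ℓ := by linarith
    have hbt : (blockIndex ℓ i : ℤ) < t := by
      refine lt_of_mul_lt_mul_right (a := (ℓ : ℤ)) ?_ (by omega)
      omega
    have htk : t ≤ (k - 1 : ℕ) := by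
      refine le_of_mul_le_mul_right (a := (ℓ : ℤ)) ?_ (by omega)
      omega
    exact .inr ⟨t.toNat, by omega, by rw [Int.toNat_of_nonneg (by omega)]⟩

theorem card_initSet (hi : i ∈ Icc 1 (numMutable k ℓ)) : (initSet k ℓ i).card = k := by
  have hb := blockIndex_add_one_lt hi
  have hℓ := (two_le_of_mem_Icc_numMutable hi).2
  have hhigh := add_blockIndex_le (mem_Icc.1 hi).1 hℓ
  rw [initSet_of_mem hi, card_union_of_disjoint, Int.card_Icc, card_image_of_injOn, Nat.card_Ico]
  · omega
  · intro s _ t _ hst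
    simpa [show ℓ ≠ 0 by omega] using hst
  · simp only [disjoint_left, mem_Icc, mem_image, mem_Ico]
    rintro x ⟨_, hxb⟩ ⟨t, ⟨hbt, -⟩, rfl⟩
    have : ((blockIndex ℓ i : ℤ) + 1) * ℓ ≤ t * ℓ := by gcongr; omega
    omega

theorem initSet_subset (hi : i ∈ Icc 1 (numMutable k ℓ)) :
    initSet k ℓ i ⊆ Icc (i : ℤ) ((k - 1 : ℕ) * ℓ + 1) :=
  fun _ hx => ((mem_initSet_iff hi).1 hx).1

theorem card_Icc_sdiff_initSet (hi : i ∈ Icc 1 (numMutable k ℓ)) :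
    (Icc (i : ℤ) ((k - 1 : ℕ) * ℓ + 1) \ initSet k ℓ i).card = numMutable k ℓ - i + 1 := by
  have hkℓ := two_le_of_mem_Icc_numMutable hi
  have hN := numMutable_add (k := k) (ℓ := ℓ) (by omega) (by omega)
  zify at hN
  have := mem_Icc.1 hi
  rw [card_sdiff_of_subset (initSet_subset hi), card_initSet hi, Int.card_Icc]
  omega

theorem initRows_eq (hi : i ∈ Icc 1 (numMutable k ℓ)) :
    initRows k ℓ i = Icc (i : ℤ) ((k - 1 : ℕ) * ℓ + 1) \ initSet k ℓ i := by
  have hchar : ∀ x : ℤ, x ∈ Icc (i : ℤ) ((k - 1 : ℕ) * ℓ + 1) \ initSet k ℓ i ↔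
      x ∈ ((Icc (1 : ℤ) ((k - 1 : ℕ) * ℓ)).filter fun j => ¬ j ≡ 1 [ZMOD ℓ]) ∧
        i + blockIndex ℓ i < x := fun x => by
    have hlast : ((k - 1 : ℕ) : ℤ) * ℓ + 1 ≡ 1 [ZMOD ℓ] := by simp
    have hi1 := (mem_Icc.1 hi).1
    simp only [mem_sdiff, mem_initSet_iff hi, mem_filter, mem_Icc]
    constructor
    · rintro ⟨⟨hix, hxk⟩, hx⟩
      have hx1 : ¬ x ≡ 1 [ZMOD ℓ] := fun h => hx ⟨⟨hix, hxk⟩, .inr h⟩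
      have hxne : x ≠ (k - 1 : ℕ) * ℓ + 1 := fun h => hx1 (h ▸ hlast)
      exact ⟨⟨by omega, hx1⟩, lt_of_not_ge fun h => hx ⟨⟨hix, hxk⟩, .inl h⟩⟩
    · rintro ⟨⟨⟨_, hxk⟩, hx1⟩, hbx⟩
      exact ⟨by omega, fun h => h.2.elim hbx.not_ge hx1⟩
  exact largest_eq (fun x hx => ((hchar x).1 hx).1)
    (fun a ha b hb hab => (hchar b).2 ⟨hb, ((hchar a).1 ha).2.trans hab⟩)
    (card_Icc_sdiff_initSet hi)

theorem initSet_numMutable_add {j : ℕ} (hj : 1 ≤ j) :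
    initSet k ℓ (numMutable k ℓ + j) = Icc ((j : ℤ) - k + 1) j := by
  rw [initSet, if_neg (by omega), Nat.cast_add, add_sub_cancel_left]

theorem resIcc_eq (hℓ : 0 < ℓ) (a : ℤ) : (resIcc ℓ a : ℤ) = a - (a - 1) / ℓ * ℓ := by
  have := Int.emod_add_ediv_mul (a - 1) ℓ
  rw [resIcc, Nat.cast_succ, Int.toNat_of_nonneg (Int.emod_nonneg _ (by omega))]
  linarith

end InitialSets

section BandImage

variable {k n ℓ : ℕ} [NeZero n] {X : Matrix (Fin k) (Fin n) ℂ}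

theorem colMinor_image_add_of_mem_distinguished {p : ℕ} [NeZero k] (hpn : n = p * ℓ)
    (hX : X ∈ distinguished k n ℓ) (I : Finset ℤ) :
    colMinor (col X) (I.image (· + (ℓ : ℤ))) = colMinor (col X) I := by
  obtain ⟨T, hT⟩ := exists_mul_rho_pow_eq (mem_fixedLocus_of_mem_distinguished hX)
  rw [← colMinor_comp_add, funext (col_add_of_mul_rho_pow_eq hT), colMinor_mulVec,
    det_eq_one_of_mem_distinguished hpn hX hT, one_mul]

theorem phi'_eq_bandEntry (hkn : k < n) (X : Matrix (Fin k) (Fin n) ℂ) (i j : ℤ) :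
    phi' X i j = bandEntry (col X) i (j - k) := by
  rw [phi'_apply X hkn, bandEntry, sub_add_cancel]

theorem phi'_diag (hkn : k < n) (X : Matrix (Fin k) (Fin n) ℂ) (i : ℤ) :
    phi' X i i = colMinor (col X) (Ico (i - k) i) := by
  have h := bandEntry_add_right (col X) (i - k)
  rwa [sub_add_cancel, ← phi'_eq_bandEntry hkn] at h

theorem phi'_outer (hkn : k < n) (X : Matrix (Fin k) (Fin n) ℂ) (i : ℤ) :
    phi' X (i - k - 1) (i - 1) = colMinor (col X) (Ico (i - k) i) := by
  rw [phi'_eq_bandEntry hkn, sub_right_comm, bandEntry_self, sub_add_cancel]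
  congr 1
  ext x
  rw [mem_Ioc, mem_Ico]
  omega

variable (hper : ∀ I : Finset ℤ, colMinor (col X) (I.image (· + (ℓ : ℤ))) = colMinor (col X) I)
include hper

theorem phi'_mem_band (hkn : k < n) : phi' X ∈ band k ℓ := by
  refine ⟨fun i j hij => ?_, fun i j => ?_⟩
  · rw [phi'_eq_bandEntry hkn, bandEntry_eq_zero]
    rw [mem_Icc]
    omega
  · rw [phi'_apply X hkn, phi'_apply X hkn, ← hper ((Icc (j - k) j).erase i),
      image_erase (add_left_injective _), image_add_right_Icc, sub_add_eq_add_sub]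

theorem plucker_frozen (hℓ : 0 < ℓ) (hkn : k < n) (a : ℤ) :
    plucker X (initSet k ℓ (numMutable k ℓ + resIcc ℓ a)) =
      colMinor (col X) (Ico (a + 1 - k) (a + 1)) := by
  have hperiodic : Function.Periodic (fun b : ℤ => colMinor (col X) (Ico (b + 1 - k) (b + 1))) ℓ :=
    fun b => by
      dsimp only
      rw [← hper (Ico (b + 1 - k) (b + 1)), image_add_right_Ico]
      congr 2 <;> ring
  have hIcc : Icc ((resIcc ℓ a : ℤ) - k + 1) (resIcc ℓ a) =
      Ico ((resIcc ℓ a : ℤ) + 1 - k) (resIcc ℓ a + 1) := by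
    ext x
    rw [mem_Icc, mem_Ico]
    omega
  have hres : 1 ≤ resIcc ℓ a := Nat.le_add_left _ _
  rw [initSet_numMutable_add hres, hIcc,
    plucker_eq_colMinor X ((resIcc ℓ a : ℤ) + 1 - k)
      (Ico_subset_Ico_right (by omega)), resIcc_eq hℓ]
  exact hperiodic.sub_int_mul_eq ((a - 1) / ℓ)

theorem initMinor_phi' (hkn : k * ℓ ≤ n) {i : ℕ} (hi : i ∈ Icc 1 (numMutable k ℓ)) :
    initMinor k ℓ i (phi' X) = plucker X (initSet k ℓ i) * ∏ b ∈ Ico i (numMutable k ℓ),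
      plucker X (initSet k ℓ (numMutable k ℓ + resIcc ℓ (b + k))) := by
  have hkℓ := two_le_of_mem_Icc_numMutable hi
  obtain ⟨m, hm⟩ := Nat.exists_eq_add_of_le (mem_Icc.1 hi).2
  have hwidth := numMutable_add (k := k) (ℓ := ℓ) (by omega) (by omega)
  have hlast : ((k - 1 : ℕ) : ℤ) * ℓ + 1 = i + k + m := by
    rw [hm] at hwidth
    zify at hwidth
    linarith
  have hkℓn : (k - 1) * ℓ + ℓ ≤ n := by
    rwa [← Nat.succ_mul, Nat.succ_eq_add_one, Nat.sub_add_cancel (by omega)]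
  have hlt : k < n := by nlinarith
  have hsub : initSet k ℓ i ⊆ Icc (i : ℤ) (i + k + m) := hlast ▸ initSet_subset hi
  have hphi : phi' X = Matrix.of fun a b => bandEntry (col X) a (b - k) :=
    Matrix.ext (phi'_eq_bandEntry hlt X)
  rw [initMinor, initRows_eq hi, initCols, hlast, hphi, add_comm (k : ℤ),
    minor_bandEntry _ _ _ hsub (card_initSet hi), plucker_eq_colMinor X i fun x hx => ?_]
  · congr 1
    simp only [plucker_frozen hper (by omega) hlt]
    symm
    refine prod_nbij (fun b : ℕ => (b : ℤ) + 1) (fun b hb => ?_) (fun a _ b _ hab => ?_)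
      (fun c hc => ⟨(c - 1).toNat, ?_⟩) fun b _ => ?_
    · rw [mem_Ico] at hb
      exact mem_Ioc.2 ⟨by omega, by omega⟩
    · simpa using hab
    · rw [coe_Ioc, Set.mem_Ioc] at hc
      rw [coe_Ico, Set.mem_Ico]
      exact ⟨⟨by omega, by omega⟩, by dsimp only; omega⟩
    · congr 2 <;> ring
  · have := mem_Icc.1 (hsub hx)
    have := (mem_Icc.1 hi).1
    zify at hkℓn
    exact mem_Ico.2 ⟨by omega, by omega⟩

end BandImage

/-! ### The coefficient strings -/

section Pencil

variable {K : Type*} [Field K] {k ℓ : ℕ}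

theorem X_pow_dvd_det_X_smul_add {m : ℕ} (hm : m ≤ ℓ) {A : Matrix (Fin ℓ) (Fin ℓ) K}
    (hA : ∀ a (b : Fin ℓ), (b : ℕ) < m → A a b = 0) (B : Matrix (Fin ℓ) (Fin ℓ) K) :
    (X : K[X]) ^ m ∣ ((X : K[X]) • B.map C + A.map C).det := by
  have hfactor : (X : K[X]) • B.map C + A.map C = Matrix.of fun a (b : Fin ℓ) =>
      (if (b : ℕ) < m then X else 1) *
        if (b : ℕ) < m then C (B a b) else X * C (B a b) + C (A a b) := by
    ext1 a b
    rw [Matrix.add_apply, Matrix.smul_apply, Matrix.map_apply, Matrix.map_apply, Matrix.of_apply,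
      smul_eq_mul]
    split_ifs with hb
    · rw [hA a b hb, map_zero, add_zero]
    · rw [one_mul]
  have hprod : ∏ b : Fin ℓ, (if (b : ℕ) < m then X else 1 : K[X]) = X ^ m := by
    rw [prod_ite, prod_const, prod_const_one, mul_one, Fin.card_filter_val_lt, min_eq_right hm]
  rw [hfactor, ← hprod]
  exact Dvd.intro _ (Matrix.det_mul_row _ _).symm

theorem eq_C_mul_prod_X_sub_C_mul_X_pow {D : K[X]} (hkℓ : k ≤ ℓ) (hdeg : D.natDegree ≤ ℓ)
    (hdvd : X ^ (ℓ - k) ∣ D) {r : Fin k → K} (hinj : Function.Injective r) (hr : ∀ j, r j ≠ 0)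
    (hroot : ∀ j, D.IsRoot (r j)) :
    D = C (D.coeff ℓ) * ((∏ j, (X - C (r j))) * X ^ (ℓ - k)) := by
  set Q : K[X] := (∏ j, (X - C (r j))) * X ^ (ℓ - k)
  have hmonic : Q.Monic := (monic_prod_X_sub_C r univ).mul (monic_X_pow _)
  have hQdeg : Q.natDegree = ℓ := by
    rw [(monic_prod_X_sub_C r univ).natDegree_mul (monic_X_pow _),
      natDegree_finsetProd_X_sub_C_eq_card, natDegree_X_pow, card_univ, Fintype.card_fin]
    omega
  have hcoprime : IsCoprime (∏ j, (X - C (r j))) ((X : K[X]) ^ (ℓ - k)) := by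
    refine (IsCoprime.prod_left fun j _ => ?_).pow_right
    have := isCoprime_X_sub_C_of_isUnit_sub (a := r j) (b := 0) (by simpa using hr j)
    rwa [C_0, sub_zero] at this
  have hQ : Q ∣ D := hcoprime.mul_dvd
    (prod_dvd_of_coprime ((pairwise_coprime_X_sub_C hinj).set_pairwise _)
      fun j _ => dvd_iff_isRoot.2 (hroot j)) hdvd
  have hlead := eq_leadingCoeff_mul_of_monic_of_dvd_of_natDegree_le hmonic hQ (hdeg.trans hQdeg.ge)
  have hcoeff : D.coeff ℓ = D.leadingCoeff := by
    conv_lhs => rw [hlead, coeff_C_mul, ← hQdeg, hmonic.coeff_natDegree, mul_one]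
  rwa [hcoeff]

theorem det_X_smul_add_eq {A B : Matrix (Fin ℓ) (Fin ℓ) K} (hkℓ : k ≤ ℓ)
    (hA : ∀ a (b : Fin ℓ), (b : ℕ) < ℓ - k → A a b = 0) {r : Fin k → K}
    (hinj : Function.Injective r) (hr : ∀ j, r j ≠ 0) (hroot : ∀ j, (r j • B + A).det = 0) :
    ((X : K[X]) • B.map C + A.map C).det =
      C B.det * ((∏ j, (X - C (r j))) * X ^ (ℓ - k)) := by
  have hlead := coeff_det_X_add_C_card B A
  have hdeg := natDegree_det_X_add_C_le B A
  rw [Fintype.card_fin] at hlead hdeg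
  rw [← hlead]
  refine eq_C_mul_prod_X_sub_C_mul_X_pow hkℓ hdeg
    (X_pow_dvd_det_X_smul_add (Nat.sub_le _ _) hA B) hinj hr fun j => ?_
  rw [IsRoot, ← hroot j, ← coe_evalRingHom, RingHom.map_det]
  congr 1
  ext a b
  simpa using mul_comm _ _

theorem vecMul_bandEntry_eq_zero (v : ℤ → Fin k → K) (hkℓ : k < ℓ) {u : Fin k → K} {lam t : K}
    (hu : ∀ a, u ⬝ᵥ v (a + ℓ) = lam * (u ⬝ᵥ v a)) (ht : t * lam = (-1) ^ ℓ) :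
    Matrix.vecMul (fun a : Fin ℓ => (-1) ^ (a : ℕ) * (u ⬝ᵥ v (a : ℕ)))
      (Matrix.of fun a b : Fin ℓ =>
        t * bandEntry v (a : ℕ) (b : ℕ) + bandEntry v ((a : ℕ) + ℓ) (b : ℕ)) = 0 := by
  ext b
  have hrel : ∑ a ∈ range (ℓ + ℓ), (-1) ^ a * (bandEntry v a (b : ℕ) * (u ⬝ᵥ v a)) = 0 := by
    simp only [dotProduct, mul_sum]
    rw [sum_comm]
    refine sum_eq_zero fun i _ => ?_
    rw [← mul_zero (u i), ← sum_range_bandEntry_mul v (by omega : (b : ℕ) + k < ℓ + ℓ) i, mul_sum]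
    exact sum_congr rfl fun a _ => by ring
  rw [sum_range_add, ← sum_add_distrib, ← Fin.sum_univ_eq_sum_range
    fun a => (-1) ^ a * (bandEntry v a (b : ℕ) * (u ⬝ᵥ v a)) +
      (-1) ^ (ℓ + a) * (bandEntry v ((ℓ + a : ℕ) : ℤ) (b : ℕ) * (u ⬝ᵥ v ((ℓ + a : ℕ) : ℤ)))] at hrel
  rw [Pi.zero_apply, ← mul_zero t, ← hrel, mul_sum, Matrix.vecMul, dotProduct]
  refine sum_congr rfl fun a _ => ?_
  have hsq : ((-1 : K) ^ ℓ) * (-1) ^ ℓ = 1 := by rw [← mul_pow, neg_one_mul, neg_neg, one_pow]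
  rw [Matrix.of_apply, add_comm ℓ, Nat.cast_add, hu, pow_add]
  linear_combination ((-1) ^ (a : ℕ) * (u ⬝ᵥ v (a : ℕ)) * bandEntry v ((a : ℕ) + ℓ) (b : ℕ)) *
    (-hsq - (-1) ^ ℓ * ht)

end Pencil

section GaussBinomial

variable {K : Type*} [Field K]

/-- The monic polynomial with roots `c h^(k-1), c h^(k-3), …, c h^(1-k)`. Up to powers of `-c`, its
coefficients are the `q`-binomial coefficients at `q = h²`. -/
def gaussPoly (h c : K) (k : ℕ) : K[X] := ∏ j ∈ range k, (X - C (c * h ^ ((k : ℤ) - 1 - 2 * j)))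

theorem gaussPoly_comp_mul {h : K} (hh : h ≠ 0) (c : K) (k : ℕ) :
    (gaussPoly h c k).comp (C (h ^ 2) * X) * (X - C (c * h ^ ((k : ℤ) - 1))) =
      C (h ^ 2) ^ k * (gaussPoly h c k * (X - C (c * h ^ ((k : ℤ) - 1 - 2 * k)))) := by
  have hfactor : ∀ j : ℕ, (X - C (c * h ^ ((k : ℤ) - 1 - 2 * j))).comp (C (h ^ 2) * X) =
      C (h ^ 2) * (X - C (c * h ^ ((k : ℤ) - 1 - 2 * (j + 1 : ℕ)))) := fun j => by
    rw [sub_comp, X_comp, C_comp, mul_sub, ← C_mul, mul_left_comm, ← zpow_natCast h 2,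
      ← zpow_add₀ hh]
    congr 5
    push_cast
    ring
  have hzero : c * h ^ ((k : ℤ) - 1) = c * h ^ ((k : ℤ) - 1 - 2 * (0 : ℕ)) := by simp
  rw [gaussPoly, Polynomial.prod_comp, prod_congr rfl fun j _ => hfactor j, prod_mul_distrib,
    prod_const, card_range, mul_assoc, hzero, ← prod_range_succ' fun j : ℕ =>
      X - C (c * h ^ ((k : ℤ) - 1 - 2 * j)), prod_range_succ]

theorem coeff_gaussPoly_mul {h : K} (hh : h ≠ 0) (c : K) {k m : ℕ} (hm : m ≤ k) :
    (gaussPoly h c k).coeff m * (h ^ (k - m) - (h ^ (k - m))⁻¹) =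
      -c * ((gaussPoly h c k).coeff (m + 1) * (h ^ (m + 1) - (h ^ (m + 1))⁻¹)) := by
  obtain ⟨d, rfl⟩ := Nat.exists_eq_add_of_le hm
  have hcoeff := congrArg (coeff · (m + 1)) (gaussPoly_comp_mul hh c (m + d))
  simp only [coeff_mul_X_sub_C, comp_C_mul_X_coeff, ← C_pow, coeff_C_mul] at hcoeff
  have hfirst : h ^ (((m + d : ℕ) : ℤ) - 1) = h ^ m * h ^ d / h := by
    rw [zpow_sub_one₀ hh, zpow_natCast, pow_add, div_eq_mul_inv]
  have hlast : h ^ (((m + d : ℕ) : ℤ) - 1 - 2 * (m + d : ℕ)) = (h ^ m * h ^ d * h)⁻¹ := by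
    rw [← pow_add, ← pow_succ, ← zpow_natCast, ← zpow_neg]
    congr 1
    push_cast
    ring
  rw [hfirst, hlast] at hcoeff
  have hsq : ∀ e, (h ^ 2) ^ e = (h ^ e) ^ 2 := fun e => pow_right_comm h 2 e
  simp only [Nat.add_sub_cancel_left, hsq, pow_add, pow_one] at hcoeff ⊢
  field_simp at hcoeff ⊢
  linear_combination -hcoeff

end GaussBinomial

section Eta

variable {k p : ℕ}

theorem isPrimitiveRoot_exp_pi_sq (hp : p ≠ 0) :
    IsPrimitiveRoot (Complex.exp (Real.pi * Complex.I / p) ^ 2) p := by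
  convert Complex.isPrimitiveRoot_exp p hp using 1
  rw [← Complex.exp_nat_mul]
  congr 1
  push_cast
  ring

theorem exp_pi_pow_sub_inv_ne_zero {m : ℕ} (hm : 0 < m) (hmp : m < p) :
    Complex.exp (Real.pi * Complex.I / p) ^ m -
      (Complex.exp (Real.pi * Complex.I / p) ^ m)⁻¹ ≠ 0 := by
  intro h
  refine Nat.not_dvd_of_pos_of_lt hm hmp
    ((isPrimitiveRoot_exp_pi_sq (by omega)).dvd_of_pow_eq_one m ?_)
  rw [pow_right_comm, sq]
  nth_rw 2 [sub_eq_zero.1 h]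
  exact mul_inv_cancel₀ (pow_ne_zero _ (Complex.exp_ne_zero _))

theorem qInt_ne_zero {m : ℕ} (hm : 0 < m) (hmp : m < p) : qInt p m ≠ 0 := by
  refine div_ne_zero (exp_pi_pow_sub_inv_ne_zero hm hmp) ?_
  simpa using exp_pi_pow_sub_inv_ne_zero one_pos (by omega : 1 < p)

theorem qFactorial_ne_zero {m : ℕ} (hmp : m < p) : qFactorial p m ≠ 0 :=
  prod_ne_zero_iff.2 fun _ hj =>
    qInt_ne_zero (mem_Icc.1 hj).1 ((mem_Icc.1 hj).2.trans_lt hmp)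

theorem qFactorial_succ (p m : ℕ) : qFactorial p (m + 1) = qFactorial p m * qInt p (m + 1) :=
  prod_Icc_succ_top (Nat.le_add_left 1 m) _

theorem prod_X_sub_C_shiftEigenvalue (c : ℂ) :
    ∏ j : Fin k, (X - C (c * shiftEigenvalue k p j)) =
      gaussPoly (Complex.exp (Real.pi * Complex.I / p)) c k :=
  Fin.prod_univ_eq_prod_range (fun j => X - C (c * shiftEigenvalue k p j)) k

theorem coeff_prod_X_sub_C_shiftEigenvalue_mul (c : ℂ) {s : ℕ} (hs : s ≤ k) :
    (∏ j : Fin k, (X - C (c * shiftEigenvalue k p j))).coeff (k - s) *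
      (qFactorial p s * qFactorial p (k - s)) = (-c) ^ s * qFactorial p k := by
  induction s with
  | zero =>
    have hmonic := monic_prod_X_sub_C (fun j : Fin k => c * shiftEigenvalue k p j) univ
    have hlead := hmonic.coeff_natDegree
    rw [natDegree_finsetProd_X_sub_C_eq_card, card_univ, Fintype.card_fin] at hlead
    rw [Nat.sub_zero, hlead, pow_zero, one_mul, one_mul, qFactorial, Icc_eq_empty_of_lt one_pos,
      prod_empty, one_mul]
  | succ s ih =>
    specialize ih (by omega)
    rw [prod_X_sub_C_shiftEigenvalue] at ih ⊢
    have hrec := coeff_gaussPoly_mul (Complex.exp_ne_zero (Real.pi * Complex.I / p)) c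
      (Nat.sub_le k (s + 1))
    obtain ⟨d, rfl⟩ := Nat.exists_eq_add_of_le hs
    simp only [Nat.add_sub_cancel_left, Nat.add_sub_cancel, show s + 1 + d - s = d + 1 by omega,
      qFactorial_succ] at hrec ih ⊢
    have hq : (gaussPoly (Complex.exp (Real.pi * Complex.I / p)) c (s + 1 + d)).coeff d *
        qInt p (s + 1) = -c * ((gaussPoly (Complex.exp (Real.pi * Complex.I / p)) c
          (s + 1 + d)).coeff (d + 1) * qInt p (d + 1)) := by
      simp only [qInt, ← mul_div_assoc]
      rw [hrec]
    linear_combination qFactorial p s * qFactorial p d * hq - c * ih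

theorem coeff_prod_X_sub_C_shiftEigenvalue (hp : k ≤ p) (c : ℂ) {s : ℕ} (hs : s ∈ Icc 1 (k - 1)) :
    (∏ j : Fin k, (X - C (c * shiftEigenvalue k p j))).coeff (k - s) = (-c) ^ s * eta k p s := by
  rw [mem_Icc] at hs
  rw [eta, ← mul_div_assoc, eq_div_iff (mul_ne_zero (qFactorial_ne_zero (by omega))
    (qFactorial_ne_zero (by omega))), coeff_prod_X_sub_C_shiftEigenvalue_mul c (by omega)]

theorem shiftEigenvalue_injective (hp : k ≤ p) :
    Function.Injective fun j : Fin k => shiftEigenvalue k p j := by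
  have hh := Complex.exp_ne_zero (Real.pi * Complex.I / p)
  intro i j hij
  have hp0 : p ≠ 0 := by have := i.2; omega
  refine Fin.ext ((isPrimitiveRoot_exp_pi_sq hp0).pow_inj (i.2.trans_le hp) (j.2.trans_le hp) ?_)
  simp only [shiftEigenvalue, zpow_sub₀ hh, zpow_mul, zpow_natCast, zpow_ofNat] at hij
  exact inv_injective (mul_left_cancel₀ (by simp [hh]) hij)

theorem shiftEigenvalue_mul_rev (j : Fin k) :
    shiftEigenvalue k p j * shiftEigenvalue k p j.rev = 1 := by
  rw [shiftEigenvalue, shiftEigenvalue, ← zpow_add₀ (Complex.exp_ne_zero _), Fin.val_rev,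
    Nat.cast_sub (by omega)]
  convert zpow_zero _ using 2
  push_cast
  ring

end Eta

section StringValues

variable {k ℓ n : ℕ} [NeZero n] {X : Matrix (Fin k) (Fin n) ℂ}

theorem prod_range_add_of_periodic {M : Type*} [CommMonoid M] {F : ℤ → M} {m : ℕ}
    (hF : Function.Periodic F m) (c : ℤ) :
    ∏ i ∈ range m, F (i + c) = ∏ i ∈ range m, F i := by
  have hshift : Function.Periodic (fun c : ℤ => ∏ i ∈ range m, F (i + c)) 1 := fun c => by
    cases m with
    | zero => rfl
    | succ m =>
      dsimp only
      rw [prod_range_succ, prod_range_succ']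
      congr 1
      · exact prod_congr rfl fun i _ => congrArg F (by push_cast; ring)
      · exact (congrArg F (by push_cast; ring)).trans (hF _)
  simpa using hshift.int_mul_eq c

theorem resIcc_natCast {i : ℕ} (hi : i ∈ Icc 1 ℓ) : resIcc ℓ i = i := by
  rw [mem_Icc] at hi
  rw [resIcc, Int.emod_eq_of_lt (by omega) (by omega)]
  omega

theorem resIcc_add (a : ℤ) : resIcc ℓ (a + ℓ) = resIcc ℓ a := by
  rw [resIcc, resIcc, add_sub_right_comm, Int.add_emod_right]

theorem matB_phi' (hkn : k < n) (a b : Fin ℓ) :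
    matB k ℓ (phi' X) a b = bandEntry (fun c => col X (c + 1)) (a : ℕ) (b : ℕ) := by
  rw [bandEntry_comp_add, ← add_sub_cancel_right (((b : ℕ) : ℤ) + 1) k, ← phi'_eq_bandEntry hkn]
  rfl

theorem matA_phi' (hper : ∀ I, colMinor (col X) (I.image (· + (ℓ : ℤ))) = colMinor (col X) I)
    (hkn : k < n) (a b : Fin ℓ) :
    matA k ℓ (phi' X) a b = bandEntry (fun c => col X (c + 1)) ((a : ℕ) + ℓ) (b : ℕ) := by
  rw [bandEntry_comp_add]
  simp only [matA, Matrix.of_apply]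
  split_ifs with h
  · rw [← (phi'_mem_band hper hkn).2, phi'_eq_bandEntry hkn]
    congr 1 <;> ring
  · rw [bandEntry_eq_zero]
    rw [mem_Icc]
    omega

theorem det_smul_matB_add_matA_eq_zero
    (hper : ∀ I, colMinor (col X) (I.image (· + (ℓ : ℤ))) = colMinor (col X) I)
    (hkℓ : k < ℓ) (hkn : k < n) (hX : X.rank = k) {T : Matrix (Fin k) (Fin k) ℂ}
    (hT : X * rho k n ^ ℓ = T * X) {lam t : ℂ} (hlam : T.charpoly.IsRoot lam)
    (ht : t * lam = (-1) ^ ℓ) :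
    (t • matB k ℓ (phi' X) + matA k ℓ (phi' X)).det = 0 := by
  rw [IsRoot, Matrix.eval_charpoly, ← Matrix.exists_vecMul_eq_zero_iff] at hlam
  obtain ⟨u, hu0, hu⟩ := hlam
  have hT' : Matrix.vecMul u T = lam • u := by
    rw [Matrix.vecMul_sub, sub_eq_zero] at hu
    rw [← hu]
    simp
  set v : ℤ → Fin k → ℂ := fun c => col X (c + 1)
  have hshift : ∀ a, u ⬝ᵥ v (a + ℓ) = lam * (u ⬝ᵥ v a) := fun a => by
    simp only [v]
    rw [add_right_comm, col_add_of_mul_rho_pow_eq hT, Matrix.dotProduct_mulVec, hT',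
      smul_dotProduct, smul_eq_mul]
  have hmatrix : t • matB k ℓ (phi' X) + matA k ℓ (phi' X) = Matrix.of fun a b : Fin ℓ =>
      t * bandEntry v (a : ℕ) (b : ℕ) + bandEntry v ((a : ℕ) + ℓ) (b : ℕ) := by
    ext a b
    rw [Matrix.add_apply, Matrix.smul_apply, matB_phi' hkn, matA_phi' hper hkn]
    rfl
  refine Matrix.exists_vecMul_eq_zero_iff.1 ⟨_, fun hzero => hu0 ?_,
    hmatrix ▸ vecMul_bandEntry_eq_zero v hkℓ hshift ht⟩
  have hvanish : ∀ m : ℕ, u ⬝ᵥ v m = 0 := fun m => by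
    induction m using Nat.strong_induction_on with
    | _ m ih =>
      rcases lt_or_ge m ℓ with hm | hm
      · simpa using congrFun hzero ⟨m, hm⟩
      · have := hshift (m - ℓ : ℕ)
        rwa [ih _ (by omega), mul_zero, ← Nat.cast_add, Nat.sub_add_cancel hm] at this
  refine vecMul_injective_of_rank_eq hX ((funext fun c => ?_).trans (Matrix.zero_vecMul X).symm)
  rw [Pi.zero_apply, ← hvanish c]
  simp only [v, col_natCast_add_one]
  rfl

theorem det_matB (hper : ∀ I, colMinor (col X) (I.image (· + (ℓ : ℤ))) = colMinor (col X) I)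
    (hkn : k < n) :
    (matB k ℓ (phi' X)).det = ∏ i ∈ Icc 1 ℓ, plucker X (initSet k ℓ (numMutable k ℓ + i)) := by
  have hlower : (matB k ℓ (phi' X)).IsLowerTriangular := fun a b hab => by
    rw [matB_phi' hkn, bandEntry_eq_zero]
    rw [mem_Icc]
    have : a < b := hab
    omega
  rw [Matrix.det_of_isLowerTriangular _ hlower]
  have hdiag : ∀ a : Fin ℓ, matB k ℓ (phi' X) a a =
      plucker X (initSet k ℓ (numMutable k ℓ + resIcc ℓ ((a : ℕ) + (1 + k)))) := fun a => by
    rw [matB_phi' hkn, bandEntry_comp_add, bandEntry_self,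
      plucker_frozen hper (Nat.zero_lt_of_lt a.2) hkn]
    congr 1
    ext
    simp only [mem_Ioc, mem_Ico]
    omega
  have hperiodic : Function.Periodic
      (fun a : ℤ => plucker X (initSet k ℓ (numMutable k ℓ + resIcc ℓ a))) ℓ := fun a => by
    simp only [resIcc_add]
  rw [prod_congr rfl fun a _ => hdiag a, Fin.prod_univ_eq_prod_range
    (fun a => plucker X (initSet k ℓ (numMutable k ℓ + resIcc ℓ (a + (1 + k))))) ℓ,
    prod_range_add_of_periodic hperiodic, ← prod_range_add_of_periodic hperiodic 1,
    range_eq_Ico]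
  exact (prod_Ico_add' (fun i : ℕ => plucker X (initSet k ℓ (numMutable k ℓ + resIcc ℓ i)))
    0 ℓ 1).trans (prod_congr (by rw [zero_add]; rfl) fun i hi => by rw [resIcc_natCast hi])

theorem neg_one_pow_mul_neg_neg_one_pow {s : ℕ} (hs : s ≤ ℓ) :
    (-1 : ℂ) ^ (s * (ℓ - s)) * (-(-1) ^ ℓ) ^ s = 1 := by
  obtain ⟨d, rfl⟩ := Nat.exists_eq_add_of_le hs
  rw [← neg_one_mul ((-1 : ℂ) ^ (s + d)), ← pow_succ', ← pow_mul, ← pow_add,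
    Nat.add_sub_cancel_left]
  refine Even.neg_one_pow ?_
  rw [show s * d + (s + d + 1) * s = 2 * (s * d) + s * (s + 1) by ring]
  exact (even_two_mul _).add (Nat.even_mul_succ_self s)

theorem coeffString_phi' [NeZero k] {p : ℕ} (hkℓ : k < ℓ) (hp : k ≤ p) (hpn : n = p * ℓ)
    (hX : X ∈ distinguished k n ℓ) {s : ℕ} (hs : s ∈ Icc 1 (k - 1)) :
    coeffString k ℓ s (phi' X) =
      eta k p s * ∏ i ∈ Icc 1 ℓ, plucker X (initSet k ℓ (numMutable k ℓ + i)) := by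
  have hper := colMinor_image_add_of_mem_distinguished hpn hX
  have hp0 : 0 < p := Nat.pos_of_ne_zero fun h => NeZero.ne n (by simp [hpn, h])
  have hkn : k < n := hkℓ.trans_le (hpn ▸ Nat.le_mul_of_pos_left ℓ hp0)
  have hXfix := mem_fixedLocus_of_mem_distinguished hX
  obtain ⟨T, hT⟩ := exists_mul_rho_pow_eq hXfix
  set r : Fin k → ℂ := fun j => (-1) ^ ℓ * shiftEigenvalue k p j
  have hsign : ((-1 : ℂ) ^ ℓ) ≠ 0 := pow_ne_zero _ (neg_ne_zero.2 one_ne_zero)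
  have hroot : ∀ j, (r j • matB k ℓ (phi' X) + matA k ℓ (phi' X)).det = 0 := fun j => by
    refine det_smul_matB_add_matA_eq_zero hper hkℓ hkn hXfix.1 hT
      (lam := shiftEigenvalue k p j.rev) ?_ ?_
    · rw [charpoly_eq_of_mem_distinguished hpn hX hT, IsRoot, eval_prod]
      exact prod_eq_zero (mem_univ j.rev) (by simp)
    · rw [mul_assoc, shiftEigenvalue_mul_rev, mul_one]
  have hdet := det_X_smul_add_eq hkℓ.le (A := matA k ℓ (phi' X)) (B := matB k ℓ (phi' X))
    (fun a b hb => if_neg (by omega)) (r := r)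
    (fun i j hij => shiftEigenvalue_injective hp (mul_left_cancel₀ hsign hij))
    (fun j => mul_ne_zero hsign (shiftEigenvalue_ne_zero k p j)) hroot
  have hs' := mem_Icc.1 hs
  have hcoeff : charCoeff k ℓ s (phi' X) =
      (matB k ℓ (phi' X)).det * ((-(-1) ^ ℓ) ^ s * eta k p s) := by
    rw [charCoeff, hdet, coeff_C_mul, show ℓ - s = (k - s) + (ℓ - k) by omega, coeff_mul_X_pow,
      coeff_prod_X_sub_C_shiftEigenvalue hp _ hs]
  rw [coeffString, hcoeff, det_matB hper hkn, mul_left_comm, ← mul_assoc (_ ^ _),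
    neg_one_pow_mul_neg_neg_one_pow (by omega), one_mul, mul_comm]

end StringValues

/-! ### Substitution into rational functions -/

section Substitution

variable {V W : Type} {a : V → ℂ} {f g : FractionRing (MvPolynomial V ℂ)} {c d : ℂ}

theorem hasValueAt_algebraMap (a : V → ℂ) (q : MvPolynomial V ℂ) :
    HasValueAt a (algebraMap _ _ q) (MvPolynomial.eval a q) :=
  ⟨q, 1, by simp, by simp, by simp⟩

theorem HasValueAt.add (hf : HasValueAt a f c) (hg : HasValueAt a g d) :
    HasValueAt a (f + g) (c + d) := by
  obtain ⟨q, h, hh, hfh, rfl⟩ := hf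
  obtain ⟨q', h', hh', hgh, rfl⟩ := hg
  refine ⟨q * h' + h * q', h * h', by simp [hh, hh'], ?_, by simp [div_add_div _ _ hh hh']⟩
  simp only [map_add, map_mul, ← hfh, ← hgh]
  ring

theorem HasValueAt.mul (hf : HasValueAt a f c) (hg : HasValueAt a g d) :
    HasValueAt a (f * g) (c * d) := by
  obtain ⟨q, h, hh, hfh, rfl⟩ := hf
  obtain ⟨q', h', hh', hgh, rfl⟩ := hg
  refine ⟨q * q', h * h', by simp [hh, hh'], ?_, by simp [div_mul_div_comm]⟩
  simp only [map_mul, ← hfh, ← hgh]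
  ring

theorem HasValueAt.ne_zero (hf : HasValueAt a f c) (hc : c ≠ 0) : f ≠ 0 := by
  rintro rfl
  obtain ⟨q, h, -, hfh, rfl⟩ := hf
  rw [zero_mul, eq_comm, FaithfulSMul.algebraMap_eq_zero_iff] at hfh
  simp [hfh] at hc

theorem HasValueAt.inv (hf : HasValueAt a f c) (hc : c ≠ 0) : HasValueAt a f⁻¹ c⁻¹ := by
  have hf0 := hf.ne_zero hc
  obtain ⟨q, h, -, hfh, rfl⟩ := hf
  refine ⟨h, q, fun hq => hc (by rw [hq, zero_div]), ?_, inv_div _ _⟩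
  rw [← hfh, inv_mul_cancel_left₀ hf0]

/-- The rational function obtained from `f` by substituting the polynomials `w v` for the
indeterminates. It is a junk value if the denominator of `f` becomes `0`. -/
def substitute (w : V → MvPolynomial W ℂ) (f : FractionRing (MvPolynomial V ℂ)) :
    FractionRing (MvPolynomial W ℂ) :=
  algebraMap _ _ (MvPolynomial.bind₁ w (IsFractionRing.num (MvPolynomial V ℂ) f)) /
    algebraMap _ _ (MvPolynomial.bind₁ w (IsFractionRing.den (MvPolynomial V ℂ) f))

variable {w : V → MvPolynomial W ℂ} {b : W → ℂ}

theorem substitute_eq_div {q h : MvPolynomial V ℂ} (hh : MvPolynomial.bind₁ w h ≠ 0)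
    (hfh : f * algebraMap _ _ h = algebraMap _ _ q) :
    substitute w f = algebraMap _ _ (MvPolynomial.bind₁ w q) /
      algebraMap _ _ (MvPolynomial.bind₁ w h) := by
  have hinj := IsFractionRing.injective (MvPolynomial V ℂ) (FractionRing (MvPolynomial V ℂ))
  set num := IsFractionRing.num (MvPolynomial V ℂ) f
  set den := IsFractionRing.den (MvPolynomial V ℂ) f
  have hden : f * algebraMap _ _ (den : MvPolynomial V ℂ) = algebraMap _ _ num :=
    IsFractionRing.num_mul_den_eq_num_iff_eq.2 rfl
  have hcross : num * h = den * q := hinj (by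
    rw [map_mul, map_mul, ← hden, ← hfh]
    ring)
  obtain ⟨e, rfl⟩ : (den : MvPolynomial V ℂ) ∣ h :=
    (IsFractionRing.num_den_reduced (MvPolynomial V ℂ) f).symm.dvd_of_dvd_mul_left ⟨q, hcross⟩
  rw [mul_left_comm, mul_right_inj' (nonZeroDivisors.ne_zero den.2)] at hcross
  rw [map_mul] at hh
  rw [← hcross, map_mul, map_mul, map_mul, map_mul, mul_div_mul_right _ _ fun h0 =>
    right_ne_zero_of_mul hh (FaithfulSMul.algebraMap_eq_zero_iff _ _ |>.1 h0)]
  rfl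

theorem substitute_algebraMap (q : MvPolynomial V ℂ) :
    substitute w (algebraMap _ _ q) = algebraMap _ _ (MvPolynomial.bind₁ w q) := by
  rw [substitute_eq_div (q := q) (h := 1) (by simp) (by simp), map_one, map_one, div_one]

theorem eval_bind₁ (q : MvPolynomial V ℂ) :
    MvPolynomial.eval b (MvPolynomial.bind₁ w q) =
      MvPolynomial.eval (fun v => MvPolynomial.eval b (w v)) q :=
  MvPolynomial.eval₂Hom_bind₁ (RingHom.id ℂ) b w q

theorem bind₁_ne_zero_of_eval_ne_zero {h : MvPolynomial V ℂ}
    (hh : MvPolynomial.eval (fun v => MvPolynomial.eval b (w v)) h ≠ 0) :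
    MvPolynomial.bind₁ w h ≠ 0 := fun h0 => hh (by rw [← eval_bind₁, h0, map_zero])

theorem algebraMap_bind₁_ne_zero_of_eval_ne_zero {h : MvPolynomial V ℂ}
    (hh : MvPolynomial.eval (fun v => MvPolynomial.eval b (w v)) h ≠ 0) :
    algebraMap _ (FractionRing (MvPolynomial W ℂ)) (MvPolynomial.bind₁ w h) ≠ 0 := fun h0 =>
  bind₁_ne_zero_of_eval_ne_zero hh ((FaithfulSMul.algebraMap_eq_zero_iff _ _).1 h0)

theorem HasValueAt.substitute (hf : HasValueAt (fun v => MvPolynomial.eval b (w v)) f c) :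
    HasValueAt b (substitute w f) c := by
  obtain ⟨q, h, hh, hfh, rfl⟩ := hf
  refine ⟨MvPolynomial.bind₁ w q, MvPolynomial.bind₁ w h, by rwa [eval_bind₁], ?_, ?_⟩
  · rw [substitute_eq_div (bind₁_ne_zero_of_eval_ne_zero hh) hfh,
      div_mul_cancel₀ _ (algebraMap_bind₁_ne_zero_of_eval_ne_zero hh)]
  · rw [eval_bind₁, eval_bind₁]

theorem substitute_add (hf : HasValueAt (fun v => MvPolynomial.eval b (w v)) f c)
    (hg : HasValueAt (fun v => MvPolynomial.eval b (w v)) g d) :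
    substitute w (f + g) = substitute w f + substitute w g := by
  obtain ⟨q, h, hh, hfh, -⟩ := hf
  obtain ⟨q', h', hh', hgh, -⟩ := hg
  have hsum : (f + g) * algebraMap _ _ (h * h') = algebraMap _ _ (q * h' + h * q') := by
    simp only [map_add, map_mul, ← hfh, ← hgh]
    ring
  rw [substitute_eq_div (bind₁_ne_zero_of_eval_ne_zero hh) hfh,
    substitute_eq_div (bind₁_ne_zero_of_eval_ne_zero hh') hgh,
    substitute_eq_div (bind₁_ne_zero_of_eval_ne_zero (by rw [map_mul]; exact mul_ne_zero hh hh'))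
      hsum,
    div_add_div _ _ (algebraMap_bind₁_ne_zero_of_eval_ne_zero hh)
      (algebraMap_bind₁_ne_zero_of_eval_ne_zero hh')]
  simp only [map_add, map_mul]

theorem substitute_mul (hf : HasValueAt (fun v => MvPolynomial.eval b (w v)) f c)
    (hg : HasValueAt (fun v => MvPolynomial.eval b (w v)) g d) :
    substitute w (f * g) = substitute w f * substitute w g := by
  obtain ⟨q, h, hh, hfh, -⟩ := hf
  obtain ⟨q', h', hh', hgh, -⟩ := hg
  have hprod : (f * g) * algebraMap _ _ (h * h') = algebraMap _ _ (q * q') := by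
    simp only [map_mul, ← hfh, ← hgh]
    ring
  rw [substitute_eq_div (bind₁_ne_zero_of_eval_ne_zero hh) hfh,
    substitute_eq_div (bind₁_ne_zero_of_eval_ne_zero hh') hgh,
    substitute_eq_div (bind₁_ne_zero_of_eval_ne_zero (by rw [map_mul]; exact mul_ne_zero hh hh'))
      hprod, div_mul_div_comm]
  simp only [map_mul]

theorem substitute_inv (hf : HasValueAt (fun v => MvPolynomial.eval b (w v)) f c) (hc : c ≠ 0) :
    substitute w f⁻¹ = (substitute w f)⁻¹ := by
  have hf0 := hf.ne_zero hc
  obtain ⟨q, h, hh, hfh, rfl⟩ := hf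
  rw [substitute_eq_div (bind₁_ne_zero_of_eval_ne_zero hh) hfh,
    substitute_eq_div (bind₁_ne_zero_of_eval_ne_zero (div_ne_zero_iff.1 hc).1)
      (by rw [← hfh, inv_mul_cancel_left₀ hf0] : f⁻¹ * algebraMap _ _ q = algebraMap _ _ h),
    inv_div]

end Substitution

section Positivity

variable {V W : Type} {a : V → ℂ} {f g : FractionRing (MvPolynomial V ℂ)}

/-- The rational function `f` is defined at `a`, and its value there is a positive real number. -/
def IsPositiveAt (a : V → ℂ) (f : FractionRing (MvPolynomial V ℂ)) : Prop :=
  ∃ r : ℝ, 0 < r ∧ HasValueAt a f r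

theorem IsPositiveAt.add (hf : IsPositiveAt a f) (hg : IsPositiveAt a g) :
    IsPositiveAt a (f + g) := by
  obtain ⟨r, hr, hfr⟩ := hf
  obtain ⟨r', hr', hgr⟩ := hg
  exact ⟨r + r', add_pos hr hr', by simpa using hfr.add hgr⟩

theorem IsPositiveAt.mul (hf : IsPositiveAt a f) (hg : IsPositiveAt a g) :
    IsPositiveAt a (f * g) := by
  obtain ⟨r, hr, hfr⟩ := hf
  obtain ⟨r', hr', hgr⟩ := hg
  exact ⟨r * r', mul_pos hr hr', by simpa using hfr.mul hgr⟩

theorem IsPositiveAt.inv (hf : IsPositiveAt a f) : IsPositiveAt a f⁻¹ := by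
  obtain ⟨r, hr, hfr⟩ := hf
  exact ⟨r⁻¹, inv_pos.2 hr, by simpa using hfr.inv (Complex.ofReal_ne_zero.2 hr.ne')⟩

theorem isPositiveAt_one : IsPositiveAt a 1 :=
  ⟨1, one_pos, by simpa using hasValueAt_algebraMap a 1⟩

end Positivity

section LaurentMonomials

variable {K : Type} [Field K] {G : Set K} {f g : K}

theorem mem_laurentMonomials (hf : f ∈ G) (hf0 : f ≠ 0) : f ∈ laurentMonomials G :=
  ⟨Units.mk0 f hf0, Subgroup.subset_closure hf, rfl⟩

theorem one_mem_laurentMonomials : (1 : K) ∈ laurentMonomials G := ⟨1, one_mem _, rfl⟩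

theorem mul_mem_laurentMonomials (hf : f ∈ laurentMonomials G) (hg : g ∈ laurentMonomials G) :
    f * g ∈ laurentMonomials G := by
  obtain ⟨u, hu, rfl⟩ := hf
  obtain ⟨v, hv, rfl⟩ := hg
  exact ⟨u * v, mul_mem hu hv, rfl⟩

theorem inv_mem_laurentMonomials (hf : f ∈ laurentMonomials G) : f⁻¹ ∈ laurentMonomials G := by
  obtain ⟨u, hu, rfl⟩ := hf
  exact ⟨u⁻¹, inv_mem hu, (Units.val_inv_eq_inv_val u).symm⟩

theorem pow_mem_laurentMonomials (hf : f ∈ laurentMonomials G) (m : ℕ) :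
    f ^ m ∈ laurentMonomials G := by
  obtain ⟨u, hu, rfl⟩ := hf
  exact ⟨u ^ m, pow_mem hu m, (Units.val_pow_eq_pow_val u m).symm⟩

theorem prod_mem_laurentMonomials {ι : Type*} {S : Finset ι} {f : ι → K}
    (hf : ∀ i ∈ S, f i ∈ laurentMonomials G) : ∏ i ∈ S, f i ∈ laurentMonomials G :=
  prod_induction f (· ∈ laurentMonomials G) (fun _ _ => mul_mem_laurentMonomials)
    one_mem_laurentMonomials hf

end LaurentMonomials

section SubtractionFree

variable {V W : Type} {w : V → MvPolynomial W ℂ} {b : W → ℂ}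
  {G : Set (FractionRing (MvPolynomial V ℂ))} {P : Set (FractionRing (MvPolynomial W ℂ))}
  {f : FractionRing (MvPolynomial V ℂ)}

theorem substitute_mem_laurentMonomials
    (hG : ∀ f ∈ G, IsPositiveAt (fun v => MvPolynomial.eval b (w v)) f ∧
      substitute w f ∈ laurentMonomials P)
    (hf : f ∈ laurentMonomials G) :
    IsPositiveAt (fun v => MvPolynomial.eval b (w v)) f ∧ substitute w f ∈ laurentMonomials P := by
  obtain ⟨u, hu, rfl⟩ := hf
  induction hu using Subgroup.closure_induction with
  | mem u hu => exact hG _ hu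
  | one =>
    refine ⟨isPositiveAt_one, ?_⟩
    rw [Units.val_one, ← map_one (algebraMap (MvPolynomial V ℂ) _), substitute_algebraMap, map_one,
      map_one]
    exact one_mem_laurentMonomials
  | mul u v _ _ hu hv =>
    rw [Units.val_mul, substitute_mul hu.1.choose_spec.2 hv.1.choose_spec.2]
    exact ⟨hu.1.mul hv.1, mul_mem_laurentMonomials hu.2 hv.2⟩
  | inv u _ hu =>
    obtain ⟨⟨r, hr, hur⟩, hu⟩ := hu
    rw [Units.val_inv_eq_inv_val, substitute_inv hur (Complex.ofReal_ne_zero.2 hr.ne')]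
    exact ⟨IsPositiveAt.inv ⟨r, hr, hur⟩, inv_mem_laurentMonomials hu⟩

theorem SubtractionFree.substitute
    (hG : ∀ f ∈ G, IsPositiveAt (fun v => MvPolynomial.eval b (w v)) f ∧
      SubtractionFree P (substitute w f))
    (hf : SubtractionFree G f) :
    IsPositiveAt (fun v => MvPolynomial.eval b (w v)) f ∧ SubtractionFree P (substitute w f) := by
  induction hf with
  | of hf => exact hG _ hf
  | add _ _ hf hg =>
    rw [substitute_add hf.1.choose_spec.2 hg.1.choose_spec.2]
    exact ⟨hf.1.add hg.1, hf.2.add hg.2⟩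
  | mul _ _ hf hg =>
    rw [substitute_mul hf.1.choose_spec.2 hg.1.choose_spec.2]
    exact ⟨hf.1.mul hg.1, hf.2.mul hg.2⟩
  | div _ _ hf hg =>
    obtain ⟨⟨r, hr, hgr⟩, hg⟩ := hg
    have hr0 := Complex.ofReal_ne_zero.2 hr.ne'
    rw [div_eq_mul_inv, substitute_mul hf.1.choose_spec.2 (hgr.inv hr0), substitute_inv hgr hr0,
      ← div_eq_mul_inv]
    exact ⟨hf.1.mul (IsPositiveAt.inv ⟨r, hr, hgr⟩), hf.2.div hg⟩

end SubtractionFree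

/-! ### The exchange matrix -/

section ExchangeMatrix

variable {K : Type} [Field K] {k ℓ i : ℕ}

theorem sum_ite_eq_of_iff {S : Finset ℕ} {t : ℕ} {P : Prop} [Decidable P] (c : ℕ → Prop)
    [DecidablePred c] (hc : ∀ x ∈ S, c x ↔ x = t ∧ P) (ht : P → t ∈ S) :
    ∑ x ∈ S, (if c x then (1 : ℤ) else 0) = if P then 1 else 0 := by
  rw [sum_congr rfl fun x hx => if_congr (hc x hx) rfl rfl]
  by_cases hP : P
  · simp only [hP, and_true, sum_ite_eq', ht hP, if_true]
  · simp only [hP, and_false, if_false, sum_const_zero]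

theorem exchange_eq (hi : i ∈ Icc 1 (numMutable k ℓ)) (j : ℕ) :
    exchange k ℓ j i =
      (if j = i + 1 then 1 else 0) + (if ℓ < i ∧ j = i - ℓ then 1 else 0) +
        (if 2 ≤ i ∧ j = i + ℓ - 1 then 1 else 0) - (if 2 ≤ i ∧ j = i - 1 then 1 else 0) -
        (if j = i + ℓ then 1 else 0) - (if ℓ < i ∧ j = i + 1 - ℓ then 1 else 0) := by
  rw [mem_Icc] at hi
  simp only [exchange, arrows, sum_add_distrib]
  rw [sum_ite_eq_of_iff (t := i) (P := j = i + 1) (fun x => j = x + 1 ∧ i = x),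
    sum_ite_eq_of_iff (t := i - ℓ) (P := ℓ < i ∧ j = i - ℓ) (fun x => j = x ∧ i = x + ℓ),
    sum_ite_eq_of_iff (t := i - 1) (P := 2 ≤ i ∧ j = i + ℓ - 1) (fun x => j = x + ℓ ∧ i = x + 1),
    sum_ite_eq_of_iff (t := i - 1) (P := 2 ≤ i ∧ j = i - 1) (fun x => i = x + 1 ∧ j = x),
    sum_ite_eq_of_iff (t := i) (P := j = i + ℓ) (fun x => i = x ∧ j = x + ℓ),
    sum_ite_eq_of_iff (t := i - ℓ) (P := ℓ < i ∧ j = i + 1 - ℓ) (fun x => i = x + ℓ ∧ j = x + 1)]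
  · ring
  all_goals
    simp only [mem_Icc]
    omega

theorem prod_zpow_ite_eq {S : Finset ℕ} {H : ℕ → K} {t : ℕ} {P : Prop} [Decidable P]
    (ht : P → t ∈ S) :
    ∏ j ∈ S, H j ^ (if P ∧ j = t then (1 : ℤ) else 0) = if P then H t else 1 := by
  by_cases hP : P
  · simp only [hP, true_and, pow_ite, zpow_one, zpow_zero, prod_ite_eq', ht hP, if_true]
  · simp only [hP, false_and, if_false, zpow_zero, prod_const_one]

theorem prod_zpow_exchange (hi : i ∈ Icc 1 (numMutable k ℓ)) (hℓ : 1 ≤ ℓ) {H : ℕ → K}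
    (hH : ∀ j, H j ≠ 0) :
    ∏ j ∈ Icc 1 (numMutable k ℓ + ℓ), H j ^ exchange k ℓ j i =
      H (i + 1) / H (i + ℓ) * (if ℓ < i then H (i - ℓ) / H (i + 1 - ℓ) else 1) *
        (if 2 ≤ i then H (i + ℓ - 1) / H (i - 1) else 1) := by
  have hsplit : ∀ j, H j ^ exchange k ℓ j i =
      H j ^ (if True ∧ j = i + 1 then (1 : ℤ) else 0) *
        H j ^ (if ℓ < i ∧ j = i - ℓ then (1 : ℤ) else 0) *
        H j ^ (if 2 ≤ i ∧ j = i + ℓ - 1 then (1 : ℤ) else 0) /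
        H j ^ (if 2 ≤ i ∧ j = i - 1 then (1 : ℤ) else 0) /
        H j ^ (if True ∧ j = i + ℓ then (1 : ℤ) else 0) /
        H j ^ (if ℓ < i ∧ j = i + 1 - ℓ then (1 : ℤ) else 0) := fun j => by
    rw [exchange_eq hi, zpow_sub₀ (hH j), zpow_sub₀ (hH j), zpow_sub₀ (hH j), zpow_add₀ (hH j),
      zpow_add₀ (hH j)]
    simp only [true_and]
  rw [mem_Icc] at hi
  simp only [hsplit, prod_div_distrib, prod_mul_distrib]
  rw [prod_zpow_ite_eq, prod_zpow_ite_eq, prod_zpow_ite_eq, prod_zpow_ite_eq, prod_zpow_ite_eq,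
    prod_zpow_ite_eq]
  · split_ifs <;> field_simp [hH]
  all_goals
    simp only [mem_Icc]
    omega

theorem prod_pow_toNat_div_prod_pow_toNat (S : Finset ℕ) {H : ℕ → K} (hH : ∀ j ∈ S, H j ≠ 0)
    (b : ℕ → ℤ) :
    (∏ j ∈ S, H j ^ (b j).toNat) / ∏ j ∈ S, H j ^ (-b j).toNat = ∏ j ∈ S, H j ^ b j := by
  rw [← prod_div_distrib]
  refine prod_congr rfl fun j hj => ?_
  rw [← zpow_natCast, ← zpow_natCast, ← zpow_sub₀ (hH j hj), Int.toNat_sub_toNat_neg]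

theorem degree_pos (hk : 1 ≤ k) (i : ℕ) : 1 ≤ degree k i := by
  rw [degree]
  split_ifs <;> omega

theorem exchange_antisymm (a b : ℕ) : exchange k ℓ a b = -exchange k ℓ b a :=
  (neg_sub _ _).symm

end ExchangeMatrix

/-! ### The map `ψ^*` -/

section Psi

variable {k ℓ i j s : ℕ}

/-- The images of the initial variables of `𝒜_GSV(k,ℓ)` under `ψ^*`. -/
def psiVar (k ℓ : ℕ) : GSVVar k ℓ → MvPolynomial (CycVar k ℓ) ℂ
  | .x i => MvPolynomial.X (.x i) *
      ∏ b ∈ Ico (i : ℕ) (numMutable k ℓ), MvPolynomial.X (.frozen ((b : ZMod ℓ) + k))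
  | .diag j => MvPolynomial.X (.frozen (j - 1))
  | .outer j => MvPolynomial.X (.frozen (j + k))
  | .c ⟨s, hs⟩ => MvPolynomial.X (.z ⟨min s (k - s), by rw [Set.mem_Icc] at hs ⊢; omega⟩) *
      ∏ i ∈ Icc 1 ℓ, MvPolynomial.X (.frozen (i : ZMod ℓ))

/-- The map `ψ^*`, as a substitution on all rational functions: it is additive and multiplicative
only where the substituted denominators do not vanish, such as on subtraction-free expressions. -/
def psi (k ℓ : ℕ) : GSVField k ℓ → CycField k ℓ := substitute (psiVar k ℓ)

/-- The frozen variable `x̄_{N+a}` of `𝒜_cyc(k,ℓ)`, with `a` modulo `ℓ`. -/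
def cycFrozen (k ℓ : ℕ) (a : ℤ) : CycField k ℓ := cycVar (.frozen (a : ZMod ℓ))

/-- The product of all frozen variables of `𝒜_cyc(k,ℓ)`. -/
def prodFrozen (k ℓ : ℕ) : CycField k ℓ := ∏ i ∈ Icc 1 ℓ, cycFrozen k ℓ i

theorem cycVar_ne_zero (v : CycVar k ℓ) : cycVar v ≠ 0 :=
  (FaithfulSMul.algebraMap_eq_zero_iff _ _).not.2 (MvPolynomial.X_ne_zero v)

theorem gsvVar_ne_zero (v : GSVVar k ℓ) : gsvVar v ≠ 0 :=
  (FaithfulSMul.algebraMap_eq_zero_iff _ _).not.2 (MvPolynomial.X_ne_zero v)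

theorem cycFrozen_ne_zero (a : ℤ) : cycFrozen k ℓ a ≠ 0 := cycVar_ne_zero _

theorem prodFrozen_ne_zero : prodFrozen k ℓ ≠ 0 := prod_ne_zero_iff.2 fun _ _ => cycFrozen_ne_zero _

theorem cycFrozen_periodic : Function.Periodic (cycFrozen k ℓ) ℓ := fun a => by
  rw [cycFrozen, cycFrozen, Int.cast_add, Int.cast_natCast, ZMod.natCast_self, add_zero]

theorem cycX_ne_zero (i : ℕ) : cycX k ℓ i ≠ 0 := by
  rw [cycX]
  split_ifs <;> exact cycVar_ne_zero _

theorem cycX_of_numMutable_lt (hj : numMutable k ℓ < j) :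
    cycX k ℓ j = cycFrozen k ℓ (j - numMutable k ℓ) := by
  rw [cycX, dif_neg (by omega), cycFrozen, ← Nat.cast_sub hj.le, Int.cast_natCast]

theorem cycX_resIcc (hℓ : 0 < ℓ) (a : ℤ) :
    cycX k ℓ (numMutable k ℓ + resIcc ℓ a) = cycFrozen k ℓ a := by
  rw [cycX_of_numMutable_lt (by rw [resIcc]; omega), Nat.cast_add, add_sub_cancel_left,
    resIcc_eq hℓ, ← smul_eq_mul, cycFrozen_periodic.sub_zsmul_eq]

theorem cycZ_symm (hs : s ≤ k) : cycZ k ℓ (k - s) = cycZ k ℓ s := by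
  simp only [cycZ, Nat.sub_sub_self hs, min_comm (k - s)]

theorem cycZ_zero : cycZ k ℓ 0 = 1 := by
  rw [cycZ, dif_neg (by simp)]

theorem cycZ_self : cycZ k ℓ k = 1 := by
  rw [← cycZ_symm le_rfl, Nat.sub_self, cycZ_zero]

theorem psi_gsvVar (v : GSVVar k ℓ) :
    psi k ℓ (gsvVar v) = algebraMap _ (CycField k ℓ) (psiVar k ℓ v) := by
  rw [psi, gsvVar, substitute_algebraMap, MvPolynomial.bind₁_X_right]

theorem psi_gsvDiag (i : ℤ) : psi k ℓ (gsvDiag k ℓ i) = cycFrozen k ℓ (i - 1) := by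
  rw [gsvDiag, psi_gsvVar, cycFrozen, Int.cast_sub, Int.cast_one]
  rfl

theorem psi_gsvOuter (i : ℤ) : psi k ℓ (gsvOuter k ℓ i) = cycFrozen k ℓ (i + k) := by
  rw [gsvOuter, psi_gsvVar, cycFrozen, Int.cast_add, Int.cast_natCast]
  rfl

theorem psi_gsvC (hs : s ∈ Icc 1 (k - 1)) : psi k ℓ (gsvC k ℓ s) = cycZ k ℓ s * prodFrozen k ℓ := by
  rw [mem_Icc] at hs
  rw [gsvC, dif_pos hs, psi_gsvVar, psiVar.eq_def, map_mul, map_prod, cycZ, dif_pos (by omega)]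
  simp only [prodFrozen, cycFrozen, Int.cast_natCast]
  rfl

/-- The ratio of `ψ^*(x_j)` to `x̄_j`, where `x_j` stands for `1` at the frozen vertices `j > N`. -/
def frozenFactor (k ℓ j : ℕ) : CycField k ℓ :=
  if j ≤ numMutable k ℓ then ∏ b ∈ Ico j (numMutable k ℓ), cycFrozen k ℓ (b + k)
  else (cycX k ℓ j)⁻¹

theorem frozenFactor_ne_zero (j : ℕ) : frozenFactor k ℓ j ≠ 0 := by
  rw [frozenFactor]
  split_ifs
  · exact prod_ne_zero_iff.2 fun _ _ => cycFrozen_ne_zero _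
  · exact inv_ne_zero (cycX_ne_zero j)

theorem psi_gsvX (hi : i ∈ Icc 1 (numMutable k ℓ)) :
    psi k ℓ (gsvX k ℓ i) = cycX k ℓ i * frozenFactor k ℓ i := by
  rw [mem_Icc] at hi
  rw [gsvX, dif_pos hi, psi_gsvVar, psiVar, map_mul, map_prod, cycX, dif_pos hi, frozenFactor,
    if_pos hi.2]
  simp only [cycFrozen, Int.cast_add, Int.cast_natCast]
  rfl

theorem psiOnVariables (hℓ : 0 < ℓ) : PsiOnVariables k ℓ (psi k ℓ) := by
  refine ⟨fun i hi => ?_, fun i => ⟨?_, ?_⟩⟩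
  · simp only [psi_gsvX hi, frozenFactor, if_pos (mem_Icc.1 hi).2, cycX_resIcc hℓ]
  · rw [psi_gsvDiag, cycX_resIcc hℓ]
  · rw [psi_gsvOuter, cycX_resIcc hℓ]
    congr 1
    ring

theorem psiOnCoefficients : PsiOnCoefficients k ℓ (psi k ℓ) := fun s hs => by
  rw [psi_gsvC hs, prodFrozen]
  refine congrArg _ (prod_congr rfl fun i hi => ?_)
  rw [mem_Icc] at hi
  rw [cycX_of_numMutable_lt (by omega), Nat.cast_add, add_sub_cancel_left]

end Psi

section Ambient

variable {k ℓ : ℕ}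

theorem cycFrozen_mem (a : ℤ) : cycFrozen k ℓ a ∈ cycCoeff k ℓ :=
  mem_laurentMonomials (Or.inl ⟨_, rfl⟩) (cycFrozen_ne_zero a)

theorem cycZ_mem (s : ℕ) : cycZ k ℓ s ∈ cycCoeff k ℓ := by
  rw [cycZ]
  split_ifs
  · exact mem_laurentMonomials (Or.inr ⟨_, rfl⟩) (cycVar_ne_zero _)
  · exact one_mem_laurentMonomials

theorem frozenFactor_mem {j : ℕ} (hj : j ≤ numMutable k ℓ) : frozenFactor k ℓ j ∈ cycCoeff k ℓ := by
  rw [frozenFactor, if_pos hj]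
  exact prod_mem_laurentMonomials fun _ _ => cycFrozen_mem _

theorem gsvDiag_mem (i : ℤ) : gsvDiag k ℓ i ∈ gsvCoeff k ℓ :=
  mem_laurentMonomials (Or.inl (Or.inl ⟨_, rfl⟩)) (gsvVar_ne_zero _)

theorem gsvOuter_mem (i : ℤ) : gsvOuter k ℓ i ∈ gsvCoeff k ℓ :=
  mem_laurentMonomials (Or.inl (Or.inr ⟨_, rfl⟩)) (gsvVar_ne_zero _)

theorem gsvC_mem (s : ℕ) : gsvC k ℓ s ∈ gsvCoeff k ℓ := by
  rw [gsvC]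
  split_ifs
  · exact mem_laurentMonomials (Or.inr ⟨_, rfl⟩) (gsvVar_ne_zero _)
  · exact one_mem_laurentMonomials

theorem gsvP_mem (i s : ℕ) : gsvP k ℓ i s ∈ gsvCoeff k ℓ := by
  have hmul : ∀ {f g : GSVField k ℓ}, f ∈ gsvCoeff k ℓ → g ∈ gsvCoeff k ℓ → f * g ∈ gsvCoeff k ℓ :=
    mul_mem_laurentMonomials
  have hdiag : ∀ S : Finset ℕ, ∏ a ∈ S, gsvDiag k ℓ a ∈ gsvCoeff k ℓ := fun S =>
    prod_mem_laurentMonomials fun a _ => gsvDiag_mem a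
  have houter : ∀ m : ℕ, ∏ a ∈ Icc 2 ℓ, gsvOuter k ℓ a ^ m ∈ gsvCoeff k ℓ := fun m =>
    prod_mem_laurentMonomials fun a _ => pow_mem_laurentMonomials (gsvOuter_mem a) m
  have hone : (1 : GSVField k ℓ) ∈ gsvCoeff k ℓ := one_mem_laurentMonomials
  unfold gsvP
  split_ifs
  · exact hmul (hdiag _) (by simpa only [pow_one] using houter 1)
  · exact gsvC_mem _
  · exact hmul (gsvOuter_mem _) (gsvDiag_mem _)
  · exact hmul (hdiag _) (houter _)
  · exact hmul (gsvC_mem _) (houter _)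
  · exact gsvOuter_mem _
  · exact hone
  · exact hmul (gsvOuter_mem _) (gsvDiag_mem _)
  · exact hmul (gsvOuter_mem _) hone
  · exact hmul hone (gsvDiag_mem _)
  · exact hmul hone hone

theorem isSeedOver_gsvSeed (hk : 1 ≤ k) :
    (gsvSeed k ℓ).IsSeedOver (numMutable k ℓ) (gsvCoeff k ℓ) :=
  ⟨fun i _ => ⟨degree_pos hk i, fun s _ => gsvP_mem i s⟩, fun _ => 1, fun _ => one_pos,
    fun i _ j _ => by rw [one_mul, one_mul]; exact exchange_antisymm i j⟩

theorem isSeedOver_cycSeed (hk : 1 ≤ k) :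
    (cycSeed k ℓ).IsSeedOver (numMutable k ℓ) (cycCoeff k ℓ) := by
  refine ⟨fun i _ => ⟨degree_pos hk i, fun s _ => mul_mem_laurentMonomials ?_ ?_⟩, fun _ => 1,
    fun _ => one_pos, fun i _ j _ => by rw [one_mul, one_mul]; exact exchange_antisymm i j⟩
  · split_ifs
    · exact cycZ_mem s
    · exact one_mem_laurentMonomials
  · refine prod_mem_laurentMonomials fun j hj => pow_mem_laurentMonomials ?_ _
    rw [cycX_of_numMutable_lt (mem_Icc.1 hj).1]
    exact cycFrozen_mem _

-- Subtraction-free expressions are positive at the point `1`, so `ψ^*` kills no denominator.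
theorem isPositiveAt_gsvVar (v : GSVVar k ℓ) :
    IsPositiveAt (fun v => MvPolynomial.eval 1 (psiVar k ℓ v)) (gsvVar v) := by
  have hone : MvPolynomial.eval 1 (psiVar k ℓ v) = 1 := by
    cases v <;> simp [psiVar]
  refine ⟨1, one_pos, ?_⟩
  rw [Complex.ofReal_one, ← hone, gsvVar]
  simpa only [MvPolynomial.eval_X] using
    hasValueAt_algebraMap (fun v => MvPolynomial.eval 1 (psiVar k ℓ v)) (MvPolynomial.X v)

theorem psi_mem_cycCoeff {f : GSVField k ℓ} (hf : f ∈ gsvCoeff k ℓ) :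
    IsPositiveAt (fun v => MvPolynomial.eval 1 (psiVar k ℓ v)) f ∧ psi k ℓ f ∈ cycCoeff k ℓ := by
  refine substitute_mem_laurentMonomials ?_ hf
  rintro f ((⟨j, rfl⟩ | ⟨j, rfl⟩) | ⟨⟨s, hs⟩, rfl⟩) <;> refine ⟨isPositiveAt_gsvVar _, ?_⟩ <;>
    change psi k ℓ _ ∈ cycCoeff k ℓ <;> rw [psi_gsvVar]
  · exact mem_laurentMonomials (Or.inl ⟨_, rfl⟩) (cycVar_ne_zero _)
  · exact mem_laurentMonomials (Or.inl ⟨_, rfl⟩) (cycVar_ne_zero _)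
  · rw [psiVar, map_mul, map_prod]
    exact mul_mem_laurentMonomials (mem_laurentMonomials (Or.inr ⟨_, rfl⟩) (cycVar_ne_zero _))
      (prod_mem_laurentMonomials fun _ _ =>
        mem_laurentMonomials (Or.inl ⟨_, rfl⟩) (cycVar_ne_zero _))

theorem psi_mem_ambient {f : GSVField k ℓ}
    (hf : f ∈ ambient (numMutable k ℓ) (gsvCoeff k ℓ) (gsvSeed k ℓ)) :
    IsPositiveAt (fun v => MvPolynomial.eval 1 (psiVar k ℓ v)) f ∧
      psi k ℓ f ∈ ambient (numMutable k ℓ) (cycCoeff k ℓ) (cycSeed k ℓ) := by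
  refine SubtractionFree.substitute ?_ hf
  rintro f (⟨i, hi, rfl⟩ | hf)
  · constructor
    · change IsPositiveAt _ (gsvX k ℓ i)
      rw [gsvX, dif_pos (mem_Icc.1 hi)]
      exact isPositiveAt_gsvVar _
    · change SubtractionFree _ (psi k ℓ (gsvX k ℓ i))
      rw [psi_gsvX hi]
      exact .mul (.of (Or.inl ⟨i, hi, rfl⟩)) (.of (Or.inr (frozenFactor_mem (mem_Icc.1 hi).2)))
  · exact ⟨(psi_mem_cycCoeff hf).1, .of (Or.inr (psi_mem_cycCoeff hf).2)⟩

end Ambient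

section HatVariables

variable {K : Type} [Field K] {k ℓ i s : ℕ}

theorem yhat_eq_prod_zpow (N : ℕ) (S : CSSeed K) (i s : ℕ) (hx : ∀ j ∈ Icc 1 N, S.x j ≠ 0) :
    S.yhat N i s = S.p i s / S.p i 0 * (∏ j ∈ Icc 1 N, S.x j ^ S.B j i) ^ s := by
  rw [CSSeed.yhat, CSSeed.monPos, CSSeed.monNeg, prod_pow_toNat_div_prod_pow_toNat _ hx]

theorem prod_Icc_one_add (N m : ℕ) (f : ℕ → K) :
    ∏ j ∈ Icc 1 (N + m), f j = (∏ j ∈ Icc 1 N, f j) * ∏ j ∈ Icc (N + 1) (N + m), f j := by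
  simpa only [Ico_add_one_right_eq_Icc] using
    (prod_Ico_consecutive f (Nat.le_add_left 1 N) (by omega : N + 1 ≤ N + m + 1)).symm

theorem yhat_cycSeed (hs : s ≤ degree k i) :
    (cycSeed k ℓ).yhat (numMutable k ℓ) i s = (if i = 1 then cycZ k ℓ s else 1) *
      (∏ j ∈ Icc 1 (numMutable k ℓ + ℓ), cycX k ℓ j ^ exchange k ℓ j i) ^ s := by
  have hcoeff : (cycSeed k ℓ).p i s / (cycSeed k ℓ).p i 0 = (if i = 1 then cycZ k ℓ s else 1) *
      (∏ j ∈ Icc (numMutable k ℓ + 1) (numMutable k ℓ + ℓ),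
        cycX k ℓ j ^ exchange k ℓ j i) ^ s := by
    simp only [cycSeed, cycZ_zero, ite_self, one_mul, mul_div_assoc]
    rw [← prod_div_distrib, ← prod_pow]
    refine congrArg _ (prod_congr rfl fun j _ => ?_)
    rw [← zpow_natCast, ← zpow_natCast, ← zpow_natCast, ← zpow_sub₀ (cycX_ne_zero j), ← zpow_mul]
    conv_rhs => rw [← Int.toNat_sub_toNat_neg (exchange k ℓ j i)]
    rw [Nat.sub_zero]
    push_cast [Nat.cast_sub hs]
    congr 1
    ring
  rw [yhat_eq_prod_zpow _ _ _ _ fun j _ => cycX_ne_zero j, hcoeff, prod_Icc_one_add, mul_assoc,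
    ← mul_pow, mul_comm (∏ j ∈ Icc 1 _, _)]
  rfl

theorem yhat_map_gsvSeed (i s : ℕ) :
    ((gsvSeed k ℓ).map (psi k ℓ)).yhat (numMutable k ℓ) i s =
      psi k ℓ (gsvP k ℓ i s) / psi k ℓ (gsvP k ℓ i 0) *
        (∏ j ∈ Icc 1 (numMutable k ℓ + ℓ),
          (cycX k ℓ j * frozenFactor k ℓ j) ^ exchange k ℓ j i) ^ s := by
  have hx : ∀ j ∈ Icc 1 (numMutable k ℓ), ((gsvSeed k ℓ).map (psi k ℓ)).x j =
      cycX k ℓ j * frozenFactor k ℓ j := fun j hj => psi_gsvX hj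
  have hfrozen : ∀ j ∈ Icc (numMutable k ℓ + 1) (numMutable k ℓ + ℓ),
      (cycX k ℓ j * frozenFactor k ℓ j) ^ exchange k ℓ j i = 1 := fun j hj => by
    rw [frozenFactor, if_neg (Nat.not_le.2 (mem_Icc.1 hj).1), mul_inv_cancel₀ (cycX_ne_zero j),
      one_zpow]
  rw [yhat_eq_prod_zpow _ _ _ _ fun j hj => by
      rw [hx j hj]; exact mul_ne_zero (cycX_ne_zero j) (frozenFactor_ne_zero j),
    prod_Icc_one_add, prod_eq_one hfrozen, mul_one,
    prod_congr rfl fun j hj => by rw [hx j hj]]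
  rfl

theorem yhat_map_gsvSeed_eq (hs : s ≤ degree k i)
    (h : psi k ℓ (gsvP k ℓ i s) / psi k ℓ (gsvP k ℓ i 0) *
        (∏ j ∈ Icc 1 (numMutable k ℓ + ℓ), frozenFactor k ℓ j ^ exchange k ℓ j i) ^ s =
      if i = 1 then cycZ k ℓ s else 1) :
    ((gsvSeed k ℓ).map (psi k ℓ)).yhat (numMutable k ℓ) i s =
      (cycSeed k ℓ).yhat (numMutable k ℓ) i s := by
  rw [yhat_map_gsvSeed, yhat_cycSeed hs, ← h]
  simp only [mul_zpow, prod_mul_distrib, mul_pow]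
  ring

end HatVariables

section FrozenFactors

variable {k ℓ i s j : ℕ}

theorem cycX_numMutable_lt (hk : 1 ≤ k) (hℓ : 1 ≤ ℓ) (hj : numMutable k ℓ < j) :
    cycX k ℓ j = cycFrozen k ℓ (j - 1 + k) := by
  have h : (numMutable k ℓ : ℤ) + k = (k - 1 : ℕ) * ℓ + 1 := mod_cast numMutable_add hk hℓ
  rw [cycX_of_numMutable_lt hj,
    ← cycFrozen_periodic.sub_zsmul_eq (x := (j : ℤ) - 1 + k) (k - 1 : ℕ), smul_eq_mul]
  congr 1
  linear_combination -h

theorem frozenFactor_div_succ (hk : 1 ≤ k) (hℓ : 1 ≤ ℓ) (j : ℕ) :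
    frozenFactor k ℓ j / frozenFactor k ℓ (j + 1) = cycFrozen k ℓ (j + k) *
      if numMutable k ℓ < j then (cycFrozen k ℓ (j - 1 + k))⁻¹ else 1 := by
  have hne : ∏ b ∈ Ico (j + 1) (numMutable k ℓ), cycFrozen k ℓ (b + k) ≠ 0 :=
    prod_ne_zero_iff.2 fun _ _ => cycFrozen_ne_zero _
  have hsucc : numMutable k ℓ < j + 1 → cycX k ℓ (j + 1) = cycFrozen k ℓ (j + k) := fun hj => by
    rw [cycX_numMutable_lt hk hℓ hj, Nat.cast_succ, add_sub_cancel_right]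
  rw [frozenFactor, frozenFactor]
  rcases lt_trichotomy j (numMutable k ℓ) with hj | rfl | hj
  · rw [if_pos hj.le, if_pos (Nat.succ_le_of_lt hj), if_neg hj.not_gt, prod_eq_prod_Ico_succ_bot hj,
      mul_div_cancel_right₀ _ hne, mul_one]
  · rw [if_pos le_rfl, if_neg (by omega), if_neg (lt_irrefl _), Ico_self, prod_empty,
      hsucc (Nat.lt_succ_self _), one_div, inv_inv, mul_one]
  · rw [if_neg (by omega), if_neg (by omega), if_pos hj, hsucc (by omega),
      cycX_numMutable_lt hk hℓ hj, div_inv_eq_mul, mul_comm]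

theorem frozenFactor_pred_div_succ (hk : 1 ≤ k) (hℓ : 1 ≤ ℓ) (hi : i ∈ Icc 1 (numMutable k ℓ)) :
    frozenFactor k ℓ (i - 1) / frozenFactor k ℓ (i + 1) =
      cycFrozen k ℓ (i - 1 + k) * cycFrozen k ℓ (i + k) := by
  rw [mem_Icc] at hi
  have hpred := frozenFactor_div_succ (k := k) hk hℓ (i - 1)
  rw [Nat.sub_add_cancel hi.1, if_neg (by omega), mul_one, Nat.cast_pred hi.1] at hpred
  rw [← div_mul_div_cancel₀ (frozenFactor_ne_zero i), frozenFactor_div_succ hk hℓ i,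
    if_neg (by omega), mul_one, hpred]

theorem frozenFactor_add_pred_div (hk : 1 ≤ k) (hℓ : 1 ≤ ℓ) :
    frozenFactor k ℓ (i + ℓ - 1) / frozenFactor k ℓ (i + ℓ) =
      cycFrozen k ℓ (i - 1 + k) *
        if numMutable k ℓ + 2 ≤ i + ℓ then (cycFrozen k ℓ (i + k - 2))⁻¹ else 1 := by
  have hpred := frozenFactor_div_succ (k := k) hk hℓ (i + ℓ - 1)
  rw [Nat.sub_add_cancel (by omega), Nat.cast_pred (by omega)] at hpred
  rw [hpred, ← cycFrozen_periodic (i - 1 + k), ← cycFrozen_periodic (i + k - 2)]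
  push_cast
  split_ifs <;> first | omega | ring_nf

theorem prod_frozenFactor_of_two_le (hk : 1 ≤ k) (hℓ : 1 ≤ ℓ)
    (hi : i ∈ Icc 2 (numMutable k ℓ)) :
    ∏ j ∈ Icc 1 (numMutable k ℓ + ℓ), frozenFactor k ℓ j ^ exchange k ℓ j i =
      ((if i ≤ ℓ then cycFrozen k ℓ (i + k) else 1) *
        if numMutable k ℓ + 2 ≤ i + ℓ then cycFrozen k ℓ (i + k - 2) else 1)⁻¹ := by
  rw [mem_Icc] at hi
  have hfar : ℓ < i → frozenFactor k ℓ (i - ℓ) / frozenFactor k ℓ (i + 1 - ℓ) =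
      cycFrozen k ℓ (i + k) := fun hℓi => by
    have h := frozenFactor_div_succ (k := k) hk hℓ (i - ℓ)
    rw [if_neg (by omega), mul_one, ← Nat.sub_add_comm hℓi.le] at h
    rw [h, ← cycFrozen_periodic]
    congr 1
    push_cast [Nat.cast_sub hℓi.le]
    ring
  rw [prod_zpow_exchange (mem_Icc.2 ⟨by omega, hi.2⟩) hℓ frozenFactor_ne_zero, if_pos hi.1]
  calc _ = frozenFactor k ℓ (i + ℓ - 1) / frozenFactor k ℓ (i + ℓ) /
        (frozenFactor k ℓ (i - 1) / frozenFactor k ℓ (i + 1)) *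
        (if ℓ < i then frozenFactor k ℓ (i - ℓ) / frozenFactor k ℓ (i + 1 - ℓ) else 1) := by
        field_simp [frozenFactor_ne_zero]
    _ = _ := by
        have hne := cycFrozen_ne_zero (k := k) (ℓ := ℓ)
        rw [frozenFactor_add_pred_div hk hℓ,
          frozenFactor_pred_div_succ hk hℓ (mem_Icc.2 ⟨by omega, hi.2⟩)]
        rcases lt_or_ge ℓ i with h | h
        · rw [if_pos h, if_neg h.not_ge, hfar h]
          split_ifs <;> field_simp [hne]
        · rw [if_neg h.not_gt, if_pos h]
          split_ifs <;> field_simp [hne]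

theorem prod_frozenFactor_one (hk : 2 ≤ k) (hkℓ : k < ℓ) :
    ∏ j ∈ Icc 1 (numMutable k ℓ + ℓ), frozenFactor k ℓ j ^ exchange k ℓ j 1 =
      (∏ a ∈ Icc 2 ℓ, cycFrozen k ℓ (a + k)) * if k = 2 then (cycFrozen k ℓ 1)⁻¹ else 1 := by
  have hpos : 1 ≤ numMutable k ℓ := Nat.mul_pos (by omega) (by omega)
  rw [prod_zpow_exchange (mem_Icc.2 ⟨le_rfl, hpos⟩) (by omega) frozenFactor_ne_zero,
    if_neg (by omega), if_neg (by omega), mul_one, mul_one, ← Ico_add_one_right_eq_Icc]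
  rcases hk.eq_or_lt with rfl | hk
  · obtain ⟨m, rfl⟩ : ∃ m, ℓ = m + 1 := ⟨ℓ - 1, by omega⟩
    have hfirst : cycFrozen 2 (m + 1) (m + 2) = cycFrozen 2 (m + 1) 1 := by
      rw [← cycFrozen_periodic 1]
      push_cast
      ring_nf
    have hNm : numMutable 2 (m + 1) = m := one_mul m
    rw [frozenFactor, frozenFactor, hNm, if_pos (by omega), if_neg (by omega),
      cycX_numMutable_lt one_le_two (by omega) (by omega), if_pos rfl, prod_Ico_succ_top (by omega),
      prod_Ico_succ_top (by omega)]
    push_cast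
    rw [hfirst, div_inv_eq_mul, mul_right_comm _ (cycFrozen _ _ _) (cycFrozen _ _ _),
      mul_inv_cancel_right₀ (cycFrozen_ne_zero 1)]
    ring_nf
  · have hN : 2 * (ℓ - 1) ≤ numMutable k ℓ := Nat.mul_le_mul_right (ℓ - 1) (by omega)
    have hℓN : ℓ + 1 ≤ numMutable k ℓ := by omega
    rw [frozenFactor, frozenFactor, if_pos (by omega), if_pos (by omega), if_neg (by omega),
      mul_one, add_comm 1 ℓ, ← prod_Ico_consecutive _ (by omega : 1 + 1 ≤ ℓ + 1) hℓN,
      mul_div_cancel_right₀ _ (prod_ne_zero_iff.2 fun _ _ => cycFrozen_ne_zero _)]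

end FrozenFactors

section Coefficients

variable {k ℓ i s : ℕ} {f g : GSVField k ℓ}

theorem psi_mul (hf : f ∈ gsvCoeff k ℓ) (hg : g ∈ gsvCoeff k ℓ) :
    psi k ℓ (f * g) = psi k ℓ f * psi k ℓ g :=
  substitute_mul (psi_mem_cycCoeff hf).1.choose_spec.2 (psi_mem_cycCoeff hg).1.choose_spec.2

theorem psi_one : psi k ℓ 1 = 1 := by
  rw [psi, ← map_one (algebraMap (MvPolynomial (GSVVar k ℓ) ℂ) _), substitute_algebraMap, map_one,
    map_one]

theorem psi_prod {ι : Type*} {S : Finset ι} {f : ι → GSVField k ℓ}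
    (hf : ∀ a ∈ S, f a ∈ gsvCoeff k ℓ) : psi k ℓ (∏ a ∈ S, f a) = ∏ a ∈ S, psi k ℓ (f a) := by
  classical
  induction S using Finset.induction_on with
  | empty => simpa only [prod_empty] using psi_one
  | insert a S ha ih =>
    have hS : ∀ b ∈ S, f b ∈ gsvCoeff k ℓ := fun b hb => hf b (mem_insert_of_mem hb)
    rw [prod_insert ha, prod_insert ha, psi_mul (hf a (mem_insert_self a S))
      (prod_mem_laurentMonomials hS), ih hS]

theorem psi_prod_gsvDiag (S : Finset ℕ) :
    psi k ℓ (∏ a ∈ S, gsvDiag k ℓ a) = ∏ a ∈ S, cycFrozen k ℓ (a - 1) := by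
  rw [psi_prod fun (a : ℕ) _ => gsvDiag_mem (a : ℤ)]
  exact prod_congr rfl fun a _ => psi_gsvDiag a

theorem psi_prod_gsvOuter_pow (S : Finset ℕ) (m : ℕ) :
    psi k ℓ (∏ a ∈ S, gsvOuter k ℓ a ^ m) = (∏ a ∈ S, cycFrozen k ℓ (a + k)) ^ m := by
  have hpow : ∀ a : ℕ, psi k ℓ (gsvOuter k ℓ a ^ m) = cycFrozen k ℓ (a + k) ^ m := fun a => by
    rw [← card_range m, ← prod_const, psi_prod fun _ _ => gsvOuter_mem _, prod_const, psi_gsvOuter]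
  rw [psi_prod fun (a : ℕ) _ => pow_mem_laurentMonomials (gsvOuter_mem (a : ℤ)) m,
    ← prod_pow]
  exact prod_congr rfl fun a _ => hpow a

theorem prod_Icc_cycFrozen_add (c : ℤ) : ∏ a ∈ Icc 1 ℓ, cycFrozen k ℓ (a + c) = prodFrozen k ℓ := by
  have hrange : ∀ c : ℤ, ∏ a ∈ Icc 1 ℓ, cycFrozen k ℓ (a + c) = ∏ a ∈ range ℓ, cycFrozen k ℓ a := by
    intro c
    rw [← prod_range_add_of_periodic cycFrozen_periodic (c + 1), ← Ico_add_one_right_eq_Icc,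
      range_eq_Ico, ← zero_add 1, ← prod_Ico_add' _ 0 ℓ 1]
    exact prod_congr rfl fun a _ => congrArg _ (by push_cast; ring)
  simpa only [prodFrozen, add_zero] using (hrange c).trans (hrange 0).symm

theorem mul_prod_cycFrozen_add (hℓ : 1 ≤ ℓ) :
    cycFrozen k ℓ (1 + k) * ∏ a ∈ Icc 2 ℓ, cycFrozen k ℓ (a + k) = prodFrozen k ℓ := by
  rw [← prod_Icc_cycFrozen_add k, ← mul_prod_Ioc_eq_prod_Icc hℓ]
  push_cast
  rfl

theorem mul_prod_cycFrozen_erase_two (hℓ : 2 ≤ ℓ) :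
    cycFrozen k ℓ 1 * ∏ a ∈ (Icc 1 ℓ).erase 2, cycFrozen k ℓ (a - 1) = prodFrozen k ℓ := by
  rw [← prod_Icc_cycFrozen_add (-1),
    ← mul_prod_erase _ _ (mem_Icc.2 ⟨one_le_two, hℓ⟩ : 2 ∈ Icc 1 ℓ)]
  rfl

theorem psi_gsvP_two_one_zero :
    psi 2 ℓ (gsvP 2 ℓ 1 0) = (∏ a ∈ (Icc 1 ℓ).erase 2, cycFrozen 2 ℓ (a - 1)) *
      ∏ a ∈ Icc 2 ℓ, cycFrozen 2 ℓ (a + 2) := by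
  have houter := psi_prod_gsvOuter_pow (k := 2) (ℓ := ℓ) (Icc 2 ℓ) 1
  simp only [pow_one] at houter
  rw [gsvP, if_pos rfl, if_pos rfl, if_pos rfl, psi_mul, psi_prod_gsvDiag, houter]
  · rfl
  · exact prod_mem_laurentMonomials fun a _ => gsvDiag_mem a
  · exact prod_mem_laurentMonomials fun a _ => gsvOuter_mem a

theorem psi_gsvP_one_zero (hk : 3 ≤ k) :
    psi k ℓ (gsvP k ℓ 1 0) =
      prodFrozen k ℓ * (∏ a ∈ Icc 2 ℓ, cycFrozen k ℓ (a + k)) ^ (k - 1) := by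
  rw [gsvP, if_pos rfl, if_neg (by omega), if_pos rfl, psi_mul, psi_prod_gsvDiag,
    psi_prod_gsvOuter_pow, ← prod_Icc_cycFrozen_add (-1)]
  · rfl
  · exact prod_mem_laurentMonomials fun a _ => gsvDiag_mem a
  · exact prod_mem_laurentMonomials fun a _ => pow_mem_laurentMonomials (gsvOuter_mem a) _

theorem psi_gsvP_one_of_lt (hk : 3 ≤ k) (hs : s ∈ Icc 1 (k - 1)) :
    psi k ℓ (gsvP k ℓ 1 s) = cycZ k ℓ s * prodFrozen k ℓ *
      (∏ a ∈ Icc 2 ℓ, cycFrozen k ℓ (a + k)) ^ (k - 1 - s) := by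
  rw [mem_Icc] at hs
  rw [gsvP, if_pos rfl, if_neg (by omega), if_neg (by omega), if_pos (by omega),
    psi_mul (gsvC_mem _), psi_gsvC (mem_Icc.2 (by omega)), cycZ_symm (by omega),
    psi_prod_gsvOuter_pow]
  exact prod_mem_laurentMonomials fun a _ => pow_mem_laurentMonomials (gsvOuter_mem a) _

theorem psi_gsvP_one_self (hk : 3 ≤ k) :
    psi k ℓ (gsvP k ℓ 1 k) = cycFrozen k ℓ (1 + k) := by
  rw [gsvP, if_pos rfl, if_neg (by omega), if_neg (by omega), if_neg (lt_irrefl _), psi_gsvOuter]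

theorem psi_gsvP_one_div_mul_pow (hk : 3 ≤ k) (hℓ : 1 ≤ ℓ) (hs : s ∈ Icc 1 k) :
    psi k ℓ (gsvP k ℓ 1 s) / psi k ℓ (gsvP k ℓ 1 0) *
      (∏ a ∈ Icc 2 ℓ, cycFrozen k ℓ (a + k)) ^ s = cycZ k ℓ s := by
  have hQ : ∏ a ∈ Icc 2 ℓ, cycFrozen k ℓ (a + k) ≠ 0 :=
    prod_ne_zero_iff.2 fun _ _ => cycFrozen_ne_zero _
  have hP : prodFrozen k ℓ ≠ 0 := prodFrozen_ne_zero
  have hk1 : cycFrozen k ℓ (1 + k) * _ = prodFrozen k ℓ := mul_prod_cycFrozen_add hℓ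
  rw [psi_gsvP_one_zero hk, div_mul_eq_mul_div, div_eq_iff (mul_ne_zero hP (pow_ne_zero _ hQ))]
  obtain ⟨hs1, hs2⟩ := mem_Icc.1 hs
  rcases hs2.eq_or_lt with rfl | hs2
  · rw [psi_gsvP_one_self hk, cycZ_self, ← hk1, ← mul_pow_sub_one (by omega : s ≠ 0)]
    ring
  · rw [psi_gsvP_one_of_lt hk (mem_Icc.2 ⟨hs1, by omega⟩), mul_assoc, ← pow_add, mul_assoc,
      Nat.sub_add_cancel (by omega)]

theorem psi_gsvP_two_one_div_mul_pow (hℓ : 2 ≤ ℓ) (hs : s ∈ Icc 1 2) :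
    psi 2 ℓ (gsvP 2 ℓ 1 s) / psi 2 ℓ (gsvP 2 ℓ 1 0) *
      ((∏ a ∈ Icc 2 ℓ, cycFrozen 2 ℓ (a + 2)) * (cycFrozen 2 ℓ 1)⁻¹) ^ s = cycZ 2 ℓ s := by
  have hQ : ∏ a ∈ Icc 2 ℓ, cycFrozen 2 ℓ (a + 2) ≠ 0 :=
    prod_ne_zero_iff.2 fun _ _ => cycFrozen_ne_zero _
  have hR : ∏ a ∈ (Icc 1 ℓ).erase 2, cycFrozen 2 ℓ (a - 1) ≠ 0 :=
    prod_ne_zero_iff.2 fun _ _ => cycFrozen_ne_zero _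
  have h1 : cycFrozen 2 ℓ 1 ≠ 0 := cycFrozen_ne_zero 1
  have hPR : _ = prodFrozen 2 ℓ := mul_prod_cycFrozen_erase_two hℓ
  have hPQ : _ = prodFrozen 2 ℓ := mul_prod_cycFrozen_add (k := 2) (one_le_two.trans hℓ)
  obtain ⟨hs1, hs2⟩ := mem_Icc.1 hs
  rw [psi_gsvP_two_one_zero]
  rcases hs1.eq_or_lt with rfl | hs1
  · rw [gsvP, if_pos rfl, if_pos rfl, if_neg one_ne_zero, if_pos rfl,
      psi_gsvC (mem_Icc.2 ⟨le_rfl, le_rfl⟩), ← hPR, pow_one]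
    field_simp
  · obtain rfl : s = 2 := by omega
    have hp : psi 2 ℓ (gsvP 2 ℓ 1 2) = cycFrozen 2 ℓ (1 + 2) * cycFrozen 2 ℓ 1 := by
      rw [gsvP, if_pos rfl, if_pos rfl, if_neg two_ne_zero, if_neg (by norm_num),
        psi_mul (gsvOuter_mem _) (gsvDiag_mem _), psi_gsvOuter, psi_gsvDiag]
      rfl
    rw [hp, cycZ_self]
    field_simp
    exact hPQ.trans hPR.symm

theorem psi_gsvP_of_two_le (hi : 2 ≤ i) :
    psi k ℓ (gsvP k ℓ i 1) / psi k ℓ (gsvP k ℓ i 0) =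
      (if i ≤ ℓ then cycFrozen k ℓ (i + k) else 1) *
        if numMutable k ℓ + 2 ≤ i + ℓ then cycFrozen k ℓ (i + k - 2) else 1 := by
  have hone : (1 : GSVField k ℓ) ∈ gsvCoeff k ℓ := one_mem_laurentMonomials
  have hi1 : i ≠ 1 := by omega
  rw [gsvP, gsvP, if_neg hi1, if_neg one_ne_zero, if_neg hi1, if_pos rfl, psi_one, div_one,
    psi_mul (by split_ifs; exacts [gsvOuter_mem _, hone])
      (by split_ifs; exacts [gsvDiag_mem _, hone]), apply_ite (psi k ℓ), apply_ite (psi k ℓ),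
    psi_one, psi_gsvOuter, psi_gsvDiag]
  ring_nf

theorem psi_gsvP_mul_prod_frozenFactor (hk : 2 ≤ k) (hkℓ : k < ℓ) (hi : i ∈ Icc 1 (numMutable k ℓ))
    (hs : s ∈ Icc 1 (degree k i)) :
    psi k ℓ (gsvP k ℓ i s) / psi k ℓ (gsvP k ℓ i 0) *
        (∏ j ∈ Icc 1 (numMutable k ℓ + ℓ), frozenFactor k ℓ j ^ exchange k ℓ j i) ^ s =
      if i = 1 then cycZ k ℓ s else 1 := by
  obtain ⟨hi1, hiN⟩ := mem_Icc.1 hi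
  rcases hi1.eq_or_lt with rfl | hi1
  · rw [if_pos rfl, prod_frozenFactor_one hk hkℓ]
    rw [degree, if_pos rfl] at hs
    rcases hk.eq_or_lt with rfl | hk
    · rw [if_pos rfl]
      exact psi_gsvP_two_one_div_mul_pow hkℓ.le hs
    · rw [if_neg (by omega), mul_one]
      exact psi_gsvP_one_div_mul_pow hk (by omega) hs
  · rw [degree, if_neg (by omega), Icc_self, mem_singleton] at hs
    have hne := cycFrozen_ne_zero (k := k) (ℓ := ℓ)
    rw [if_neg (by omega), hs, pow_one, psi_gsvP_of_two_le hi1,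
      prod_frozenFactor_of_two_le (by omega) (by omega) (mem_Icc.2 ⟨hi1, hiN⟩),
      mul_inv_cancel₀ (mul_ne_zero (by split_ifs <;> simp [hne]) (by split_ifs <;> simp [hne]))]

theorem isQuasiHom_psi (hk : 2 ≤ k) (hkℓ : k < ℓ) :
    IsQuasiHom (numMutable k ℓ) (gsvCoeff k ℓ) (gsvSeed k ℓ) (cycCoeff k ℓ) (cycSeed k ℓ)
      (psi k ℓ) where
  source := isSeedOver_gsvSeed (by omega)
  target := isSeedOver_cycSeed (by omega)
  mapsTo _ hf := (psi_mem_ambient hf).2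
  map_add _ hf _ hg := substitute_add (psi_mem_ambient hf).1.choose_spec.2
    (psi_mem_ambient hg).1.choose_spec.2
  map_mul _ hf _ hg := substitute_mul (psi_mem_ambient hf).1.choose_spec.2
    (psi_mem_ambient hg).1.choose_spec.2
  map_coeff _ hf := (psi_mem_cycCoeff hf).2
  equivalent i hi := by
    refine ⟨rfl, ?_, fun s hs => yhat_map_gsvSeed_eq (mem_Icc.1 hs).2
      (psi_gsvP_mul_prod_frozenFactor hk hkℓ hi hs)⟩
    change psi k ℓ (gsvX k ℓ i) / cycX k ℓ i ∈ cycCoeff k ℓ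
    rw [psi_gsvX hi, mul_div_cancel_left₀ _ (cycX_ne_zero i)]
    exact frozenFactor_mem (mem_Icc.1 hi).2

end Coefficients

/-! ### Specialization on the distinguished component -/

section Specialization

variable {k ℓ n p s : ℕ} {X : Matrix (Fin k) (Fin n) ℂ}

theorem phi'_diag_eq_plucker [NeZero n]
    (hper : ∀ I : Finset ℤ, colMinor (col X) (I.image (· + (ℓ : ℤ))) = colMinor (col X) I)
    (hℓ : 0 < ℓ) (hkn : k < n) (i : ℤ) :
    phi' X i i = plucker X (initSet k ℓ (numMutable k ℓ + resIcc ℓ (i - 1))) := by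
  rw [phi'_diag hkn, plucker_frozen hper hℓ hkn, sub_add_cancel]

theorem phi'_outer_eq_plucker [NeZero n]
    (hper : ∀ I : Finset ℤ, colMinor (col X) (I.image (· + (ℓ : ℤ))) = colMinor (col X) I)
    (hℓ : 0 < ℓ) (hkn : k < n) (i : ℤ) :
    phi' X (i - k - 1) (i - 1) =
      plucker X (initSet k ℓ (numMutable k ℓ + resIcc ℓ (i - 1))) := by
  rw [phi'_outer hkn, plucker_frozen hper hℓ hkn, sub_add_cancel]

theorem eta_min (hs : s ≤ k) : eta k p (min s (k - s)) = eta k p s := by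
  rcases min_choice s (k - s) with h | h <;> rw [h]
  rw [eta, eta, Nat.sub_sub_self hs, mul_comm]

theorem cycPoint_frozen [NeZero ℓ] (a : ℤ) :
    cycPoint ℓ p X (.frozen a) = plucker X (initSet k ℓ (numMutable k ℓ + resIcc ℓ a)) := by
  rw [cycPoint, resIcc, resIcc, ZMod.val_intCast, Int.emod_sub_emod]

theorem eval_cycPoint_psiVar (hk : 1 ≤ k) (hkℓ : k < ℓ) (hp : k ≤ p) (hn : n = p * ℓ)
    (hX : X ∈ distinguished k n ℓ) (v : GSVVar k ℓ) :
    MvPolynomial.eval (cycPoint ℓ p X) (psiVar k ℓ v) = gsvPoint k ℓ (phi' X) v := by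
  have : NeZero k := ⟨by omega⟩
  have : NeZero ℓ := ⟨by omega⟩
  have hkn : k * ℓ ≤ n := hn ▸ Nat.mul_le_mul_right _ hp
  have hkn' : k < n := (hkℓ.trans_le (Nat.le_mul_of_pos_left ℓ hk)).trans_le hkn
  have : NeZero n := ⟨by omega⟩
  have hper := colMinor_image_add_of_mem_distinguished hn hX
  have hfrozen := cycPoint_frozen (ℓ := ℓ) (p := p) (X := X)
  cases v with
  | x i =>
    rw [gsvPoint, initMinor_phi' hper hkn (mem_Icc.2 i.2), psiVar, map_mul, map_prod]
    refine congrArg₂ _ (MvPolynomial.eval_X _) (prod_congr rfl fun b _ => ?_)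
    rw [MvPolynomial.eval_X, ← hfrozen]
    push_cast
    rfl
  | diag j =>
    rw [gsvPoint, phi'_diag_eq_plucker hper (by omega) hkn', ← hfrozen, psiVar, MvPolynomial.eval_X]
    simp
  | outer j =>
    have h := phi'_outer_eq_plucker hper (by omega) hkn' (j.val + k + 1)
    rw [add_sub_cancel_right, add_sub_right_comm, add_sub_cancel_right, add_sub_cancel_right] at h
    rw [gsvPoint, h, ← hfrozen, psiVar, MvPolynomial.eval_X]
    simp
  | c s =>
    rw [gsvPoint, coeffString_phi' hkℓ hp hn hX (mem_Icc.2 s.2), psiVar.eq_def, map_mul, map_prod,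
      MvPolynomial.eval_X]
    refine congrArg₂ _ (eta_min (by have := s.2.2; omega)) (prod_congr rfl fun i hi => ?_)
    rw [MvPolynomial.eval_X, ← resIcc_natCast hi, ← hfrozen, Int.cast_natCast, resIcc_natCast hi]

end Specialization

end CyclicLocus

end

theorem proposition8p3_general (k ℓ p n : ℕ) (hk : 2 ≤ k) (hkℓ : k < ℓ) (hp : k ≤ p)
    (hn : n = p * ℓ) :
    (∀ X ∈ distinguished k n ℓ,
      phi' X ∈ band k ℓ ∧
      (∀ i ∈ Finset.Icc 1 (numMutable k ℓ),
        initMinor k ℓ i (phi' X) = plucker X (initSet k ℓ i) *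
          ∏ b ∈ Finset.Ico i (numMutable k ℓ),
            plucker X (initSet k ℓ (numMutable k ℓ + resIcc ℓ (b + k)))) ∧
      (∀ i : ℤ,
        phi' X i i = plucker X (initSet k ℓ (numMutable k ℓ + resIcc ℓ (i - 1))) ∧
        phi' X (i - k - 1) (i - 1) =
          plucker X (initSet k ℓ (numMutable k ℓ + resIcc ℓ (i - 1))))) ∧
    (∀ X ∈ distinguished k n ℓ, ∀ s ∈ Finset.Icc 1 (k - 1),
      coeffString k ℓ s (phi' X) =
        eta k p s * ∏ i ∈ Finset.Icc 1 ℓ, plucker X (initSet k ℓ (numMutable k ℓ + i))) ∧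
    ∃ ψ : GSVField k ℓ → CycField k ℓ,
      PsiOnVariables k ℓ ψ ∧ PsiOnCoefficients k ℓ ψ ∧
      IsQuasiHom (numMutable k ℓ) (gsvCoeff k ℓ) (gsvSeed k ℓ) (cycCoeff k ℓ) (cycSeed k ℓ) ψ ∧
      ∀ X ∈ distinguished k n ℓ, ∀ f ∈ ambient (numMutable k ℓ) (gsvCoeff k ℓ) (gsvSeed k ℓ),
        ∀ c : ℂ, HasValueAt (gsvPoint k ℓ (phi' X)) f c → HasValueAt (cycPoint ℓ p X) (ψ f) c := by
  have : NeZero k := ⟨by omega⟩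
  have hkn : k * ℓ ≤ n := hn ▸ Nat.mul_le_mul_right _ hp
  have hkn' : k < n := (hkℓ.trans_le (Nat.le_mul_of_pos_left ℓ (by omega))).trans_le hkn
  have hℓ : 0 < ℓ := by omega
  have : NeZero n := ⟨by omega⟩
  have hper {X} (hX : X ∈ distinguished k n ℓ) := colMinor_image_add_of_mem_distinguished hn hX
  refine ⟨fun X hX => ⟨phi'_mem_band (hper hX) hkn', fun i => initMinor_phi' (hper hX) hkn,
    fun i => ⟨phi'_diag_eq_plucker (hper hX) hℓ hkn' i,
      phi'_outer_eq_plucker (hper hX) hℓ hkn' i⟩⟩,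
    fun X hX s => coeffString_phi' hkℓ hp hn hX, psi k ℓ, psiOnVariables hℓ, psiOnCoefficients,
    isQuasiHom_psi hk hkℓ, fun X hX f _ c hc => ?_⟩
  rw [← funext (eval_cycPoint_psiVar (by omega) hkℓ hp hn hX)] at hc
  exact hc.substitute

theorem proposition8p3 (k ℓ p n : ℕ) (hk : 2 ≤ k) (hkℓ : k < ℓ) (hp : k ≤ p) (hn : n = p * ℓ) :
    -- for every `k`: cluster variables and frozen entries
    (∀ X ∈ distinguished k n ℓ,
      phi' X ∈ band k ℓ ∧
      (∀ i ∈ Finset.Icc 1 (numMutable k ℓ),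
        initMinor k ℓ i (phi' X) = plucker X (initSet k ℓ i) *
          ∏ b ∈ Finset.Ico i (numMutable k ℓ),
            plucker X (initSet k ℓ (numMutable k ℓ + resIcc ℓ (b + k)))) ∧
      (∀ i : ℤ,
        phi' X i i = plucker X (initSet k ℓ (numMutable k ℓ + resIcc ℓ (i - 1))) ∧
        phi' X (i - k - 1) (i - 1) =
          plucker X (initSet k ℓ (numMutable k ℓ + resIcc ℓ (i - 1))))) ∧
    (k = 2 ∨ k = 3 →
      -- coefficient strings
      (∀ X ∈ distinguished k n ℓ, ∀ s ∈ Finset.Icc 1 (k - 1),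
        coeffString k ℓ s (phi' X) =
          eta k p s * ∏ i ∈ Finset.Icc 1 ℓ, plucker X (initSet k ℓ (numMutable k ℓ + i))) ∧
      -- the pullback realizes the quasi-homomorphism
      ∃ ψ : GSVField k ℓ → CycField k ℓ,
        PsiOnVariables k ℓ ψ ∧ PsiOnCoefficients k ℓ ψ ∧
        IsQuasiHom (numMutable k ℓ) (gsvCoeff k ℓ) (gsvSeed k ℓ) (cycCoeff k ℓ) (cycSeed k ℓ) ψ ∧
        ∀ X ∈ distinguished k n ℓ, ∀ f ∈ ambient (numMutable k ℓ) (gsvCoeff k ℓ) (gsvSeed k ℓ),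
          ∀ c : ℂ, HasValueAt (gsvPoint k ℓ (phi' X)) f c → HasValueAt (cycPoint ℓ p X) (ψ f) c) := by
  obtain ⟨hentries, hrest⟩ := proposition8p3_general k ℓ p n hk hkℓ hp hn
  exact ⟨hentries, fun _ => hrest⟩
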